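/- **Setting.** A 2-stratifold is a compact connected Hausdorff space \(X\) with a closed subset \(X_1\) (a closed 1-manifold) such that every \(x\in X_1\) has an open neighbourhood \(U\) with \((U,U\cap X_1)\cong(\mathbb R\times CL,\ \mathbb R\times\{\text{apex}\})\), where \(CL\) is the open cone on a finite set \(L\) with \(|L|>2\), and every \(x\in X\setminus X_1\) has a neighbourhood homeomorphic to \(\mathbb R^2\). Its family of surfaces \(\mathcal M=\{M_i\}\) is indexed by the connected components of \(X\setminus X_1\) (the interiors of the \(M_i\)). Let \(K\) be a finite triangulation of \(X\), written as a collection of triangulated polygons \(P_i\) with identified sides, one for each \(M_i\in\mathcal M\): each \(P_i\) is a finite simplicial complex in the Euclidean plane whose underlying space is a closed disc, and there are simplicial maps \(q_i:P_i\to K\) that collapse no simplex, are jointly onto, identify only simplices lying on the polygonal boundaries \(\partial P_i\), and are such that the image of \(P_i\) is the subcomplex \(K_i\) whose underlying space is the closure of the \(i\)-th component of \(X\setminus X_1\). A vertex or edge of \(P_i\) is a *boundary* vertex or edge if it lies on \(\partial P_i\); other vertices are *internal*. A non-boundary edge is a *crossing* edge if it connects two boundary vertices, a *bridge* edge if it connects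 an internal and a boundary vertex, and an *internal* edge if it connects two internal vertices. The crossing edges cut \(P_i\) into smaller polygons \(P_{i,1},\dots,P_{i,r_i}\). **Algorithm.** 1. For each \(i\): (a) In each \(P_{i,j}\) that has internal vertices, choose a boundary vertex \(b\) and a bridge edge of \(P_{i,j}\) joining it to an internal vertex, and choose a spanning tree of the graph formed by \(b\), this bridge edge and all internal vertices and internal edges of \(P_{i,j}\). Let \(V_{i,j}\) consist of all pairs \((w,e)\), where \(e\) is an edge of the spanning tree and \(w\) is its endpoint farther from \(b\). (If \(P_{i,j}\) has no internal vertices, \(V_{i,j}=\varnothing\).) (b) Let \(T_i\) be the graph whose vertices are the 2-cells of \(P_i\), two of them being adjacent if they share a non-boundary edge that was not used in the spanning trees of (a) (crossing edges are never used there). (c) Choose a root 2-cell \(F_{i,0}\). Let \(V_{T_i}\) consist of all pairs \((e,F)\), where \(e\) is the shared edge corresponding to an edge of \(T_i\) and \(F\) is the endpoint of that edge of \(T_i\) farther from \(F_{i,0}\) in \(T_i\). 2. In the graph formed by the boundary vertices and boundary edges of all polygons, after all identifications, choose a spanning tree and a root. Let \(V_B\) consist of all pairs \((w,e)\), where \(e\)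 is an edge of this tree and \(w\) is its endpoint farther from the root. 3. Put \(V=V_B\cup\bigcup_i V_{T_i}\cup\bigcup_{i,j}V_{i,j}\), all cells being regarded as cells of \(K\). **Discrete Morse theory.** Write \(\tau<\sigma\) if \(\tau\) is a face of \(\sigma\) of codimension one. A discrete vector field is a set of pairs \((\tau,\sigma)\) of cells of \(K\) with \(\tau<\sigma\) in which every cell appears in at most one pair. A closed \(V\)-path is a sequence \(\tau_0<\sigma_0>\tau_1<\dots<\sigma_{r-1}>\tau_r\) with \((\tau_j,\sigma_j)\in V\) and \(\tau_j\ne\tau_{j+1}\) for all \(0\le j<r\), \(r\ge 2\) and \(\tau_r=\tau_0\). A function \(f:K\to\mathbb R\) is a discrete Morse function if for each cell \(\sigma\) there is at most one \(\tau\) with \(\sigma<\tau\), \(f(\tau)\le f(\sigma)\), and at most one \(\tau\) with \(\tau<\sigma\), \(f(\sigma)\le f(\tau)\); \(\sigma\) is critical if there are none of either kind; and \(-\nabla f=\{(\tau,\sigma):\tau<\sigma,\ f(\tau)\ge f(\sigma)\}\). **Theorem.** The algorithm can be carried out, and for all choices made in it the following hold. Each \(T_i\) is a tree. The set \(V\)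 is a discrete vector field on \(K\), and it has no closed \(V\)-paths. There is a discrete Morse function \(f\) with \(-\nabla f=V\), and every such \(f\) has exactly one critical cell of dimension \(0\) and exactly \(|\mathcal M|\) critical cells of dimension \(2\). -/

import Mathlib

namespace StratifoldMorse

open Geometry

universe u v

/-! ### Discrete Morse theory on a geometric simplicial complex -/

section Morse

variable {E : Type v} [AddCommGroup E] [Module ℝ E]

/-- The cells of a simplicial complex are its (nonempty, closed) simplices. -/
abbrev Cell (K : SimplicialComplex ℝ E) : Type v := {s : Finset E // s ∈ K.faces}

/-- `σ` has dimension `i`. -/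
def HasDim {K : SimplicialComplex ℝ E} (σ : Cell K) (i : ℕ) : Prop := σ.1.card = i + 1

/-- `τ` is a face of `σ` of codimension one. -/
def IsFacet {K : SimplicialComplex ℝ E} (τ σ : Cell K) : Prop :=
  τ.1 ⊆ σ.1 ∧ σ.1.card = τ.1.card + 1

/-- The exceptional cofacets of `σ`. -/
def upSet {K : SimplicialComplex ℝ E} (f : Cell K → ℝ) (σ : Cell K) : Set (Cell K) :=
  {τ | IsFacet σ τ ∧ f τ ≤ f σ}

/-- The exceptional facets of `σ`. -/
def downSet {K : SimplicialComplex ℝ E} (f : Cell K → ℝ) (σ : Cell K) : Set (Cell K) :=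
  {τ | IsFacet τ σ ∧ f σ ≤ f τ}

/-- Discrete Morse functions. -/
def IsDiscreteMorse {K : SimplicialComplex ℝ E} (f : Cell K → ℝ) : Prop :=
  ∀ σ, (upSet f σ).encard ≤ 1 ∧ (downSet f σ).encard ≤ 1

/-- Critical cells of a function on the cells. -/
def IsCritical {K : SimplicialComplex ℝ E} (f : Cell K → ℝ) (σ : Cell K) : Prop :=
  (upSet f σ).encard = 0 ∧ (downSet f σ).encard = 0

/-- The set of critical cells of dimension `i`. -/
def criticalCells {K : SimplicialComplex ℝ E} (f : Cell K → ℝ) (i : ℕ) : Set (Cell K) :=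
  {σ | HasDim σ i ∧ IsCritical f σ}

/-- A discrete vector field: a set of pairs (facet, cell) such that every cell appears in at most
one pair. -/
def IsDiscreteVectorField {K : SimplicialComplex ℝ E} (V : Set (Cell K × Cell K)) : Prop :=
  (∀ p ∈ V, IsFacet p.1 p.2) ∧
  ∀ σ : Cell K, ∀ p ∈ V, ∀ p' ∈ V,
    (p.1 = σ ∨ p.2 = σ) → (p'.1 = σ ∨ p'.2 = σ) → p = p'

/-- The set of pairs `-∇f` induced by `f`. -/
def negGradient {K : SimplicialComplex ℝ E} (f : Cell K → ℝ) : Set (Cell K × Cell K) :=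
  {p | IsFacet p.1 p.2 ∧ f p.2 ≤ f p.1}

/-- The cells `τ 0 < σ 0 > τ 1 < σ 1 > ⋯ < σ (r - 1) > τ r` form a `V`-path
(the values of `τ` beyond `r` and of `σ` beyond `r - 1` are irrelevant). -/
def IsVPath {K : SimplicialComplex ℝ E} (V : Set (Cell K × Cell K)) (r : ℕ)
    (τ σ : ℕ → Cell K) : Prop :=
  ∀ j < r, (τ j, σ j) ∈ V ∧ IsFacet (τ j) (σ j) ∧ IsFacet (τ (j + 1)) (σ j) ∧ τ j ≠ τ (j + 1)

/-- There is a closed `V`-path. -/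
def HasClosedVPath {K : SimplicialComplex ℝ E} (V : Set (Cell K × Cell K)) : Prop :=
  ∃ (r : ℕ) (τ σ : ℕ → Cell K), 2 ≤ r ∧ IsVPath V r τ σ ∧ τ 0 = τ r

end Morse

/-! ### 2-stratifolds -/

/-- The open cone on a set of `k` points: `k` half-open unit segments, placed on the coordinate
axes of `ℝ^k`, glued at the apex `0`. -/
def openCone (k : ℕ) : Set (Fin k → ℝ) :=
  {t | (∀ i, 0 ≤ t i ∧ t i < 1) ∧ ∀ i j, t i ≠ 0 → t j ≠ 0 → i = j}

/-- `X`, with the filtration `∅ ⊆ X₁ ⊆ X`, is a 2-stratifold: `X` is compact, connected and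
Hausdorff, `X₁` is closed, near each of its points the pair `(X, X₁)` looks like
`(ℝ × CL, ℝ × apex)` for a finite set `L` with more than two points (so `X₁` is a closed
1-manifold), and `X` is locally homeomorphic to `ℝ²` off `X₁`. -/
structure IsTwoStratifold (X : Type u) [TopologicalSpace X] (X₁ : Set X) : Prop where
  compact : CompactSpace X
  connected : ConnectedSpace X
  hausdorff : T2Space X
  isClosed : IsClosed X₁
  book : ∀ x ∈ X₁, ∃ k : ℕ, 2 < k ∧ ∃ φ : ℝ × openCone k → X,
    Topology.IsOpenEmbedding φ ∧ x ∈ Set.range φ ∧ ∀ p, φ p ∈ X₁ ↔ p.2.1 = 0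
  plane : ∀ x ∉ X₁, ∃ φ : EuclideanSpace ℝ (Fin 2) → X,
    Topology.IsOpenEmbedding φ ∧ x ∈ Set.range φ

/-- The index set of the family of surfaces of a 2-stratifold: a compact surface `M` of the family
is attached along its boundary to `X₁`, and the interiors of these surfaces are the connected
components of `X ∖ X₁`. -/
abbrev Surface {X : Type u} [TopologicalSpace X] (X₁ : Set X) : Type u :=
  ConnectedComponents {x : X // x ∉ X₁}

/-- The component of `X ∖ X₁` with index `c`, as a subset of `X`. -/
def Surface.openCarrier {X : Type u} [TopologicalSpace X] {X₁ : Set X} (c : Surface X₁) : Set X :=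
  {x | ∃ hx : x ∉ X₁, (ConnectedComponents.mk (⟨x, hx⟩ : {x : X // x ∉ X₁})) = c}

/-! ### Triangulated polygons -/

section Polygon

/-- The Euclidean plane. -/
abbrev Plane : Type := EuclideanSpace ℝ (Fin 2)

/-- A triangulated polygon: a finite simplicial complex in the Euclidean plane whose underlying
space is homeomorphic to the closed disc. -/
def IsPolygon (P : SimplicialComplex ℝ Plane) : Prop :=
  P.faces.Finite ∧ Nonempty (P.space ≃ₜ Metric.closedBall (0 : Plane) 1)

/-- The simplex with vertex set `s` lies on the boundary of the polygon `P`. -/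
def OnBoundary (P : SimplicialComplex ℝ Plane) (s : Finset Plane) : Prop :=
  convexHull ℝ (s : Set Plane) ⊆ frontier P.space

def IsBoundaryVertex (P : SimplicialComplex ℝ Plane) (v : Plane) : Prop :=
  {v} ∈ P.faces ∧ OnBoundary P {v}

def IsInternalVertex (P : SimplicialComplex ℝ Plane) (v : Plane) : Prop :=
  {v} ∈ P.faces ∧ ¬ OnBoundary P {v}

def IsEdge (P : SimplicialComplex ℝ Plane) (e : Finset Plane) : Prop :=
  e ∈ P.faces ∧ e.card = 2

def IsBoundaryEdge (P : SimplicialComplex ℝ Plane) (e : Finset Plane) : Prop :=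
  IsEdge P e ∧ OnBoundary P e

/-- An edge off the polygonal boundary that connects two boundary vertices. -/
def IsCrossingEdge (P : SimplicialComplex ℝ Plane) (e : Finset Plane) : Prop :=
  IsEdge P e ∧ ¬ OnBoundary P e ∧ ∀ v ∈ e, IsBoundaryVertex P v

/-- An edge that connects an internal vertex with a boundary vertex. -/
def IsBridgeEdge (P : SimplicialComplex ℝ Plane) (e : Finset Plane) : Prop :=
  IsEdge P e ∧ (∃ v ∈ e, IsInternalVertex P v) ∧ ∃ v ∈ e, IsBoundaryVertex P v

/-- An edge that connects two internal vertices. -/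
def IsInternalEdge (P : SimplicialComplex ℝ Plane) (e : Finset Plane) : Prop :=
  IsEdge P e ∧ ∀ v ∈ e, IsInternalVertex P v

/-- The 2-cells of `P`. -/
abbrev Triangle (P : SimplicialComplex ℝ Plane) : Type :=
  {t : Finset Plane // t ∈ P.faces ∧ t.card = 3}

/-- The graph on the 2-cells of `P` in which two 2-cells are connected if and only if they share an
edge that belongs to `S`. -/
def dualGraph (P : SimplicialComplex ℝ Plane) (S : Set (Finset Plane)) :
    SimpleGraph (Triangle P) :=
  SimpleGraph.fromRel fun t t' => ∃ e ∈ S, IsEdge P e ∧ e ⊆ t.1 ∧ e ⊆ t'.1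

/-- The smaller polygons into which the crossing edges cut `P`, given through their 2-cells: two
2-cells lie in the same piece if and only if one can walk from one to the other across edges that
are neither boundary edges nor crossing edges. -/
abbrev Piece (P : SimplicialComplex ℝ Plane) : Type :=
  (dualGraph P {e | ¬ OnBoundary P e ∧ ¬ IsCrossingEdge P e}).ConnectedComponent

/-- The simplex `s` belongs to the piece `j`. -/
def InPiece {P : SimplicialComplex ℝ Plane} (j : Piece P) (s : Finset Plane) : Prop :=
  ∃ t ∈ j.supp, s ⊆ t.1

/-- The internal vertices of `P` that belong to the piece `j`. -/
def internalVertices {P : SimplicialComplex ℝ Plane} (j : Piece P) : Set Plane :=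
  {v | IsInternalVertex P v ∧ InPiece j {v}}

end Polygon

/-! ### The construction of the vector field -/

/-- The pairs `(a, {a, b})` for which `{a, b}` is an edge of the graph `T` (on the vertex set `S`)
and `a` is the endpoint of this edge farther from the root `r`. -/
def rootedPairs {α : Type*} {S : Set α} (T : SimpleGraph S) (r : S) :
    Set (Finset α × Finset α) :=
  {p | ∃ a b : S, T.Adj a b ∧ T.dist r b < T.dist r a ∧
    (p.1 : Set α) = {a.1} ∧ (p.2 : Set α) = {a.1, b.1}}

/-- The graph of all internal vertices and internal edges of the piece `j`, along with the vertex
`b` and the edge `{b, w}`. -/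
def pieceGraph {P : SimplicialComplex ℝ Plane} (j : Piece P) (b w : Plane) :
    SimpleGraph (insert b (internalVertices j) : Set Plane) :=
  SimpleGraph.fromRel fun x y => ∃ e : Finset Plane, (e : Set Plane) = {x.1, y.1} ∧
    InPiece j e ∧ (IsInternalEdge P e ∨ (e : Set Plane) = {b, w})

/-- The choices made in one piece: a boundary vertex `b`, a bridge edge `{b, w}` of the piece that
connects it with the internal graph, and a spanning tree of the resulting graph. -/
structure PieceChoice {P : SimplicialComplex ℝ Plane} (j : Piece P) where
  b : Plane
  w : Plane
  bridge : Finset Plane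
  coe_bridge : (bridge : Set Plane) = {b, w}
  isBridge : IsBridgeEdge P bridge
  bridge_inPiece : InPiece j bridge
  b_boundary : IsBoundaryVertex P b
  w_internal : w ∈ internalVertices j
  T : SimpleGraph (insert b (internalVertices j) : Set Plane)
  T_le : T ≤ pieceGraph j b w
  isTree : T.IsTree

/-- The vertex-edge pairs of the spanning tree of a piece, rooted at its boundary vertex. -/
def PieceChoice.pairs {P : SimplicialComplex ℝ Plane} {j : Piece P} (C : PieceChoice j) :
    Set (Finset Plane × Finset Plane) :=
  rootedPairs C.T ⟨C.b, Set.mem_insert _ _⟩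

/-- The edges of the spanning tree of a piece. -/
def PieceChoice.usedEdges {P : SimplicialComplex ℝ Plane} {j : Piece P} (C : PieceChoice j) :
    Set (Finset Plane) :=
  {e | ∃ x y, C.T.Adj x y ∧ (e : Set Plane) = {x.1, y.1}}

section Presentation

variable {E : Type v} [NormedAddCommGroup E] [NormedSpace ℝ E]

open Classical in
/-- The image of a simplex under a vertex map. -/
noncomputable def push (q : Plane → E) (s : Finset Plane) : Finset E := s.image q

/-- The triangulation `K` of the stratifold `X`, written as a collection of triangulated polygons
with identified sides, one polygon `P i` for each surface. The vertex maps `q i` describe the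
quotient map: it is simplicial and does not collapse any simplex, it is onto, it identifies only
simplices on the boundaries of the polygons, and the image of `P i` is the subcomplex of `K` that
corresponds to the surface `i`. -/
structure PolygonPresentation {X : Type u} [TopologicalSpace X] (X₁ : Set X)
    (K : SimplicialComplex ℝ E) (h : K.space ≃ₜ X) where
  P : Surface X₁ → SimplicialComplex ℝ Plane
  isPolygon : ∀ i, IsPolygon (P i)
  q : Surface X₁ → Plane → E
  map_mem : ∀ i, ∀ s ∈ (P i).faces, push (q i) s ∈ K.faces
  map_injOn : ∀ i, ∀ s ∈ (P i).faces, Set.InjOn (q i) (s : Set Plane)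
  map_surj : ∀ σ ∈ K.faces, ∃ i, ∃ s ∈ (P i).faces, push (q i) s = σ
  map_glue : ∀ i j, ∀ s ∈ (P i).faces, ∀ t ∈ (P j).faces, push (q i) s = push (q j) t →
    ¬ OnBoundary (P i) s → i = j ∧ s = t
  map_carrier : ∀ i,
    h '' {x | ∃ s ∈ (P i).faces, (x : E) ∈ convexHull ℝ (push (q i) s : Set E)} =
      closure i.openCarrier

variable {X : Type u} [TopologicalSpace X] {X₁ : Set X} {K : SimplicialComplex ℝ E}
  {h : K.space ≃ₜ X}

/-- The boundary vertices of `K`. -/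
def PolygonPresentation.boundaryVertices (D : PolygonPresentation X₁ K h) : Set E :=
  {x | ∃ i v, IsBoundaryVertex (D.P i) v ∧ D.q i v = x}

/-- The graph of the boundary vertices and boundary edges of `K`, after all identifications. -/
def PolygonPresentation.boundaryGraph (D : PolygonPresentation X₁ K h) :
    SimpleGraph D.boundaryVertices :=
  SimpleGraph.fromRel fun x y => ∃ i e, IsBoundaryEdge (D.P i) e ∧
    (push (D.q i) e : Set E) = {x.1, y.1}

/-- All choices made in one execution of the algorithm: in every piece of every polygon a bridge
edge and a spanning tree (a piece without internal vertices has no bridge edge, and nothing is done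
there), in every polygon a root 2-cell, and a rooted spanning tree of the boundary graph. -/
structure Run (D : PolygonPresentation X₁ K h) where
  piece : ∀ i (j : Piece (D.P i)), (internalVertices j).Nonempty → PieceChoice j
  rootFace : ∀ i, Triangle (D.P i)
  bdTree : SimpleGraph D.boundaryVertices
  bdTree_le : bdTree ≤ D.boundaryGraph
  bdTree_isTree : bdTree.IsTree
  bdRoot : D.boundaryVertices

namespace Run

variable {D : PolygonPresentation X₁ K h} (R : Run D)

/-- The edges of `P i` that are used by the spanning trees of its pieces. -/
def usedEdges (i : Surface X₁) : Set (Finset Plane) :=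
  {e | ∃ j hj, e ∈ (R.piece i j hj).usedEdges}

/-- The edges of `P i` whose duals are the edges of the dual graph: within the pieces the
non-boundary edges not used by the spanning trees, and between the pieces the crossing edges. -/
def dualEdges (i : Surface X₁) : Set (Finset Plane) :=
  {e | IsEdge (D.P i) e ∧ ¬ OnBoundary (D.P i) e ∧
    (e ∉ R.usedEdges i ∨ IsCrossingEdge (D.P i) e)}

/-- The graph on the 2-cells of `P i` obtained by connecting the dual graphs of the pieces by the
duals of the crossing edges. -/
def dualTree (i : Surface X₁) : SimpleGraph (Triangle (D.P i)) :=
  dualGraph (D.P i) (R.dualEdges i)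

/-- The vertex-edge pairs coming from the piece `j` of the polygon `P i`. -/
def vertexPairs (i : Surface X₁) (j : Piece (D.P i)) : Set (Cell K × Cell K) :=
  {p | ∃ hj, ∃ p' ∈ (R.piece i j hj).pairs,
    p.1.1 = push (D.q i) p'.1 ∧ p.2.1 = push (D.q i) p'.2}

/-- The edge-face pairs coming from the polygon `P i`: each edge `e` whose dual connects `F` and
`F'` is paired with the one, `F`, that is farther from the root. -/
def facePairs (i : Surface X₁) : Set (Cell K × Cell K) :=
  {p | ∃ F F' : Triangle (D.P i), ∃ e ∈ R.dualEdges i, F ≠ F' ∧ e ⊆ F.1 ∧ e ⊆ F'.1 ∧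
    (R.dualTree i).dist (R.rootFace i) F' < (R.dualTree i).dist (R.rootFace i) F ∧
    p.1.1 = push (D.q i) e ∧ p.2.1 = push (D.q i) F.1}

/-- The vertex-edge pairs on the boundary graph. -/
def boundaryPairs : Set (Cell K × Cell K) :=
  {p | (p.1.1, p.2.1) ∈ rootedPairs R.bdTree R.bdRoot}

/-- The output of the algorithm. -/
def V : Set (Cell K × Cell K) :=
  R.boundaryPairs ∪ (⋃ i, R.facePairs i) ∪ ⋃ i, ⋃ j, R.vertexPairs i j

end Run

end Presentation

end StratifoldMorse

namespace StratifoldMorse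

open Geometry Set Metric Topology

/-! ### Planar topology -/

/-! Two facts carry the proof: in each polygon the dual graph is a tree, and a single potential
decreases along all paths of the vector field.

The edges outside the dual set of a polygon are the boundary edges and the edges of the spanning
trees. They join all vertices, because the frontier of a disc is connected and each spanning tree
hangs on it at its boundary vertex. Suppose that the dual graph had a cycle. The signed crossing
numbers of this closed walk with the edges of the polygon form an integral cocycle, and on a disc
every such cocycle is the coboundary of a vertex function (`IsPolygon.exists_potential`). This
function is constant along uncrossed edges, hence constant on all vertices, although its values at
the ends of an edge crossed exactly once differ by one (`IsPolygon.isAcyclic_dualGraph`). Suppose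
instead that the dual graph were disconnected. The edges separating a component from the rest would
then be tree edges, and by parity an internal vertex never lies on exactly one of them, so a
separating edge farthest from the root of its tree would be followed by one still farther
(`IsPolygon.connected_polygonDual`).

The topology behind this is that a disc stays connected without finitely many points, and that its
complement and its frontier in the plane are connected. The first comes from the plane minus a
countable set; the others, and the vanishing of cocycles, come from continuous logarithms of
nonvanishing functions (`exists_log_plane`, `exists_log_disc`).

For the potential, vertices get negative values that grow with the distance from the root of their
tree, boundary vertices lying below all internal ones; triangles get positive values that shrink
with the distance from the root 2-cell. Giving each paired edge the value of its partner, and `0` to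
the other edges, produces a function with negative gradient `V` (`exists_negGradient_eq`), which
also rules out closed paths. A cell of dimension 0 or 2 is unpaired only if it has no parent: this
leaves the root of the boundary tree and one root 2-cell for each surface. The boundary tree exists
because `X`, hence the boundary graph, is connected (`PolygonPresentation.connected_boundaryGraph`).
-/

theorem one_lt_rank_plane : 1 < Module.rank ℝ Plane := by
  rw [← Module.finrank_eq_rank]
  simp

/-- The open ball is a homeomorphic image of the plane, in which the complement of a countable set
is connected. -/
theorem isPreconnected_ball_diff (c : Plane) {r : ℝ} (hr : 0 < r) {F : Set Plane}
    (hF : F.Finite) : IsPreconnected (ball c r \ F) := by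
  have h1 : ((OpenPartialHomeomorph.univBall c r) ⁻¹' F).Finite := by
    refine hF.preimage fun x _ y _ hxy => ?_
    exact (OpenPartialHomeomorph.univBall c r).injOn (by simp) (by simp) hxy
  have h2 := (h1.countable.isConnected_compl_of_one_lt_rank one_lt_rank_plane).isPreconnected.image
    _ (OpenPartialHomeomorph.continuous_univBall c r).continuousOn
  have h3 : OpenPartialHomeomorph.univBall c r '' univ = ball c r := by
    rw [← OpenPartialHomeomorph.univBall_source c r, OpenPartialHomeomorph.image_source_eq_target,
      OpenPartialHomeomorph.univBall_target c hr]
  suffices h4 : ball c r \ F = OpenPartialHomeomorph.univBall c r ''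
      (OpenPartialHomeomorph.univBall c r ⁻¹' F)ᶜ from h4 ▸ h2
  rw [← preimage_compl]
  ext y
  constructor
  · rintro ⟨hy, hyF⟩
    rw [← h3] at hy
    obtain ⟨x, -, rfl⟩ := hy
    exact ⟨x, hyF, rfl⟩
  · rintro ⟨x, hx, rfl⟩
    exact ⟨h3 ▸ mem_image_of_mem _ (mem_univ x), hx⟩

theorem dense_compl_of_finite {F : Set Plane} (hF : F.Finite) : Dense Fᶜ :=
  hF.countable.dense_compl ℝ

/-- The set lies between the punctured open ball, which is connected, and its closure. -/
theorem isPreconnected_closedBall_diff {F : Set Plane} (hF : F.Finite) :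
    IsPreconnected (closedBall (0 : Plane) 1 \ F) := by
  refine (isPreconnected_ball_diff 0 one_pos hF).subset_closure
    (sdiff_subset_sdiff_left ball_subset_closedBall) ?_
  refine sdiff_subset.trans ?_
  rw [← closure_ball (0 : Plane) one_ne_zero]
  exact closure_minimal ((dense_compl_of_finite hF).open_subset_closure_inter isOpen_ball)
    isClosed_closure

/-- The complement of a finite set in a topological disc is connected. -/
theorem isPreconnected_disc_diff {S : Set Plane} (e : S ≃ₜ closedBall (0 : Plane) 1)
    {F : Set Plane} (hF : F.Finite) : IsPreconnected (S \ F) := by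
  set G : Set Plane := (fun x : S => (e x : Plane)) '' ((↑) ⁻¹' F) with hG
  have hGf : G.Finite := (hF.preimage Subtype.val_injective.injOn).image _
  have h1 := isPreconnected_closedBall_diff hGf
  have h2 : IsPreconnected {y : closedBall (0 : Plane) 1 | (y : Plane) ∉ G} := by
    rw [← IsInducing.subtypeVal.isPreconnected_image]
    convert h1 using 1
    ext y
    simp [and_comm]
  have h3 := h2.image (fun y => (e.symm y : Plane))
    (continuous_subtype_val.comp e.symm.continuous).continuousOn
  convert h3 using 1
  ext x
  constructor
  · rintro ⟨hx, hxF⟩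
    refine ⟨e ⟨x, hx⟩, ?_, by simp⟩
    rintro ⟨y, hy, hye⟩
    have : y = ⟨x, hx⟩ := e.injective (Subtype.ext hye)
    subst this
    exact hxF hy
  · rintro ⟨y, hy, rfl⟩
    refine ⟨(e.symm y).2, fun hF' => hy ⟨e.symm y, hF', by simp⟩⟩

theorem isConnected_disc {S : Set Plane} (e : S ≃ₜ closedBall (0 : Plane) 1) : IsConnected S := by
  refine ⟨⟨_, (e.symm ⟨0, by simp⟩).2⟩, ?_⟩
  simpa using isPreconnected_disc_diff e finite_empty

theorem isCompact_disc {S : Set Plane} (e : S ≃ₜ closedBall (0 : Plane) 1) : IsCompact S := by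
  have : CompactSpace (closedBall (0 : Plane) 1) :=
    isCompact_iff_compactSpace.1 (isCompact_closedBall _ _)
  exact isCompact_iff_compactSpace.2 e.symm.compactSpace

theorem infinite_disc {S : Set Plane} (e : S ≃ₜ closedBall (0 : Plane) 1) : S.Infinite := by
  intro hS
  have : Finite S := hS
  have h1 : Finite (closedBall (0 : Plane) 1) := Finite.of_equiv S e.toEquiv
  have h2 : (closedBall (0 : Plane) 1).Finite := h1
  exact infinite_of_mem_nhds (0 : Plane) (closedBall_mem_nhds _ one_pos) h2

/-- A nowhere vanishing continuous function on the plane has a continuous logarithm. -/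
theorem exists_log_plane {m : Plane → ℂ} (hm : Continuous m) (h0 : ∀ x, m x ≠ 0) :
    ∃ g : Plane → ℂ, Continuous g ∧ ∀ x, Complex.exp (g x) = m x := by
  -- The exponential is a covering of the nonzero numbers, so the map lifts from the simply
  -- connected plane.
  obtain ⟨F, ⟨-, hF⟩, -⟩ := Complex.isCoveringMapOn_exp.existsUnique_continuousMap_lifts
    ⟨m, hm⟩ (a₀ := 0) (e₀ := Complex.log (m 0)) (Complex.exp_log (h0 0)) (fun a => h0 a)
  exact ⟨F, F.continuous, fun x => congrFun hF x⟩

/-- A nowhere vanishing continuous function on a topological disc has a continuous logarithm. -/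
theorem exists_log_disc {S : Set Plane} (e : S ≃ₜ closedBall (0 : Plane) 1) {m : Plane → ℂ}
    (hm : ContinuousOn m S) (h0 : ∀ x ∈ S, m x ≠ 0) :
    ∃ g : Plane → ℂ, ContinuousOn g S ∧ ∀ x ∈ S, Complex.exp (g x) = m x := by
  classical
  have hb : ∀ x : Plane, (max 1 ‖x‖)⁻¹ • x ∈ closedBall (0 : Plane) 1 := by
    intro x
    have h1 : 0 < max 1 ‖x‖ := lt_max_of_lt_left one_pos
    rw [mem_closedBall_zero_iff, norm_smul, norm_inv, Real.norm_of_nonneg h1.le,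
      inv_mul_le_iff₀ h1, mul_one]
    exact le_max_right _ _
  -- The radial retraction of the plane onto the disc reduces the claim to functions on the whole
  -- plane.
  set ρ : Plane → closedBall (0 : Plane) 1 := fun x => ⟨_, hb x⟩
  have hρ : Continuous ρ := by
    have h1 : Continuous fun x : Plane => max 1 ‖x‖ := continuous_const.max continuous_norm
    exact Continuous.subtype_mk
      ((h1.inv₀ fun x => (lt_max_of_lt_left one_pos).ne').smul continuous_id) _
  have hm' : Continuous fun x => m (e.symm (ρ x)) :=
    (continuousOn_iff_continuous_domRestrict.1 hm).comp (e.symm.continuous.comp hρ)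
  obtain ⟨g, hg, hgm⟩ := exists_log_plane hm' fun x => h0 _ (e.symm (ρ x)).2
  have hρe : ∀ x : S, ρ (e x) = e x := by
    intro x
    apply Subtype.ext
    have : ‖(e x : Plane)‖ ≤ 1 := mem_closedBall_zero_iff.1 (e x).2
    simp [ρ, max_eq_left this]
  refine ⟨fun x => if h : x ∈ S then g (e ⟨x, h⟩) else 0, ?_, ?_⟩
  · rw [continuousOn_iff_continuous_domRestrict]
    have : S.domRestrict (fun x => if h : x ∈ S then g (e ⟨x, h⟩) else 0) = fun x : S => g (e x) := by
      ext x
      simp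
    rw [this]
    exact hg.comp (continuous_subtype_val.comp e.continuous)
  · intro x hx
    simp only [hx, dif_pos]
    rw [hgm, hρe]
    simp

/-! ### Complement and frontier of a topological disc. -/

theorem isPreconnected_compl_closedBall {R : ℝ} (hR : 0 ≤ R) :
    IsPreconnected (closedBall (0 : Plane) R)ᶜ := by
  have h1 : IsPreconnected (Ioi R ×ˢ sphere (0 : Plane) 1) :=
    isPreconnected_Ioi.prod (isConnected_sphere one_lt_rank_plane 0 zero_le_one).isPreconnected
  have h2 := h1.image (fun p => p.1 • p.2) (by fun_prop)
  convert h2 using 1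
  ext x
  constructor
  · intro hx
    have hx' : R < ‖x‖ := by simpa using hx
    have hx0 : ‖x‖ ≠ 0 := (hR.trans_lt hx').ne'
    refine ⟨(‖x‖, ‖x‖⁻¹ • x), ⟨hx', ?_⟩, ?_⟩
    · simp [norm_smul, hx0]
    · simp [smul_smul, hx0]
  · rintro ⟨⟨r, y⟩, ⟨hr, hy⟩, rfl⟩
    have hr' : R < r := hr
    have hy' : ‖y‖ = 1 := by simpa using hy
    simp [norm_smul, hy', abs_of_nonneg (hR.trans hr'.le), hr']

/-- The identification of the plane with the complex numbers. -/
noncomputable def planeToComplex : Plane ≃ₗᵢ[ℝ] ℂ := Complex.orthonormalBasisOneI.repr.symm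

/-- Components of an open set are open and those that meet coincide, so a frontier point outside `S`
would lie in the component itself. -/
theorem frontier_connectedComponentIn_compl_subset {S : Set Plane} (hS : IsClosed S) (p : Plane) :
    frontier (connectedComponentIn Sᶜ p) ⊆ S := by
  intro y hy
  by_contra hyS
  have hUo : IsOpen (connectedComponentIn Sᶜ p) := hS.isOpen_compl.connectedComponentIn
  rw [hUo.frontier_eq] at hy
  have hV : IsOpen (connectedComponentIn Sᶜ y) := hS.isOpen_compl.connectedComponentIn
  obtain ⟨z, hz1, hz2⟩ := mem_closure_iff.1 hy.1 _ hV (mem_connectedComponentIn hyS)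
  apply hy.2
  rw [connectedComponentIn_eq hz2, ← connectedComponentIn_eq hz1]
  exact mem_connectedComponentIn hyS

/-- A topological disc in the plane has no bounded complementary component. -/
theorem not_connectedComponentIn_compl_subset {S : Set Plane} (e : S ≃ₜ closedBall (0 : Plane) 1)
    {p : Plane} (hp : p ∉ S) (R : ℝ) : ¬ connectedComponentIn Sᶜ p ⊆ closedBall 0 R := by
  classical
  intro hU
  have hS : IsClosed S := (isCompact_disc e).isClosed
  set U := connectedComponentIn Sᶜ p with hUdef
  have hUo : IsOpen U := hS.isOpen_compl.connectedComponentIn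
  have hpU : p ∈ U := mem_connectedComponentIn hp
  have hUS : frontier U ⊆ S := frontier_connectedComponentIn_compl_subset hS p
  have hm : Continuous fun x : Plane => planeToComplex (x - p) := by fun_prop
  have hm0 : ∀ x, x ≠ p → planeToComplex (x - p) ≠ 0 := fun x hx => by
    simpa [sub_eq_zero] using hx
  -- Inside the bounded component `x - p` gets replaced by the exponential of an extended logarithm.
  -- The result has no zero on the plane but is still `x - p` on a large circle, where no continuous
  -- logarithm exists.
  obtain ⟨g, hg, hgm⟩ := exists_log_disc e hm.continuousOn
    (fun x hx => hm0 x (fun h => hp (h ▸ hx)))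
  obtain ⟨G, hG⟩ := ContinuousMap.exists_restrict_eq hS
    (⟨S.domRestrict g, continuousOn_iff_continuous_domRestrict.1 hg⟩ : C(S, ℂ))
  have hGg : ∀ x ∈ S, G x = g x := fun x hx => congrArg (fun f : C(S, ℂ) => f ⟨x, hx⟩) hG
  set M : Plane → ℂ := U.piecewise (fun x => Complex.exp (G x)) (fun x => planeToComplex (x - p))
  have hM : Continuous M := by
    refine Continuous.piecewise ?_ (by fun_prop) hm
    intro x hx
    rw [hGg x (hUS hx), hgm x (hUS hx)]
  have hM0 : ∀ x, M x ≠ 0 := by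
    intro x
    by_cases hx : x ∈ U
    · simp [M, hx]
    · simp only [M, hx, not_false_eq_true, piecewise_eq_of_notMem]
      exact hm0 x fun h => hx (h ▸ hpU)
  obtain ⟨L, hL, hLM⟩ := exists_log_plane hM hM0
  -- Chosen so that the circle of radius `r` about `p` lies outside `closedBall 0 R`, hence outside
  -- `U`.
  set r : ℝ := |R| + ‖p‖ + 1
  have hr : 0 < r := by positivity
  have hout : ∀ z : Plane, ‖z‖ = 1 → Complex.exp (L (p + r • z)) = r * planeToComplex z := by
    intro z hz
    rw [hLM]
    have : p + r • z ∉ U := by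
      intro h
      have h1 : ‖p + r • z‖ ≤ R := by simpa using hU h
      have h2 : ‖r • z‖ ≤ ‖p + r • z‖ + ‖p‖ := by
        simpa using norm_sub_le (p + r • z) p
      rw [norm_smul, hz, Real.norm_of_nonneg hr.le] at h2
      have := le_abs_self R
      simp only [r] at h2
      linarith
    simp [M, this]
  have hsph := isConnected_sphere one_lt_rank_plane (0 : Plane) zero_le_one
  -- An odd function on the circle has a zero `z`. There the logarithms at `z` and `-z` have equal
  -- imaginary parts; their real parts always agree, so `z = -z`.
  set k : Plane → ℝ := fun z => (L (p + r • z)).im - (L (p + r • (-z))).im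
  have hk : Continuous k := by
    have h1 : Continuous fun z : Plane => L (p + r • z) := hL.comp (by fun_prop)
    have h2 : Continuous fun z : Plane => L (p + r • (-z)) := hL.comp (by fun_prop)
    exact (Complex.continuous_im.comp h1).sub (Complex.continuous_im.comp h2)
  obtain ⟨z0, hz0⟩ := hsph.nonempty
  have hz0' : -z0 ∈ sphere (0 : Plane) 1 := by simpa using hz0
  have hodd : k (-z0) = - k z0 := by simp [k]
  have hzero : ∃ z ∈ sphere (0 : Plane) 1, k z = 0 := by
    rcases le_total (k z0) 0 with h | h
    · exact hsph.isPreconnected.intermediate_value₂ hz0 hz0' hk.continuousOn continuousOn_const h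
        (by simpa [hodd] using h)
    · exact hsph.isPreconnected.intermediate_value₂ hz0' hz0 hk.continuousOn continuousOn_const
        (by simpa [hodd] using h) h
  obtain ⟨z, hz, hkz⟩ := hzero
  have hz1 : ‖z‖ = 1 := by simpa using hz
  have e1 := hout z hz1
  have e2 := hout (-z) (by simpa using hz1)
  have hre : ∀ w : Plane, ‖w‖ = 1 → Real.exp (L (p + r • w)).re = r := by
    intro w hw
    rw [← Complex.norm_exp, hout w hw, norm_mul, LinearIsometryEquiv.norm_map, hw]
    simp [abs_of_pos hr]
  have hL' : L (p + r • z) = L (p + r • (-z)) := by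
    apply Complex.ext
    · exact Real.exp_injective ((hre z hz1).trans (hre (-z) (by simpa using hz1)).symm)
    · simpa [k, sub_eq_zero] using hkz
  rw [hL', e2, mul_right_inj' (by exact_mod_cast hr.ne')] at e1
  have : -z = z := planeToComplex.injective e1
  have h2 : z = 0 := by
    have h3 : (2 : ℝ) • z = 0 := by rw [two_smul]; nth_rewrite 1 [← this]; exact neg_add_cancel z
    exact (smul_eq_zero.1 h3).resolve_left two_ne_zero
  simp [h2] at hz1

/-- Every complementary component reaches beyond a large ball around the disc, and the exterior of
that ball is connected. -/
theorem isPreconnected_compl_disc {S : Set Plane} (e : S ≃ₜ closedBall (0 : Plane) 1) :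
    IsPreconnected Sᶜ := by
  obtain ⟨R, hR⟩ := (isCompact_disc e).isBounded.subset_closedBall (0 : Plane)
  have hR' : S ⊆ closedBall 0 |R| := hR.trans (closedBall_subset_closedBall (le_abs_self R))
  have hO := isPreconnected_compl_closedBall (abs_nonneg R)
  have hp : ∀ p ∈ Sᶜ, ∃ q ∈ (closedBall (0 : Plane) |R|)ᶜ, q ∈ connectedComponentIn Sᶜ p := by
    intro p hp
    obtain ⟨q, hq, hq'⟩ := not_subset.1 (not_connectedComponentIn_compl_subset e hp |R|)
    exact ⟨q, hq', hq⟩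
  refine isPreconnected_of_forall_pair fun x hx y hy => ?_
  obtain ⟨q, hqO, hq⟩ := hp x hx
  obtain ⟨q', hqO', hq'⟩ := hp y hy
  refine ⟨connectedComponentIn Sᶜ x ∪ (closedBall 0 |R|)ᶜ ∪ connectedComponentIn Sᶜ y, ?_,
    Or.inl (Or.inl (mem_connectedComponentIn hx)), Or.inr (mem_connectedComponentIn hy), ?_⟩
  · exact union_subset (union_subset (connectedComponentIn_subset _ _) (compl_subset_compl.2 hR'))
      (connectedComponentIn_subset _ _)
  · refine IsPreconnected.union q' (Or.inr hqO') hq' ?_ isPreconnected_connectedComponentIn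
    exact IsPreconnected.union q hq hqO isPreconnected_connectedComponentIn hO

/-- The values of `f` on `C` lie in the multiples of `2πi`, a countable and hence totally
disconnected set. -/
theorem _root_.IsPreconnected.eq_of_exp_eq_one {α : Type*} [TopologicalSpace α] {C : Set α}
    (hC : IsPreconnected C) {f : α → ℂ} (hf : ContinuousOn f C)
    (h : ∀ z ∈ C, Complex.exp (f z) = 1) {a b : α} (ha : a ∈ C) (hb : b ∈ C) : f a = f b := by
  have h1 : (range fun n : ℤ => (n : ℂ) * (2 * Real.pi * Complex.I)).Countable :=
    countable_range _
  refine h1.isTotallyDisconnected (f '' C) ?_ (hC.image f hf) (mem_image_of_mem _ ha)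
    (mem_image_of_mem _ hb)
  rintro _ ⟨z, hz, rfl⟩
  obtain ⟨n, hn⟩ := Complex.exp_eq_one_iff.1 (h z hz)
  exact ⟨n, hn.symm⟩

/-- The plane is unicoherent. -/
theorem isPreconnected_inter_of_union_eq_univ {A B : Set Plane} (hA : IsClosed A)
    (hB : IsClosed B) (hAc : IsPreconnected A) (hBc : IsPreconnected B) (hAB : A ∪ B = univ) :
    IsPreconnected (A ∩ B) := by
  classical
  rw [isPreconnected_closed_iff]
  rintro t t' ht ht' hsub ⟨x, hx, hxt⟩ ⟨y, hy, hyt⟩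
  by_contra hne
  rw [not_nonempty_iff_eq_empty] at hne
  obtain ⟨φ, h0, h1, -⟩ := exists_continuous_zero_one_of_isClosed
    ((hA.inter hB).inter ht) ((hA.inter hB).inter ht') (by
      rw [disjoint_iff_inter_eq_empty, ← hne]
      ext z
      simp only [mem_inter_iff]
      tauto)
  -- `M` is continuous because `φ` is `0` or `1` on `A ∩ B`. A logarithm of `M` differs from `φ * w`
  -- by a constant on `A` and is constant on `B`, which forces `φ x = φ y`.
  set w : ℂ := 2 * Real.pi * Complex.I
  set M : Plane → ℂ := A.piecewise (fun x => Complex.exp (φ x * w)) 1 with hMdef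
  have hBA : closure Aᶜ ⊆ B := closure_minimal (fun z hz => by
    have : z ∈ A ∪ B := hAB ▸ mem_univ z
    exact this.resolve_left hz) hB
  have hAB1 : ∀ z ∈ A ∩ B, Complex.exp (φ z * w) = 1 := by
    intro z hz
    rcases hsub hz with h | h
    · have : φ z = 0 := h0 ⟨hz, h⟩
      simp [this]
    · have : φ z = 1 := h1 ⟨hz, h⟩
      simp [this, w, Complex.exp_two_pi_mul_I]
  have hM : Continuous M := by
    refine Continuous.piecewise ?_ (by fun_prop) continuous_one
    intro z hz
    refine hAB1 z ⟨hA.frontier_subset hz, hBA ?_⟩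
    rw [frontier_eq_closure_inter_closure] at hz
    exact hz.2
  have hM0 : ∀ z, M z ≠ 0 := by
    intro z
    by_cases hz : z ∈ A <;> simp [M, hz]
  obtain ⟨L, hL, hLM⟩ := exists_log_plane hM hM0
  have cA := hAc.eq_of_exp_eq_one (f := fun z => L z - φ z * w) (by fun_prop) (fun z hz => by
    rw [Complex.exp_sub, hLM]
    simp [M, hz]) hx.1 hy.1
  have cB := hBc.eq_of_exp_eq_one hL.continuousOn (fun z hz => by
    rw [hLM]
    by_cases hzA : z ∈ A
    · simp [M, hzA, hAB1 z ⟨hzA, hz⟩]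
    · simp [M, hzA]) hx.2 hy.2
  have e0 : φ x = 0 := h0 ⟨hx, hxt⟩
  have e1 : φ y = 1 := h1 ⟨hy, hyt⟩
  have : w = 0 := by simpa [e0, e1, cB, eq_comm (a := L y)] using cA
  simp [w, Real.pi_ne_zero] at this

/-- The frontier is the intersection of the disc with the closure of its complement, so unicoherence
applies. -/
theorem isPreconnected_frontier_disc {S : Set Plane} (e : S ≃ₜ closedBall (0 : Plane) 1) :
    IsPreconnected (frontier S) := by
  have hS : IsClosed S := (isCompact_disc e).isClosed
  rw [frontier_eq_closure_inter_closure, hS.closure_eq]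
  refine isPreconnected_inter_of_union_eq_univ hS isClosed_closure
    (isConnected_disc e).isPreconnected (isPreconnected_compl_disc e).closure ?_
  exact eq_univ_of_univ_subset (union_compl_self S ▸ union_subset_union_right S subset_closure)

open scoped Classical

/-- A property that propagates between intersecting members of a finite closed cover of a connected
set holds for all members if it holds for one. -/
theorem _root_.IsPreconnected.forall_of_closed_cover {α ι : Type*} [TopologicalSpace α] [Finite ι]
    {S : Set α} (hS : IsPreconnected S) {C : ι → Set α} (hC : ∀ i, IsClosed (C i))
    (hcov : S ⊆ ⋃ i, C i) (hne : ∀ i, (S ∩ C i).Nonempty) {p : ι → Prop}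
    (hp : ∀ i j, (S ∩ (C i ∩ C j)).Nonempty → p i → p j) {i : ι} (hi : p i) (j : ι) : p j := by
  by_contra hj
  obtain ⟨x, hx, hx1, hx2⟩ := isPreconnected_closed_iff.1 hS (⋃ k : {k // p k}, C k)
    (⋃ k : {k // ¬ p k}, C k) (isClosed_iUnion_of_finite fun _ => hC _)
    (isClosed_iUnion_of_finite fun _ => hC _) (by
      intro x hx
      obtain ⟨k, hk⟩ := mem_iUnion.1 (hcov hx)
      by_cases h : p k
      · exact Or.inl (mem_iUnion.2 ⟨⟨k, h⟩, hk⟩)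
      · exact Or.inr (mem_iUnion.2 ⟨⟨k, h⟩, hk⟩))
    ((hne i).mono (inter_subset_inter_right _ (subset_iUnion (fun k : {k // p k} => C k) ⟨i, hi⟩)))
    ((hne j).mono
      (inter_subset_inter_right _ (subset_iUnion (fun k : {k // ¬ p k} => C k) ⟨j, hj⟩)))
  obtain ⟨k, hk⟩ := mem_iUnion.1 hx1
  obtain ⟨l, hl⟩ := mem_iUnion.1 hx2
  exact l.2 (hp k l ⟨x, hx, hk, hl⟩ k.2)

/-! ### The oriented area -/

/-- Twice the oriented area of a triangle in the plane. -/
noncomputable def area (a b c : Plane) : ℝ :=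
  (b 0 - a 0) * (c 1 - a 1) - (b 1 - a 1) * (c 0 - a 0)

theorem plane_ext {x y : Plane} (h0 : x 0 = y 0) (h1 : x 1 = y 1) : x = y := by
  ext i
  fin_cases i <;> assumption

theorem continuous_area {α : Type*} [TopologicalSpace α] {f g k : α → Plane} (hf : Continuous f)
    (hg : Continuous g) (hk : Continuous k) : Continuous fun x => area (f x) (g x) (k x) := by
  unfold area
  fun_prop

theorem area_rotate (a b c : Plane) : area b c a = area a b c := by
  unfold area
  ring

theorem area_swap (a b c : Plane) : area b a c = -area a b c := by
  unfold area
  ring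

theorem area_self_right (a b : Plane) : area a b b = 0 := by
  unfold area
  ring

theorem area_self_left (a b : Plane) : area a b a = 0 := by
  unfold area
  ring

theorem area_add_area_add_area (a b c x : Plane) :
    area x b c + area a x c + area a b x = area a b c := by
  unfold area
  ring

theorem area_smul_barycentric (a b c x : Plane) :
    area x b c • a + area a x c • b + area a b x • c = area a b c • x := by
  apply plane_ext <;> simp [area] <;> ring

theorem area_combination (a b p q r : Plane) {α β γ : ℝ} (h : α + β + γ = 1) :
    area a b (α • p + β • q + γ • r) = α * area a b p + β * area a b q + γ * area a b r := by
  obtain rfl : α = 1 - β - γ := by linarith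
  simp [area]
  ring

theorem mem_convexHull_triple {a b c x : Plane} :
    x ∈ convexHull ℝ ({a, b, c} : Set Plane) ↔ ∃ α β γ : ℝ, 0 ≤ α ∧ 0 ≤ β ∧ 0 ≤ γ ∧
      α + β + γ = 1 ∧ α • a + β • b + γ • c = x := by
  rw [convexHull_insert (insert_nonempty _ _), convexHull_pair, convexJoin_singleton_left]
  simp only [mem_iUnion, exists_prop]
  constructor
  · rintro ⟨y, ⟨u, v, hu, hv, huv, rfl⟩, ⟨s, t, hs, ht, hst, rfl⟩⟩
    refine ⟨s, t * u, t * v, hs, by positivity, by positivity, ?_, ?_⟩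
    · rw [add_assoc, ← mul_add, huv, mul_one, hst]
    · module
  · rintro ⟨α, β, γ, hα, hβ, hγ, h, rfl⟩
    rcases eq_or_lt_of_le (add_nonneg hβ hγ) with h0 | h0
    · have hβ0 : β = 0 := by linarith
      have hγ0 : γ = 0 := by linarith
      have hα1 : α = 1 := by linarith
      exact ⟨b, left_mem_segment _ _ _, by simp [hβ0, hγ0, hα1, left_mem_segment]⟩
    · refine ⟨(β / (β + γ)) • b + (γ / (β + γ)) • c,
        ⟨_, _, by positivity, by positivity, by field_simp, rfl⟩, ?_⟩
      refine ⟨α, β + γ, hα, h0.le, by linarith, ?_⟩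
      rw [smul_add, smul_smul, smul_smul, mul_div_cancel₀ _ h0.ne', mul_div_cancel₀ _ h0.ne',
        add_assoc]

/-- Ratios of areas are the barycentric coordinates. Multiplying by `area a b c` instead of dividing
by it keeps their signs for either orientation. -/
theorem mem_convexHull_triple_iff {a b c x : Plane} (h : area a b c ≠ 0) :
    x ∈ convexHull ℝ ({a, b, c} : Set Plane) ↔ 0 ≤ area x b c * area a b c ∧
      0 ≤ area a x c * area a b c ∧ 0 ≤ area a b x * area a b c := by
  rw [mem_convexHull_triple]
  constructor
  · rintro ⟨α, β, γ, hα, hβ, hγ, hs, rfl⟩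
    have e1 : area (α • a + β • b + γ • c) b c = α * area a b c := by
      obtain rfl : α = 1 - β - γ := by linarith
      simp [area]
      ring
    have e2 : area a (α • a + β • b + γ • c) c = β * area a b c := by
      obtain rfl : α = 1 - β - γ := by linarith
      simp [area]
      ring
    have e3 : area a b (α • a + β • b + γ • c) = γ * area a b c := by
      obtain rfl : α = 1 - β - γ := by linarith
      simp [area]
      ring
    rw [e1, e2, e3]
    refine ⟨?_, ?_, ?_⟩ <;> rw [mul_assoc] <;> exact mul_nonneg ‹_› (mul_self_nonneg _)
  · rintro ⟨h1, h2, h3⟩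
    have hA : 0 < area a b c * area a b c := mul_self_pos.2 h
    refine ⟨area x b c / area a b c, area a x c / area a b c, area a b x / area a b c,
      ?_, ?_, ?_, ?_, ?_⟩
    · rw [← mul_div_mul_right _ _ h]; positivity
    · rw [← mul_div_mul_right _ _ h]; positivity
    · rw [← mul_div_mul_right _ _ h]; positivity
    · rw [← add_div, ← add_div, area_add_area_add_area, div_self h]
    · have := area_smul_barycentric a b c x
      rw [div_eq_inv_mul, div_eq_inv_mul, div_eq_inv_mul, mul_smul, mul_smul, mul_smul,
        ← smul_add, ← smul_add, this, smul_smul, inv_mul_cancel₀ h, one_smul]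

theorem area_eq_zero_of_mem_segment {a b x : Plane} (hx : x ∈ segment ℝ a b) :
    area a b x = 0 := by
  obtain ⟨u, v, -, -, huv, rfl⟩ := hx
  obtain rfl : u = 1 - v := by linarith
  simp [area]
  ring

theorem mem_segment_of_area_eq_zero {a b c x : Plane} (h : area a b c ≠ 0)
    (hx : x ∈ convexHull ℝ ({a, b, c} : Set Plane)) (h0 : area a b x = 0) :
    x ∈ segment ℝ a b := by
  obtain ⟨α, β, γ, hα, hβ, hγ, hs, rfl⟩ := mem_convexHull_triple.1 hx
  rw [area_combination _ _ _ _ _ hs, area_self_left, area_self_right] at h0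
  have hγ0 : γ = 0 := by simpa [h] using h0
  exact ⟨α, β, hα, hβ, by linarith, by simp [hγ0]⟩

/-- Two barycentric coordinates are positive at `x` and remain so nearby; only the sign of the third
one is left to check. -/
theorem eventually_mem_convexHull_triple {a b c x : Plane} (h : area a b c ≠ 0)
    (hx : x ∈ openSegment ℝ a b) :
    ∀ᶠ y in 𝓝 x, 0 ≤ area a b y * area a b c → y ∈ convexHull ℝ ({a, b, c} : Set Plane) := by
  obtain ⟨u, v, hu, hv, huv, rfl⟩ := hx
  have e1 : area (u • a + v • b) b c = u * area a b c := by
    obtain rfl : u = 1 - v := by linarith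
    simp [area]
    ring
  have e2 : area a (u • a + v • b) c = v * area a b c := by
    obtain rfl : u = 1 - v := by linarith
    simp [area]
    ring
  have hA : 0 < area a b c * area a b c := mul_self_pos.2 h
  have c1 : Continuous fun y => area y b c * area a b c :=
    (continuous_area continuous_id continuous_const continuous_const).mul continuous_const
  have c2 : Continuous fun y => area a y c * area a b c :=
    (continuous_area continuous_const continuous_id continuous_const).mul continuous_const
  have p1 : 0 < area (u • a + v • b) b c * area a b c := by rw [e1, mul_assoc]; positivity
  have p2 : 0 < area a (u • a + v • b) c * area a b c := by rw [e2, mul_assoc]; positivity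
  filter_upwards [c1.continuousAt.eventually (lt_mem_nhds p1),
    c2.continuousAt.eventually (lt_mem_nhds p2)] with y hy1 hy2 hy3
  exact (mem_convexHull_triple_iff h).2 ⟨hy1.le, hy2.le, hy3⟩

/-- Next to any point of a segment there are points on either side. -/
theorem exists_mem_nhds_area_pos {a b x : Plane} (hab : a ≠ b) (hx : x ∈ segment ℝ a b) {k : ℝ}
    (hk : k ≠ 0) {N : Set Plane} (hN : N ∈ 𝓝 x) : ∃ y ∈ N, 0 < area a b y * k := by
  -- A normal vector of the line: moving by `r * k` times it changes the area by `r * k` times the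
  -- squared length of `b - a`.
  set n : Plane := !₂[-(b 1 - a 1), b 0 - a 0] with hn
  have hc : Continuous fun r : ℝ => x + (r * k) • n := by fun_prop
  have h0 : (fun r : ℝ => x + (r * k) • n) 0 = x := by simp
  have h1 : ∀ᶠ r in 𝓝[>] (0 : ℝ), x + (r * k) • n ∈ N :=
    nhdsWithin_le_nhds (hc.continuousAt.eventually (h0.symm ▸ hN))
  obtain ⟨r, hr, hr0⟩ := (h1.and self_mem_nhdsWithin).exists
  refine ⟨_, hr, ?_⟩
  have e : area a b (x + (r * k) • n) =
      area a b x + r * k * ((b 0 - a 0) ^ 2 + (b 1 - a 1) ^ 2) := by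
    simp [area, n]
    ring
  have hpos : 0 < (b 0 - a 0) ^ 2 + (b 1 - a 1) ^ 2 := by
    by_contra hcon
    have q0 : (b 0 - a 0) ^ 2 = 0 := by nlinarith [sq_nonneg (b 0 - a 0), sq_nonneg (b 1 - a 1)]
    have q1 : (b 1 - a 1) ^ 2 = 0 := by nlinarith [sq_nonneg (b 0 - a 0), sq_nonneg (b 1 - a 1)]
    exact hab (plane_ext (by nlinarith [pow_eq_zero_iff two_ne_zero |>.1 q0])
      (by nlinarith [pow_eq_zero_iff two_ne_zero |>.1 q1]))
  rw [e, area_eq_zero_of_mem_segment hx, zero_add]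
  have : 0 < r := hr0
  have : 0 < k * k := mul_self_pos.2 hk
  calc 0 < r * (k * k) * ((b 0 - a 0) ^ 2 + (b 1 - a 1) ^ 2) := by positivity
    _ = _ := by ring

/-! ### Simplices of a planar complex -/

section Planar

variable {P : SimplicialComplex ℝ Plane}

theorem card_le_three {s : Finset Plane} (hs : s ∈ P.faces) : s.card ≤ 3 := by
  have := (P.indep hs).card_le_finrank_succ
  have h2 := Submodule.finrank_le (vectorSpan ℝ (range ((↑) : s → Plane)))
  simp only [Fintype.card_coe, finrank_euclideanSpace, Fintype.card_fin] at this h2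
  omega

theorem area_ne_zero {a b c : Plane} (h : ({a, b, c} : Finset Plane) ∈ P.faces) (hab : a ≠ b)
    (hac : a ≠ c) (hbc : b ≠ c) : area a b c ≠ 0 := by
  intro h0
  have hi := P.indep h
  let f : Fin 3 ↪ ({a, b, c} : Finset Plane) :=
    ⟨![⟨a, by simp⟩, ⟨b, by simp⟩, ⟨c, by simp⟩], by
      intro i j hij
      fin_cases i <;> fin_cases j <;> simp_all [Subtype.ext_iff]⟩
  have h1 := hi.comp_embedding f
  have h2 : ((↑) : ({a, b, c} : Finset Plane) → Plane) ∘ f = ![a, b, c] := by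
    funext i
    fin_cases i <;> rfl
  rw [h2, affineIndependent_iff_not_collinear_set] at h1
  apply h1
  rw [collinear_iff_of_mem (p₀ := a) (by simp)]
  refine ⟨b - a, ?_⟩
  simp only [mem_insert_iff, mem_singleton_iff, forall_eq_or_imp, forall_eq, vadd_eq_add]
  refine ⟨⟨0, by simp⟩, ⟨1, by simp⟩, ?_⟩
  have hz : (b 0 - a 0) * (c 1 - a 1) = (b 1 - a 1) * (c 0 - a 0) := by
    unfold area at h0
    linarith
  by_cases hb : b 0 - a 0 = 0
  · have hb1 : b 1 - a 1 ≠ 0 := fun hb1 => hab (plane_ext (by linarith) (by linarith))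
    refine ⟨(c 1 - a 1) / (b 1 - a 1), plane_ext ?_ ?_⟩
    · have : c 0 - a 0 = 0 := by simpa [hb, hb1] using hz
      simp [hb]
      linarith
    · simp [hb1]
  · refine ⟨(c 0 - a 0) / (b 0 - a 0), plane_ext ?_ ?_⟩
    · simp [hb]
    · simp
      field_simp
      linarith

theorem exists_eq_pair {e : Finset Plane} (he : e.card = 2) : ∃ a b, a ≠ b ∧ e = {a, b} :=
  Finset.card_eq_two.1 he

theorem exists_eq_triple {t : Finset Plane} (ht : t.card = 3) {a b : Plane} (ha : a ∈ t)
    (hb : b ∈ t) (hab : a ≠ b) : ∃ c, a ≠ c ∧ b ≠ c ∧ t = {a, b, c} := by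
  have h1 : ({a, b} : Finset Plane) ⊆ t := by
    intro x hx
    simp at hx
    rcases hx with rfl | rfl <;> assumption
  have h2 : (t \ {a, b}).card = 1 := by
    rw [Finset.card_sdiff_of_subset h1, ht, Finset.card_pair hab]
  obtain ⟨c, hc⟩ := Finset.card_eq_one.1 h2
  have hc' : c ∈ t \ {a, b} := by simp [hc]
  simp only [Finset.mem_sdiff, Finset.mem_insert, Finset.mem_singleton, not_or] at hc'
  refine ⟨c, fun h => hc'.2.1 h.symm, fun h => hc'.2.2 h.symm, ?_⟩
  rw [← Finset.union_sdiff_of_subset h1, hc]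
  ext x
  simp

/-- Faces meet in the hull of their common vertices. If `a` or `b` were missing from `t`, this hull
would be at most an endpoint of the edge. -/
theorem mem_of_mem_openSegment {a b x : Plane} (hab : a ≠ b)
    (he : ({a, b} : Finset Plane) ∈ P.faces) {t : Finset Plane} (ht : t ∈ P.faces)
    (hx : x ∈ openSegment ℝ a b) (hxt : x ∈ convexHull ℝ (t : Set Plane)) : {a, b} ⊆ t := by
  have hxe : x ∈ convexHull ℝ ((({a, b} : Finset Plane)) : Set Plane) := by
    rw [Finset.coe_insert, Finset.coe_singleton, convexHull_pair]
    exact openSegment_subset_segment _ _ _ hx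
  have h1 := P.inter_subset_convexHull he ht ⟨hxe, hxt⟩
  rw [← Finset.coe_inter] at h1
  have hxa : x ≠ a := by
    rintro rfl
    exact hab (left_mem_openSegment_iff.1 hx)
  have hxb : x ≠ b := by
    rintro rfl
    exact hab (right_mem_openSegment_iff.1 hx)
  by_contra hcon
  have h2 : ({a, b} ∩ t : Finset Plane) ⊆ {a} ∨ ({a, b} ∩ t : Finset Plane) ⊆ {b} := by
    by_cases ha : a ∈ t
    · left
      intro y hy
      simp only [Finset.mem_inter, Finset.mem_insert, Finset.mem_singleton] at hy ⊢
      rcases hy.1 with rfl | rfl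
      · rfl
      · exact absurd (by simp [Finset.insert_subset_iff, ha, hy.2]) hcon
    · right
      intro y hy
      simp only [Finset.mem_inter, Finset.mem_insert, Finset.mem_singleton] at hy ⊢
      rcases hy.1 with rfl | rfl
      · exact absurd hy.2 ha
      · rfl
  rcases h2 with h2 | h2
  · have := convexHull_mono (𝕜 := ℝ) (Finset.coe_subset.2 h2) h1
    simp [hxa] at this
  · have := convexHull_mono (𝕜 := ℝ) (Finset.coe_subset.2 h2) h1
    simp [hxb] at this

/-- Two triangles with a common edge lie on different sides of it. -/
theorem area_mul_area_neg {a b c d : Plane} (hab : a ≠ b) (hac : a ≠ c) (hbc : b ≠ c)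
    (had : a ≠ d) (hbd : b ≠ d) (hcd : c ≠ d) (h1 : ({a, b, c} : Finset Plane) ∈ P.faces)
    (h2 : ({a, b, d} : Finset Plane) ∈ P.faces) : area a b c * area a b d < 0 := by
  have n1 := area_ne_zero h1 hab hac hbc
  have n2 := area_ne_zero h2 hab had hbd
  by_contra hneg
  have hpos : 0 < area a b c * area a b d :=
    lt_of_le_of_ne (not_lt.1 hneg) (mul_ne_zero n1 n2).symm
  have hm : midpoint ℝ a b ∈ openSegment ℝ a b := by
    rw [midpoint_eq_smul_add, smul_add]
    exact ⟨⅟2, ⅟2, by simp, by simp, by norm_num, rfl⟩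
  -- With both apexes on one side, a point just off the midpoint on that side lies in both
  -- triangles, hence on the common edge, where the area vanishes.
  obtain ⟨y, ⟨hy1, hy2⟩, hy⟩ := exists_mem_nhds_area_pos hab
    (openSegment_subset_segment _ _ _ hm) n1
    ((eventually_mem_convexHull_triple n1 hm).and (eventually_mem_convexHull_triple n2 hm))
  have hyd : 0 ≤ area a b y * area a b d := by
    have : 0 < (area a b y * area a b c) * (area a b c * area a b d) := mul_pos hy hpos
    have h3 : 0 < (area a b y * area a b d) * (area a b c) ^ 2 := by nlinarith
    exact (pos_of_mul_pos_left h3 (sq_nonneg _)).le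
  have h3 := P.inter_subset_convexHull h1 h2
    ⟨by simpa using hy1 hy.le, by simpa using hy2 hyd⟩
  have h4 : (({a, b, c} : Finset Plane) : Set Plane) ∩ ({a, b, d} : Finset Plane) ⊆ {a, b} := by
    intro z
    simp only [Finset.coe_insert, Finset.coe_singleton, mem_inter_iff, mem_insert_iff,
      mem_singleton_iff]
    rintro ⟨rfl | rfl | rfl, h | h | h⟩ <;> simp_all
  have h5 := convexHull_mono (𝕜 := ℝ) h4 h3
  rw [convexHull_pair] at h5
  rw [area_eq_zero_of_mem_segment h5] at hy
  simp at hy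

/-- Each triangle fills a half-neighbourhood of the point, and the two halves are opposite. -/
theorem openSegment_subset_interior {a b c d : Plane} (hab : a ≠ b) (hac : a ≠ c) (hbc : b ≠ c)
    (had : a ≠ d) (hbd : b ≠ d) (hcd : c ≠ d) (h1 : ({a, b, c} : Finset Plane) ∈ P.faces)
    (h2 : ({a, b, d} : Finset Plane) ∈ P.faces) : openSegment ℝ a b ⊆ interior P.space := by
  intro x hx
  have hneg := area_mul_area_neg hab hac hbc had hbd hcd h1 h2
  rw [mem_interior_iff_mem_nhds]
  filter_upwards [eventually_mem_convexHull_triple (area_ne_zero h1 hab hac hbc) hx,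
    eventually_mem_convexHull_triple (area_ne_zero h2 hab had hbd) hx] with y hy1 hy2
  rcases le_total 0 (area a b y * area a b c) with h | h
  · exact SimplicialComplex.convexHull_subset_space h1 (by simpa using hy1 h)
  · have n1 := area_ne_zero h1 hab hac hbc
    have h3 : 0 ≤ (area a b y * area a b c) * (area a b c * area a b d) :=
      mul_nonneg_of_nonpos_of_nonpos h hneg.le
    have h4 : 0 ≤ (area a b y * area a b d) * (area a b c) ^ 2 := by nlinarith
    have h5 := hy2 (nonneg_of_mul_nonneg_left h4 (by positivity))
    exact SimplicialComplex.convexHull_subset_space h2 (by simpa using h5)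

theorem mem_interior_of_area_pos {a b c x : Plane} (h : ({a, b, c} : Finset Plane) ∈ P.faces)
    (hA : area a b c ≠ 0) (h1 : 0 < area x b c * area a b c) (h2 : 0 < area a x c * area a b c)
    (h3 : 0 < area a b x * area a b c) : x ∈ interior P.space := by
  rw [mem_interior_iff_mem_nhds]
  have c1 : Continuous fun y => area y b c * area a b c :=
    (continuous_area continuous_id continuous_const continuous_const).mul continuous_const
  have c2 : Continuous fun y => area a y c * area a b c :=
    (continuous_area continuous_const continuous_id continuous_const).mul continuous_const
  have c3 : Continuous fun y => area a b y * area a b c :=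
    (continuous_area continuous_const continuous_const continuous_id).mul continuous_const
  filter_upwards [c1.continuousAt.eventually (lt_mem_nhds h1),
    c2.continuousAt.eventually (lt_mem_nhds h2),
    c3.continuousAt.eventually (lt_mem_nhds h3)] with y hy1 hy2 hy3
  refine SimplicialComplex.convexHull_subset_space h ?_
  simpa using (mem_convexHull_triple_iff hA).2 ⟨hy1.le, hy2.le, hy3.le⟩

/-- The barycentre of a triangle is an interior point of the space. -/
theorem not_onBoundary_of_card_eq_three {t : Finset Plane} (ht : t ∈ P.faces) (h3 : t.card = 3) :
    ¬ OnBoundary P t := by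
  obtain ⟨a, b, c, hab, hac, hbc, rfl⟩ := Finset.card_eq_three.1 h3
  intro hb
  have hA := area_ne_zero ht hab hac hbc
  set x : Plane := (1 / 3 : ℝ) • a + (1 / 3 : ℝ) • b + (1 / 3 : ℝ) • c
  have hx : x ∈ convexHull ℝ ((({a, b, c} : Finset Plane)) : Set Plane) := by
    simp only [Finset.coe_insert, Finset.coe_singleton]
    exact mem_convexHull_triple.2
      ⟨_, _, _, by norm_num, by norm_num, by norm_num, by norm_num, rfl⟩
  have hpos : 0 < area a b c * area a b c := mul_self_pos.2 hA
  have e1 : area x b c = 1 / 3 * area a b c := by simp [x, area]; ring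
  have e2 : area a x c = 1 / 3 * area a b c := by simp [x, area]; ring
  have e3 : area a b x = 1 / 3 * area a b c := by simp [x, area]; ring
  have := mem_interior_of_area_pos ht hA (x := x) (by rw [e1]; linarith) (by rw [e2]; linarith)
    (by rw [e3]; linarith)
  exact (hb hx).2 this

theorem OnBoundary.mono {s t : Finset Plane} (h : OnBoundary P t) (hst : s ⊆ t) :
    OnBoundary P s :=
  (convexHull_mono (Finset.coe_subset.2 hst)).trans h

theorem onBoundary_singleton {v : Plane} : OnBoundary P {v} ↔ v ∈ frontier P.space := by
  simp [OnBoundary]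

theorem IsInternalVertex.not_onBoundary {v : Plane} (hv : IsInternalVertex P v) {s : Finset Plane}
    (hs : v ∈ s) : ¬ OnBoundary P s :=
  fun h => hv.2 (h.mono (Finset.singleton_subset_iff.2 hs))

theorem IsInternalVertex.mem_interior {v : Plane} (hv : IsInternalVertex P v) :
    v ∈ interior P.space := by
  by_contra h
  refine hv.2 (onBoundary_singleton.2 ⟨subset_closure ?_, h⟩)
  exact SimplicialComplex.vertices_subset_space hv.1

theorem singleton_mem_faces {s : Finset Plane} (hs : s ∈ P.faces) {v : Plane} (hv : v ∈ s) :
    {v} ∈ P.faces :=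
  P.down_closed hs (Finset.singleton_subset_iff.2 hv) (Finset.singleton_nonempty v)

theorem isInternalVertex_or_isBoundaryVertex {s : Finset Plane} (hs : s ∈ P.faces) {v : Plane}
    (hv : v ∈ s) : IsInternalVertex P v ∨ IsBoundaryVertex P v := by
  by_cases h : OnBoundary P {v}
  · exact Or.inr ⟨singleton_mem_faces hs hv, h⟩
  · exact Or.inl ⟨singleton_mem_faces hs hv, h⟩

theorem IsInternalVertex.not_isBoundaryVertex {v : Plane} (hv : IsInternalVertex P v) :
    ¬ IsBoundaryVertex P v :=
  fun h => hv.2 h.2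

end Planar

/-! ### Polygons: purity, triangles at an edge or a vertex, the boundary. -/

section Polygon

variable {P : SimplicialComplex ℝ Plane}

theorem isClosed_convexHull_finset (s : Finset Plane) : IsClosed (convexHull ℝ (s : Set Plane)) :=
  s.finite_toSet.isClosed_convexHull ℝ

/-- There are finitely many simplices and they are closed, so those that miss `x` also miss a
neighbourhood of it. -/
theorem eventually_mem_convexHull_of_mem (hfin : P.faces.Finite) (x : Plane) :
    ∀ᶠ y in 𝓝 x, ∀ s ∈ P.faces, y ∈ convexHull ℝ (s : Set Plane) →
      x ∈ convexHull ℝ (s : Set Plane) := by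
  rw [Filter.eventually_all_finite hfin]
  intro s _
  by_cases hx : x ∈ convexHull ℝ (s : Set Plane)
  · exact Filter.Eventually.of_forall fun _ _ => hx
  · filter_upwards [(isClosed_convexHull_finset s).isOpen_compl.mem_nhds hx] with y hy h
    exact absurd h hy

theorem finite_vertices (hfin : P.faces.Finite) : P.vertices.Finite := by
  rw [SimplicialComplex.vertices_eq]
  exact hfin.biUnion fun s _ => s.finite_toSet

theorem midpoint_mem_openSegment (a b : Plane) : midpoint ℝ a b ∈ openSegment ℝ a b := by
  rw [midpoint_eq_smul_add, smul_add]
  exact ⟨⅟2, ⅟2, by simp, by simp, by norm_num, rfl⟩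

theorem notMem_vertices_of_mem_openSegment {a b x : Plane} (hab : a ≠ b)
    (he : ({a, b} : Finset Plane) ∈ P.faces) (hx : x ∈ openSegment ℝ a b) : x ∉ P.vertices := by
  intro hv
  have h1 := mem_of_mem_openSegment hab he hv hx (by simp)
  have h2 := Finset.card_le_card h1
  rw [Finset.card_pair hab] at h2
  simp at h2

theorem openSegment_subset_convexHull {s : Finset Plane} {a b : Plane} (ha : a ∈ s)
    (hb : b ∈ s) : openSegment ℝ a b ⊆ convexHull ℝ (s : Set Plane) :=
  (convex_convexHull ℝ _).openSegment_subset (subset_convexHull ℝ _ ha) (subset_convexHull ℝ _ hb)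

/-- A polygon is pure: each of its simplices is a face of a triangle. -/
theorem IsPolygon.exists_triangle (hP : IsPolygon P) {s : Finset Plane} (hs : s ∈ P.faces) :
    ∃ t ∈ P.faces, s ⊆ t ∧ t.card = 3 := by
  obtain ⟨e⟩ := hP.2
  obtain ⟨M, hsM, hM⟩ := hP.1.exists_le_maximal hs
  refine ⟨M, hM.1, hsM, ?_⟩
  have hmax : ∀ t ∈ P.faces, M ⊆ t → t = M := fun t ht h => (hM.eq_of_le ht h).symm
  have hcard := card_le_three hM.1
  have hpos := Finset.card_pos.2 (SimplicialComplex.nonempty_of_mem_faces hM.1)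
  by_contra h3
  have h12 : M.card = 1 ∨ M.card = 2 := by omega
  have hcl : ∀ p : Finset Plane → Prop,
      IsClosed (⋃ s ∈ {s ∈ P.faces | p s}, convexHull ℝ (s : Set Plane)) := fun p =>
    (hP.1.subset (sep_subset _ _)).isClosed_biUnion fun s _ => isClosed_convexHull_finset s
  rcases h12 with h1 | h2
  -- A maximal vertex would be an isolated point of an infinite connected set.
  · obtain ⟨v, rfl⟩ := Finset.card_eq_one.1 h1
    obtain ⟨y, hy, hyv⟩ := (infinite_disc e).exists_notMem_finset {v}
    obtain ⟨x, hx, hxv, hx2⟩ := isPreconnected_closed_iff.1 (isConnected_disc e).isPreconnected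
      {v} _ isClosed_singleton (hcl fun s => s ≠ {v}) (by
        intro x hx
        obtain ⟨s, hs, hxs⟩ := SimplicialComplex.mem_space_iff.1 hx
        by_cases hsv : s = {v}
        · left; simpa [hsv] using hxs
        · right; exact mem_biUnion (show s ∈ {s ∈ P.faces | s ≠ {v}} from ⟨hs, hsv⟩) hxs)
      ⟨v, SimplicialComplex.vertices_subset_space hM.1, rfl⟩ ⟨y, hy, by
        obtain ⟨s, hs, hxs⟩ := SimplicialComplex.mem_space_iff.1 hy
        refine mem_biUnion (show s ∈ {s ∈ P.faces | s ≠ {v}} from ⟨hs, ?_⟩) hxs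
        rintro rfl
        simp at hxs
        simp [hxs] at hyv⟩
    obtain rfl : x = v := hxv
    obtain ⟨s, ⟨hs, hsv⟩, hxs⟩ := mem_iUnion₂.1 hx2
    have := (SimplicialComplex.vertex_mem_convexHull_iff hM.1 hs).1 hxs
    exact hsv (hmax s hs (by simpa using this))
  -- A maximal edge is attached to the other simplices only at its endpoints, so removing the
  -- vertices and its midpoint, a finite set, would disconnect the disc.
  · obtain ⟨a, b, hab, rfl⟩ := exists_eq_pair h2
    set m := midpoint ℝ a b with hm
    have hmo : m ∈ openSegment ℝ a b := midpoint_mem_openSegment a b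
    have hma : a ≠ m := by
      intro h
      rw [← h, left_mem_openSegment_iff] at hmo
      exact hab hmo
    have hmb : m ≠ b := by
      intro h
      rw [h, right_mem_openSegment_iff] at hmo
      exact hab hmo
    have hMhull : convexHull ℝ ((({a, b} : Finset Plane)) : Set Plane) = segment ℝ a b := by simp
    have hpts : ∀ c d : Plane, c ≠ d → openSegment ℝ c d ⊆ openSegment ℝ a b → m ∉ openSegment ℝ c d →
        ((P.space \ (P.vertices ∪ {m})) ∩ segment ℝ c d).Nonempty := by
      intro c d hcd hsub hmn
      have hx := midpoint_mem_openSegment c d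
      refine ⟨midpoint ℝ c d, ⟨SimplicialComplex.convexHull_subset_space hM.1 ?_, ?_⟩,
        openSegment_subset_segment _ _ _ hx⟩
      · rw [hMhull]
        exact openSegment_subset_segment _ _ _ (hsub hx)
      · rintro (h | h)
        · exact notMem_vertices_of_mem_openSegment hab hM.1 (hsub hx) h
        · rw [mem_singleton_iff] at h
          exact hmn (h ▸ hx)
    have sub1 : openSegment ℝ a m ⊆ openSegment ℝ a b := by
      rintro x ⟨u, v, hu, hv, huv, rfl⟩
      obtain ⟨u', v', hu', hv', huv', h⟩ := hmo
      refine ⟨u + v * u', v * v', by positivity, by positivity, ?_, ?_⟩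
      · rw [add_assoc, ← mul_add, huv', mul_one, huv]
      · rw [← h]; module
    have sub2 : openSegment ℝ m b ⊆ openSegment ℝ a b := by
      rintro x ⟨u, v, hu, hv, huv, rfl⟩
      obtain ⟨u', v', hu', hv', huv', h⟩ := hmo
      refine ⟨u * u', u * v' + v, by positivity, by positivity, ?_, ?_⟩
      · rw [← add_assoc, ← mul_add, huv', mul_one, huv]
      · rw [← h]; module
    have hseg : segment ℝ a b ⊆ segment ℝ a m ∪ segment ℝ m b := by
      rintro x ⟨u, v, hu, hv, huv, rfl⟩
      obtain rfl : u = 1 - v := by linarith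
      have hm2 : m = (1 / 2 : ℝ) • a + (1 / 2 : ℝ) • b := by
        rw [hm, midpoint_eq_smul_add, smul_add]; norm_num
      rcases le_total v (1 / 2) with h | h
      · left
        exact ⟨1 - 2 * v, 2 * v, by linarith, by linarith, by ring, by rw [hm2]; module⟩
      · right
        exact ⟨2 * (1 - v), 2 * v - 1, by linarith, by linarith, by ring, by rw [hm2]; module⟩
    have hinter : segment ℝ a m ∩ segment ℝ m b ⊆ {m} := by
      rintro x ⟨⟨u, v, hu, hv, huv, rfl⟩, ⟨u', v', hu', hv', huv', h⟩⟩
      have hm2 : m = (1 / 2 : ℝ) • a + (1 / 2 : ℝ) • b := by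
        rw [hm, midpoint_eq_smul_add, smul_add]; norm_num
      obtain rfl : u = 1 - v := by linarith
      obtain rfl : u' = 1 - v' := by linarith
      have h4 : ((1 + v') / 2 - v / 2) • (b - a) = 0 := by
        rw [hm2] at h
        rw [← sub_eq_zero] at h
        rw [← h]
        module
      have h5 := (smul_eq_zero.1 h4).resolve_right (sub_ne_zero.2 hab.symm)
      have hv1 : v = 1 := by linarith
      simp [hv1]
    have hFfin : (P.vertices ∪ {m}).Finite := (finite_vertices hP.1).union (finite_singleton m)
    obtain ⟨x, ⟨hx, hxF⟩, hx1, hx2⟩ := isPreconnected_closed_iff.1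
      (isPreconnected_disc_diff e hFfin) (segment ℝ a m)
      (segment ℝ m b ∪ ⋃ s ∈ {s ∈ P.faces | ¬ s ⊆ {a, b}}, convexHull ℝ (s : Set Plane))
      (by
        have := isClosed_convexHull_finset {a, m}
        simpa using this)
      (by
        refine IsClosed.union ?_ (hcl _)
        have := isClosed_convexHull_finset {m, b}
        simpa using this)
      (by
        rintro x ⟨hx, -⟩
        obtain ⟨s, hs, hxs⟩ := SimplicialComplex.mem_space_iff.1 hx
        by_cases hsM : s ⊆ {a, b}
        · have h1 := convexHull_mono (𝕜 := ℝ) (Finset.coe_subset.2 hsM) hxs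
          rw [hMhull] at h1
          rcases hseg h1 with h | h
          · exact Or.inl h
          · exact Or.inr (Or.inl h)
        · exact Or.inr (Or.inr (mem_biUnion
            (show s ∈ {s ∈ P.faces | ¬ s ⊆ {a, b}} from ⟨hs, hsM⟩) hxs)))
      (hpts a m hma sub1 fun h => hma (right_mem_openSegment_iff.1 h))
      ((hpts m b hmb sub2 fun h => hmb (left_mem_openSegment_iff.1 h)).mono
        (inter_subset_inter_right _ subset_union_left))
    have hxa : x ≠ a := by
      rintro rfl
      exact hxF (Or.inl (singleton_mem_faces hM.1 (by simp)))
    have hxm : x ≠ m := by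
      rintro rfl
      exact hxF (Or.inr rfl)
    have hxo : x ∈ openSegment ℝ a b := sub1
      (mem_openSegment_of_ne_left_right hxa.symm hxm.symm hx1)
    rcases hx2 with hx2 | hx2
    · exact hxm (hinter ⟨hx1, hx2⟩)
    · obtain ⟨s, ⟨hs, hsM⟩, hxs⟩ := mem_iUnion₂.1 hx2
      exact hsM (hmax s hs (mem_of_mem_openSegment hab hM.1 hs hxo hxs)).subset

theorem IsPolygon.exists_triangle_mem (hP : IsPolygon P) {x : Plane} (hx : x ∈ P.space) :
    ∃ t ∈ P.faces, t.card = 3 ∧ x ∈ convexHull ℝ (t : Set Plane) := by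
  obtain ⟨s, hs, hxs⟩ := SimplicialComplex.mem_space_iff.1 hx
  obtain ⟨t, ht, hst, h3⟩ := hP.exists_triangle hs
  exact ⟨t, ht, h3, convexHull_mono (Finset.coe_subset.2 hst) hxs⟩

theorem IsPolygon.isClosed_space (hP : IsPolygon P) : IsClosed P.space :=
  (isCompact_disc hP.2.some).isClosed

theorem IsPolygon.nonempty_triangle (hP : IsPolygon P) : Nonempty (Triangle P) := by
  obtain ⟨x, hx⟩ := (isConnected_disc hP.2.some).nonempty
  obtain ⟨t, ht, h3, -⟩ := hP.exists_triangle_mem hx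
  exact ⟨⟨t, ht, h3⟩⟩

theorem IsPolygon.finite_triangle (hP : IsPolygon P) : Finite (Triangle P) :=
  (hP.1.subset (fun _ h => h.1 : {t | t ∈ P.faces ∧ t.card = 3} ⊆ P.faces)).to_subtype

/-- An edge off the boundary has a triangle on either side. -/
theorem IsPolygon.exists_area_pos (hP : IsPolygon P) {a b : Plane} (hab : a ≠ b)
    (he : ({a, b} : Finset Plane) ∈ P.faces) (hb : ¬ OnBoundary P {a, b}) {k : ℝ} (hk : k ≠ 0) :
    ∃ c, a ≠ c ∧ b ≠ c ∧ ({a, b, c} : Finset Plane) ∈ P.faces ∧ 0 < area a b c * k := by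
  obtain ⟨x0, hx0, hx0'⟩ := not_subset.1 hb
  have hint : x0 ∈ interior P.space := by
    by_contra h
    exact hx0' ⟨subset_closure (SimplicialComplex.convexHull_subset_space he hx0), h⟩
  rw [Finset.coe_insert, Finset.coe_singleton, convexHull_pair, ← closure_openSegment] at hx0
  -- The interior point may be an endpoint; moving it into the open edge makes every simplex through
  -- it contain the whole edge.
  obtain ⟨x, hxi, hx⟩ := mem_closure_iff.1 hx0 _ isOpen_interior hint
  obtain ⟨y, ⟨hy1, hy2⟩, hy⟩ := exists_mem_nhds_area_pos hab
    (openSegment_subset_segment _ _ _ hx) hk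
    (Filter.Eventually.and (mem_interior_iff_mem_nhds.1 hxi)
      (eventually_mem_convexHull_of_mem hP.1 x))
  obtain ⟨t, ht, h3, hyt⟩ := hP.exists_triangle_mem hy1
  have hsub := mem_of_mem_openSegment hab he ht hx (hy2 t ht hyt)
  obtain ⟨c, hac, hbc, rfl⟩ := exists_eq_triple h3 (hsub (by simp)) (hsub (by simp)) hab
  refine ⟨c, hac, hbc, ht, ?_⟩
  have hA := area_ne_zero ht hab hac hbc
  simp only [Finset.coe_insert, Finset.coe_singleton] at hyt
  have h5 := ((mem_convexHull_triple_iff hA).1 hyt).2.2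
  have hy0 : area a b y ≠ 0 := fun h => by simp [h] at hy
  have h6 : 0 < area a b y * area a b c := lt_of_le_of_ne h5 (mul_ne_zero hy0 hA).symm
  have h7 : 0 < (area a b c * k) * (area a b y) ^ 2 := by nlinarith [mul_pos h6 hy]
  exact pos_of_mul_pos_left h7 (sq_nonneg _)

/-- The triangles at an edge off the boundary are exactly two. -/
theorem IsPolygon.exists_pair_triangles (hP : IsPolygon P) {e : Finset Plane} (he : IsEdge P e)
    (hb : ¬ OnBoundary P e) : ∃ t t' : Triangle P, t ≠ t' ∧ e ⊆ t.1 ∧ e ⊆ t'.1 ∧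
      ∀ t'' : Triangle P, e ⊆ t''.1 → t'' = t ∨ t'' = t' := by
  obtain ⟨a, b, hab, rfl⟩ := exists_eq_pair he.2
  -- The signs `1` and `-1` select one triangle on each side of the edge.
  obtain ⟨c, hac, hbc, hc, hcp⟩ := hP.exists_area_pos hab he.1 hb one_ne_zero
  obtain ⟨d, had, hbd, hd, hdp⟩ := hP.exists_area_pos hab he.1 hb (neg_ne_zero.2 one_ne_zero)
  have hcd : c ≠ d := by
    rintro rfl
    linarith
  refine ⟨⟨{a, b, c}, hc, Finset.card_eq_three.2 ⟨a, b, c, hab, hac, hbc, rfl⟩⟩,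
    ⟨{a, b, d}, hd, Finset.card_eq_three.2 ⟨a, b, d, hab, had, hbd, rfl⟩⟩, ?_, ?_, ?_, ?_⟩
  · intro h
    have h1 : c ∈ ({a, b, d} : Finset Plane) :=
      (Subtype.ext_iff.1 h).subset (show c ∈ ({a, b, c} : Finset Plane) by simp)
    simp [hac.symm, hbc.symm, hcd] at h1
  · intro x; simp; tauto
  · intro x; simp; tauto
  · rintro ⟨t, ht, h3⟩ hsub
    obtain ⟨f, haf, hbf, rfl⟩ := exists_eq_triple h3 (hsub (by simp)) (hsub (by simp)) hab
    by_contra hcon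
    rw [not_or] at hcon
    have hfc : f ≠ c := by rintro rfl; exact hcon.1 rfl
    have hfd : f ≠ d := by rintro rfl; exact hcon.2 rfl
    -- A third apex would have to lie opposite to both `c` and `d`, which are on different sides.
    have h1 := area_mul_area_neg hab haf hbf hac hbc hfc ht hc
    have h2 := area_mul_area_neg hab haf hbf had hbd hfd ht hd
    nlinarith [mul_pos_of_neg_of_neg h1 h2, sq_nonneg (area a b f)]

/-- If two triangles share an edge, then the edge is not on the boundary. -/
theorem not_onBoundary_of_two_triangles {e : Finset Plane} (he : e.card = 2) {t t' : Triangle P}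
    (hne : t ≠ t') (h : e ⊆ t.1) (h' : e ⊆ t'.1) : ¬ OnBoundary P e := by
  obtain ⟨a, b, hab, rfl⟩ := exists_eq_pair he
  obtain ⟨t, ht, h3⟩ := t
  obtain ⟨t', ht', h3'⟩ := t'
  obtain ⟨c, hac, hbc, rfl⟩ := exists_eq_triple h3 (h (by simp)) (h (by simp)) hab
  obtain ⟨d, had, hbd, rfl⟩ := exists_eq_triple h3' (h' (by simp)) (h' (by simp)) hab
  have hcd : c ≠ d := by rintro rfl; exact hne rfl
  intro hb
  have hm := midpoint_mem_openSegment a b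
  have h1 := openSegment_subset_interior hab hac hbc had hbd hcd ht ht' hm
  exact (hb (openSegment_subset_convexHull (by simp) (by simp) hm)).2 h1

theorem inter_card_le_two {t t' : Triangle P} (hne : t ≠ t') : (t.1 ∩ t'.1).card ≤ 2 := by
  by_contra h
  have h1 := Finset.card_le_card (Finset.inter_subset_left (s₁ := t.1) (s₂ := t'.1))
  have h2 := t.2.2
  have h3 := t'.2.2
  have e1 : t.1 ∩ t'.1 = t.1 := Finset.eq_of_subset_of_card_le Finset.inter_subset_left (by omega)
  have e2 : t.1 ∩ t'.1 = t'.1 := Finset.eq_of_subset_of_card_le Finset.inter_subset_right (by omega)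
  exact hne (Subtype.ext (e1.symm.trans e2))

theorem eq_inter_of_subset {e : Finset Plane} (he : e.card = 2) {t t' : Triangle P}
    (hne : t ≠ t') (h : e ⊆ t.1) (h' : e ⊆ t'.1) : e = t.1 ∩ t'.1 :=
  Finset.eq_of_subset_of_card_le (Finset.subset_inter h h') (by
    rw [he]
    exact inter_card_le_two hne)

theorem isEdge_of_subset {e : Finset Plane} (he : e.card = 2) (t : Triangle P) (h : e ⊆ t.1) :
    IsEdge P e :=
  ⟨P.down_closed t.2.1 h (Finset.card_pos.1 (by omega)), he⟩

/-- Two triangles that meet in a point other than a vertex are equal or share an edge. -/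
theorem exists_common_edge {t t' : Triangle P} (hne : t ≠ t') {x : Plane} (hx : x ∉ P.vertices)
    (h : x ∈ convexHull ℝ (t.1 : Set Plane)) (h' : x ∈ convexHull ℝ (t'.1 : Set Plane)) :
    IsEdge P (t.1 ∩ t'.1) ∧ x ∈ convexHull ℝ ((t.1 ∩ t'.1 : Finset Plane) : Set Plane) := by
  have h1 := P.inter_subset_convexHull t.2.1 t'.2.1 ⟨h, h'⟩
  rw [← Finset.coe_inter] at h1
  refine ⟨isEdge_of_subset ?_ t Finset.inter_subset_left, h1⟩
  have h2 := inter_card_le_two hne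
  by_contra h3
  have h4 : (t.1 ∩ t'.1).card ≤ 1 := by omega
  rcases Nat.le_one_iff_eq_zero_or_eq_one.1 h4 with h5 | h5
  · rw [Finset.card_eq_zero.1 h5] at h1
    simp at h1
  · obtain ⟨v, hv⟩ := Finset.card_eq_one.1 h5
    rw [hv] at h1
    simp at h1
    subst h1
    exact hx (singleton_mem_faces t.2.1
      (Finset.inter_subset_left (hv ▸ Finset.mem_singleton_self _)))

/-- The 2-cells of a polygon are connected through edges off the boundary. -/
theorem IsPolygon.forall_triangle (hP : IsPolygon P) {p : Triangle P → Prop}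
    (hp : ∀ (t t' : Triangle P) (e : Finset Plane), t ≠ t' → IsEdge P e → ¬ OnBoundary P e →
      e ⊆ t.1 → e ⊆ t'.1 → p t → p t') {t : Triangle P} (ht : p t) (t' : Triangle P) : p t' := by
  obtain ⟨h⟩ := hP.2
  have := hP.finite_triangle
  -- The disc without the vertices is connected, and two different triangles that meet away from the
  -- vertices share an edge.
  refine (isPreconnected_disc_diff h (finite_vertices hP.1)).forall_of_closed_cover
    (C := fun t : Triangle P => convexHull ℝ (t.1 : Set Plane))
    (fun t => isClosed_convexHull_finset _) ?_ ?_ ?_ ht t'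
  · rintro x ⟨hx, -⟩
    obtain ⟨t, ht, h3, hxt⟩ := hP.exists_triangle_mem hx
    exact mem_iUnion.2 ⟨⟨t, ht, h3⟩, hxt⟩
  · rintro ⟨t, ht, h3⟩
    obtain ⟨a, b, c, hab, hac, hbc, rfl⟩ := Finset.card_eq_three.1 h3
    have hm := midpoint_mem_openSegment a b
    have hx : midpoint ℝ a b ∈ convexHull ℝ ((({a, b, c} : Finset Plane)) : Set Plane) :=
      openSegment_subset_convexHull (by simp) (by simp) hm
    refine ⟨_, ⟨SimplicialComplex.convexHull_subset_space ht hx, ?_⟩, hx⟩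
    exact notMem_vertices_of_mem_openSegment hab
      (P.down_closed ht (by intro x; simp; tauto) (by simp)) hm
  · rintro t t' ⟨x, ⟨-, hx⟩, hxt, hxt'⟩ hpt
    by_cases hne : t = t'
    · exact hne ▸ hpt
    obtain ⟨he, -⟩ := exists_common_edge hne hx hxt hxt'
    exact hp t t' _ hne he (not_onBoundary_of_two_triangles he.2 hne Finset.inter_subset_left
      Finset.inter_subset_right) Finset.inter_subset_left Finset.inter_subset_right hpt

/-- The triangles around an internal vertex are connected through the edges at this vertex. -/
theorem IsPolygon.forall_triangle_at (hP : IsPolygon P) {v : Plane} (hv : IsInternalVertex P v)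
    {p : Triangle P → Prop}
    (hp : ∀ (t t' : Triangle P) (e : Finset Plane), t ≠ t' → IsEdge P e → v ∈ e →
      e ⊆ t.1 → e ⊆ t'.1 → p t → p t') {t t' : Triangle P} (hvt : v ∈ t.1) (hvt' : v ∈ t'.1)
    (ht : p t) : p t' := by
  have := hP.finite_triangle
  -- A small ball lies in the polygon, meets only simplices through `v` and contains no other
  -- vertex. Without `v` it is connected and covered by the triangles at `v`.
  have hev : ∀ᶠ y in 𝓝 v, y ∈ P.space ∧ (∀ s ∈ P.faces, y ∈ convexHull ℝ (s : Set Plane) →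
      v ∈ convexHull ℝ (s : Set Plane)) ∧ (y ∈ P.vertices → y = v) := by
    refine Filter.Eventually.and (mem_interior_iff_mem_nhds.1 hv.mem_interior)
      ((eventually_mem_convexHull_of_mem hP.1 v).and ?_)
    have h1 : (P.vertices \ {v})ᶜ ∈ 𝓝 v :=
      ((finite_vertices hP.1).sdiff).isClosed.isOpen_compl.mem_nhds (by simp)
    filter_upwards [h1] with y hy hyv
    by_contra hne
    exact hy ⟨hyv, hne⟩
  obtain ⟨ε, hε, hball⟩ := Metric.eventually_nhds_iff_ball.1 hev
  refine (isPreconnected_ball_diff v hε (finite_singleton v)).forall_of_closed_cover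
    (C := fun t : {t : Triangle P // v ∈ t.1} => convexHull ℝ (t.1.1 : Set Plane))
    (p := fun t => p t.1) (fun t => isClosed_convexHull_finset _) ?_ ?_ ?_
    (i := ⟨t, hvt⟩) ht ⟨t', hvt'⟩
  · rintro x ⟨hx, -⟩
    obtain ⟨hxs, hx2, -⟩ := hball x hx
    obtain ⟨t, ht, h3, hxt⟩ := hP.exists_triangle_mem hxs
    exact mem_iUnion.2 ⟨⟨⟨t, ht, h3⟩, (SimplicialComplex.vertex_mem_convexHull_iff hv.1 ht).1
      (hx2 t ht hxt)⟩, hxt⟩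
  · rintro ⟨⟨t, ht, h3⟩, hvt⟩
    obtain ⟨w, hw, hwv⟩ := Finset.exists_mem_ne (s := t) (by omega) v
    have hvs : v ∈ closure (openSegment ℝ v w) := by
      rw [closure_openSegment]
      exact left_mem_segment _ _ _
    obtain ⟨x, hx1, hx2⟩ := mem_closure_iff.1 hvs _ isOpen_ball (mem_ball_self hε)
    refine ⟨x, ⟨hx1, ?_⟩, openSegment_subset_convexHull hvt hw hx2⟩
    rintro rfl
    exact hwv (left_mem_openSegment_iff.1 hx2).symm
  · rintro ⟨t, hvt⟩ ⟨t', hvt'⟩ ⟨x, ⟨hx, hxv⟩, hxt, hxt'⟩ hpt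
    by_cases hne : t = t'
    · subst hne
      exact hpt
    have hxn : x ∉ P.vertices := fun h => hxv ((hball x hx).2.2 h)
    obtain ⟨he, -⟩ := exists_common_edge hne hxn hxt hxt'
    exact hp t t' _ hne he (Finset.mem_inter.2 ⟨hvt, hvt'⟩) Finset.inter_subset_left
      Finset.inter_subset_right hpt

/-- The frontier of a polygon is covered by the simplices on the boundary. -/
theorem IsPolygon.exists_onBoundary (hP : IsPolygon P) {x : Plane} (hx : x ∈ frontier P.space) :
    ∃ s ∈ P.faces, OnBoundary P s ∧ x ∈ convexHull ℝ (s : Set Plane) := by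
  obtain ⟨t, ht, h3, hxt⟩ := hP.exists_triangle_mem (hP.isClosed_space.frontier_subset hx)
  -- A frontier point of a triangle has a vanishing barycentric coordinate, so it lies on an edge.
  -- If this edge is not on the boundary, its open part is interior to the polygon and the point
  -- must be a vertex.
  have key : ∀ a b : Plane, a ∈ t → b ∈ t → a ≠ b → x ∈ segment ℝ a b →
      ∃ s ∈ P.faces, OnBoundary P s ∧ x ∈ convexHull ℝ (s : Set Plane) := by
    intro a b ha hb hab hxs
    have he : IsEdge P {a, b} := isEdge_of_subset (Finset.card_pair hab) ⟨t, ht, h3⟩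
      (by intro y; simp; rintro (rfl | rfl) <;> assumption)
    by_cases hbd : OnBoundary P {a, b}
    · exact ⟨_, he.1, hbd, by simpa using hxs⟩
    obtain ⟨c, hac, hbc, hc, hcp⟩ := hP.exists_area_pos hab he.1 hbd one_ne_zero
    obtain ⟨d, had, hbd', hd, hdp⟩ := hP.exists_area_pos hab he.1 hbd (neg_ne_zero.2 one_ne_zero)
    have hcd : c ≠ d := by
      rintro rfl
      linarith
    have hvert : ∀ y ∈ t, y = x → ∃ s ∈ P.faces, OnBoundary P s ∧
        x ∈ convexHull ℝ (s : Set Plane) := by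
      rintro y hy rfl
      exact ⟨{y}, singleton_mem_faces ht hy, onBoundary_singleton.2 hx, by simp⟩
    by_cases hxa : a = x
    · exact hvert a ha hxa
    by_cases hxb : b = x
    · exact hvert b hb hxb
    exact absurd (openSegment_subset_interior hab hac hbc had hbd' hcd hc hd
      (mem_openSegment_of_ne_left_right hxa hxb hxs)) hx.2
  obtain ⟨a, b, c, hab, hac, hbc, rfl⟩ := Finset.card_eq_three.1 h3
  have hA := area_ne_zero ht hab hac hbc
  simp only [Finset.coe_insert, Finset.coe_singleton] at hxt
  obtain ⟨h1, h2, h4⟩ := (mem_convexHull_triple_iff hA).1 hxt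
  by_cases z1 : area x b c = 0
  · refine key b c (by simp) (by simp) hbc (mem_segment_of_area_eq_zero (c := a) ?_ ?_ ?_)
    · rwa [area_rotate]
    · convert hxt using 2
      ext y; simp; tauto
    · rwa [area_rotate]
  by_cases z2 : area a x c = 0
  · refine key c a (by simp) (by simp) hac.symm (mem_segment_of_area_eq_zero (c := b) ?_ ?_ ?_)
    · rwa [← area_rotate]
    · convert hxt using 2
      ext y; simp; tauto
    · rwa [← area_rotate]
  by_cases z3 : area a b x = 0
  · exact key a b (by simp) (by simp) hab (mem_segment_of_area_eq_zero hA hxt z3)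
  exact absurd (mem_interior_of_area_pos ht hA (lt_of_le_of_ne h1 (mul_ne_zero z1 hA).symm)
    (lt_of_le_of_ne h2 (mul_ne_zero z2 hA).symm) (lt_of_le_of_ne h4 (mul_ne_zero z3 hA).symm)) hx.2

theorem OnBoundary.isBoundaryVertex {s : Finset Plane} (hs : s ∈ P.faces) (hb : OnBoundary P s)
    {v : Plane} (hv : v ∈ s) : IsBoundaryVertex P v :=
  ⟨singleton_mem_faces hs hv, hb.mono (Finset.singleton_subset_iff.2 hv)⟩

theorem IsPolygon.exists_isBoundaryVertex (hP : IsPolygon P) : ∃ v, IsBoundaryVertex P v := by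
  obtain ⟨e⟩ := hP.2
  -- With empty frontier the compact polygon would be the whole plane.
  have hne : (frontier P.space).Nonempty := by
    rw [nonempty_iff_ne_empty]
    intro h
    rcases isClopen_iff.1 (isClopen_iff_frontier_eq_empty.2 h) with h | h
    · exact (isConnected_disc e).nonempty.ne_empty h
    · have h2 := (isCompact_disc e)
      rw [h] at h2
      exact noncompact_univ Plane h2
  obtain ⟨x, hx⟩ := hne
  obtain ⟨s, hs, hb, -⟩ := hP.exists_onBoundary hx
  obtain ⟨v, hv⟩ := SimplicialComplex.nonempty_of_mem_faces hs
  exact ⟨v, hb.isBoundaryVertex hs hv⟩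

/-- The boundary of a polygon is connected. -/
theorem IsPolygon.forall_isBoundaryVertex (hP : IsPolygon P) {p : Plane → Prop}
    (hp : ∀ u w : Plane, u ≠ w → IsBoundaryEdge P {u, w} → p u → p w) {u : Plane}
    (hub : IsBoundaryVertex P u) (hu : p u) {w : Plane} (hw : IsBoundaryVertex P w) : p w := by
  have hfin : Finite {s // s ∈ P.faces ∧ OnBoundary P s} :=
    (hP.1.subset (fun _ h => h.1 : {s | s ∈ P.faces ∧ OnBoundary P s} ⊆ P.faces)).to_subtype
  have hall : ∀ s ∈ P.faces, OnBoundary P s → ∀ u ∈ s, p u → ∀ w ∈ s, p w := by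
    intro s hs hb u hu hpu w hw
    by_cases huw : u = w
    · exact huw ▸ hpu
    have hsub : {u, w} ⊆ s := by
      intro y
      simp only [Finset.mem_insert, Finset.mem_singleton]
      rintro (rfl | rfl) <;> assumption
    exact hp u w huw ⟨⟨P.down_closed hs hsub (by simp), Finset.card_pair huw⟩, hb.mono hsub⟩ hpu
  -- The connected frontier is covered by the boundary simplices, and two of them that meet share a
  -- vertex.
  have := (isPreconnected_frontier_disc hP.2.some).forall_of_closed_cover
    (C := fun s : {s // s ∈ P.faces ∧ OnBoundary P s} => convexHull ℝ (s.1 : Set Plane))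
    (p := fun s => ∀ v ∈ s.1, p v) (fun s => isClosed_convexHull_finset _) (by
      intro x hx
      obtain ⟨s, hs, hb, hxs⟩ := hP.exists_onBoundary hx
      exact mem_iUnion.2 ⟨⟨s, hs, hb⟩, hxs⟩) (by
      rintro ⟨s, hs, hb⟩
      obtain ⟨v, hv⟩ := SimplicialComplex.nonempty_of_mem_faces hs
      exact ⟨v, hb (subset_convexHull ℝ _ hv), subset_convexHull ℝ _ hv⟩) (by
      rintro ⟨s, hs, hb⟩ ⟨s', hs', hb'⟩ ⟨x, -, hx1, hx2⟩ hps
      have h1 := P.inter_subset_convexHull hs hs' ⟨hx1, hx2⟩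
      obtain ⟨v, hv, hv'⟩ := convexHull_nonempty_iff.1 ⟨x, h1⟩
      exact fun w hw => hall s' hs' hb' v hv' (hps v hv) w hw)
    (i := ⟨{u}, hub⟩) (by simpa using hu) ⟨{w}, hw⟩
  exact this w (by simp)

end Polygon

theorem eq_pair_of_mem_pair {α : Type*} {r r' a b c d : α} (ha : a = r ∨ a = r')
    (hb : b = r ∨ b = r') (hc : c = r ∨ c = r') (hd : d = r ∨ d = r') (hab : a ≠ b)
    (hcd : c ≠ d) : (a = c ∧ b = d) ∨ (a = d ∧ b = c) := by
  grind

/-! ### Cocycles on a polygon, crossing numbers and acyclic dual graphs. -/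

section Cocycle

variable {P : SimplicialComplex ℝ Plane}

/-- There is an affine function on the plane with prescribed values at the vertices of a
triangle. -/
theorem exists_affine_of_area_ne_zero {a b d : Plane} (h : area a b d ≠ 0) (p q : ℝ) :
    ∃ (φ : Plane →L[ℝ] ℝ) (k : ℝ), φ a + k = 0 ∧ φ b + k = p ∧ φ d + k = q := by
  -- Cramer's rule for the linear form with values `p` at `b - a` and `q` at `d - a`.
  set φ : Plane →L[ℝ] ℝ :=
    ((p * (d 1 - a 1) - q * (b 1 - a 1)) / area a b d) • EuclideanSpace.proj (0 : Fin 2) +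
    ((q * (b 0 - a 0) - p * (d 0 - a 0)) / area a b d) • EuclideanSpace.proj (1 : Fin 2) with hφ
  have happ : ∀ x : Plane, φ x = (p * (d 1 - a 1) - q * (b 1 - a 1)) / area a b d * x 0 +
      (q * (b 0 - a 0) - p * (d 0 - a 0)) / area a b d * x 1 := by
    intro x
    simp [hφ]
  refine ⟨φ, -φ a, by ring, ?_, ?_⟩
  · rw [happ, happ]
    field_simp
    unfold area
    ring
  · rw [happ, happ]
    field_simp
    unfold area
    ring

/-- On one triangle the cocycle condition gives an affine primitive; letting it vanish at one vertex
makes all its vertex values integers. -/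
theorem exists_affine_triangle {c : Plane → Plane → ℤ} (hanti : ∀ a b, c b a = -c a b)
    (hc : ∀ a b d, a ≠ b → a ≠ d → b ≠ d → ({a, b, d} : Finset Plane) ∈ P.faces →
      c a b + c b d + c d a = 0) (t : Triangle P) :
    ∃ (φ : Plane →L[ℝ] ℝ) (k : ℝ), (∀ v ∈ t.1, ∃ n : ℤ, φ v + k = n) ∧
      ∀ u ∈ t.1, ∀ w ∈ t.1, φ w - φ u = c u w := by
  obtain ⟨t, ht, h3⟩ := t
  obtain ⟨a, b, d, hab, had, hbd, rfl⟩ := Finset.card_eq_three.1 h3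
  obtain ⟨φ, k, ha, hb, hd⟩ := exists_affine_of_area_ne_zero (area_ne_zero ht hab had hbd)
    (c a b) (c a d)
  have hself : ∀ x, c x x = 0 := fun x => by have := hanti x x; omega
  have hbd' : c b d = c a d - c a b := by
    have := hc a b d hab had hbd ht
    have := hanti a d
    omega
  refine ⟨φ, k, ?_, ?_⟩
  · simp only [Finset.mem_insert, Finset.mem_singleton]
    rintro v (rfl | rfl | rfl)
    · exact ⟨0, by simpa using ha⟩
    · exact ⟨_, hb⟩
    · exact ⟨_, hd⟩
  · simp only [Finset.mem_insert, Finset.mem_singleton]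
    rintro u (rfl | rfl | rfl) w (rfl | rfl | rfl)
    · simp [hself]
    · linarith
    · linarith
    · rw [hanti w u]; push_cast; linarith
    · simp [hself]
    · rw [hbd']; push_cast; linarith
    · rw [hanti w u]; push_cast; linarith
    · rw [hanti w u, hbd']; push_cast; linarith
    · simp [hself]

/-- An integral cocycle on a polygon is a coboundary. -/
theorem IsPolygon.exists_potential (hP : IsPolygon P) {c : Plane → Plane → ℤ}
    (hanti : ∀ a b, c b a = -c a b)
    (hc : ∀ a b d, a ≠ b → a ≠ d → b ≠ d → ({a, b, d} : Finset Plane) ∈ P.faces →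
      c a b + c b d + c d a = 0) :
    ∃ n : Plane → ℝ, ∀ a b, ({a, b} : Finset Plane) ∈ P.faces → n b - n a = c a b := by
  have := hP.finite_triangle
  choose φ k hk hφ using exists_affine_triangle hanti hc
  set ω : ℂ := 2 * Real.pi * Complex.I with hω
  have hω0 : ω ≠ 0 := Complex.two_pi_I_ne_zero
  -- The primitives of two triangles differ on a common face by an integer constant. Hence their
  -- exponentials glue to a nonvanishing function on the disc, and a logarithm of it is a global
  -- primitive.
  set A : Triangle P → Plane → ℂ := fun t x => ((φ t x + k t : ℝ) : ℂ) * ω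
  have hA : ∀ t, Continuous (A t) := fun t => by
    have : Continuous (φ t) := (φ t).continuous
    fun_prop
  have hagree : ∀ (t t' : Triangle P) (x : Plane), x ∈ convexHull ℝ (t.1 : Set Plane) →
      x ∈ convexHull ℝ (t'.1 : Set Plane) → Complex.exp (A t x) = Complex.exp (A t' x) := by
    intro t t' x hx hx'
    have h1 := P.inter_subset_convexHull t.2.1 t'.2.1 ⟨hx, hx'⟩
    obtain ⟨v, hv, hv'⟩ := convexHull_nonempty_iff.1 ⟨x, h1⟩
    have h2 : convexHull ℝ ((t.1 : Set Plane) ∩ t'.1) ⊆ {y | (φ t - φ t') y = (φ t - φ t') v} := by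
      refine convexHull_min ?_ (convex_hyperplane (φ t - φ t').toLinearMap.isLinear _)
      rintro u ⟨hu, hu'⟩
      have e1 := hφ t v hv u hu
      have e2 := hφ t' v hv' u hu'
      simp only [mem_ofPred_eq, sub_apply]
      linarith
    have h3 : (φ t - φ t') x = (φ t - φ t') v := h2 h1
    obtain ⟨n, hn⟩ := hk t v hv
    obtain ⟨n', hn'⟩ := hk t' v hv'
    rw [Complex.exp_eq_exp_iff_exists_int]
    refine ⟨n - n', ?_⟩
    have h4 : φ t x + k t = φ t' x + k t' + ((n - n' : ℤ) : ℝ) := by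
      simp only [sub_apply] at h3
      push_cast
      linarith
    simp only [A, h4]
    push_cast
    rw [hω]
    ring
  have := hP.nonempty_triangle
  choose! T hT using fun x (hx : x ∈ P.space) => (by
    obtain ⟨t, ht, h3, hxt⟩ := hP.exists_triangle_mem hx
    exact ⟨⟨t, ht, h3⟩, hxt⟩ : ∃ t : Triangle P, x ∈ convexHull ℝ (t.1 : Set Plane))
  set m : Plane → ℂ := fun x => Complex.exp (A (T x) x)
  have hspace : P.space = ⋃ t : Triangle P, convexHull ℝ (t.1 : Set Plane) :=
    Subset.antisymm (fun x hx => mem_iUnion.2 ⟨T x, hT x hx⟩)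
      (iUnion_subset fun t => SimplicialComplex.convexHull_subset_space t.2.1)
  have hmt : ∀ t : Triangle P, ∀ x ∈ convexHull ℝ (t.1 : Set Plane),
      m x = Complex.exp (A t x) := fun t x hx =>
    hagree _ _ _ (hT x (SimplicialComplex.convexHull_subset_space t.2.1 hx)) hx
  have hm : ContinuousOn m P.space := by
    rw [hspace]
    refine (locallyFinite_of_finite _).continuousOn_iUnion
      (fun t => isClosed_convexHull_finset _) fun t => ?_
    exact (Complex.continuous_exp.comp (hA t)).continuousOn.congr (hmt t)
  obtain ⟨g, hg, hgm⟩ := exists_log_disc hP.2.some hm fun x _ => Complex.exp_ne_zero _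
  refine ⟨fun x => (g x / ω).re, fun a b hab => ?_⟩
  obtain ⟨t, ht, hst, h3⟩ := hP.exists_triangle hab
  have ha : a ∈ t := hst (by simp)
  have hb : b ∈ t := hst (by simp)
  have hsub := SimplicialComplex.convexHull_subset_space ht
  have hconst := (convex_convexHull ℝ (t : Set Plane)).isPreconnected.eq_of_exp_eq_one
    (f := fun x => g x - A ⟨t, ht, h3⟩ x) ((hg.mono hsub).sub (hA _).continuousOn)
    (fun x hx => by
      rw [Complex.exp_sub, hgm x (hsub hx), hmt ⟨t, ht, h3⟩ x hx, div_self (Complex.exp_ne_zero _)])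
    (subset_convexHull ℝ _ ha) (subset_convexHull ℝ _ hb)
  have h5 : g b / ω - g a / ω = ((c a b : ℝ) : ℂ) := by
    rw [← hφ ⟨t, ht, h3⟩ a ha b hb, ← sub_div, div_eq_iff hω0]
    have : g b - g a = A ⟨t, ht, h3⟩ b - A ⟨t, ht, h3⟩ a := by linear_combination -hconst
    rw [this]
    simp only [A]
    push_cast
    ring
  have h6 := congrArg Complex.re h5
  rw [Complex.sub_re, Complex.ofReal_re] at h6
  exact h6

/-- The side of the edge from `a` to `b` on which the triangle `t` lies. -/
noncomputable def side (t : Finset Plane) (a b : Plane) : ℤ :=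
  if ∃ c ∈ t, 0 < area a b c then 1 else -1

theorem side_of_pos {a b c : Plane} (h : 0 < area a b c) : side {a, b, c} a b = 1 :=
  if_pos ⟨c, by simp, h⟩

theorem side_of_neg {a b c : Plane} (h : area a b c < 0) : side {a, b, c} a b = -1 := by
  refine if_neg ?_
  rintro ⟨x, hx, hpos⟩
  simp only [Finset.mem_insert, Finset.mem_singleton] at hx
  rcases hx with rfl | rfl | rfl
  · simp [area_self_left] at hpos
  · simp [area_self_right] at hpos
  · linarith

theorem side_eq {a b c : Plane} (h : area a b c ≠ 0) :
    side {a, b, c} a b = if 0 < area a b c then 1 else -1 := by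
  split_ifs with h1
  · exact side_of_pos h1
  · exact side_of_neg (lt_of_le_of_ne (not_lt.1 h1) h)

theorem side_swap {a b c : Plane} (h : area a b c ≠ 0) :
    side {a, b, c} b a = -side {a, b, c} a b := by
  have e : ({a, b, c} : Finset Plane) = {b, a, c} := by
    ext x; simp; tauto
  have h' : area b a c ≠ 0 := by rw [area_swap]; exact neg_ne_zero.2 h
  rw [side_eq h]
  conv_lhs => rw [e]
  rw [side_eq h', area_swap]
  rcases lt_or_gt_of_ne h with h1 | h1
  · rw [if_pos (by linarith), if_neg (by linarith)]; rfl
  · rw [if_neg (by linarith), if_pos h1]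

theorem side_ne_zero (t : Finset Plane) (a b : Plane) : side t a b ≠ 0 := by
  unfold side
  split_ifs <;> decide

/-- The signed crossing number of the step from the triangle `t` to the triangle `t'` with the
edge from `a` to `b`. -/
noncomputable def crossing (t t' : Triangle P) (a b : Plane) : ℤ :=
  if a ≠ b ∧ {a, b} ⊆ t.1 ∩ t'.1 then side t.1 a b else 0

theorem crossing_antisymm (t t' : Triangle P) (a b : Plane) :
    crossing t t' b a = -crossing t t' a b := by
  unfold crossing
  by_cases h : a ≠ b ∧ {a, b} ⊆ t.1 ∩ t'.1
  · rw [if_pos h, if_pos ⟨h.1.symm, by rw [Finset.pair_comm]; exact h.2⟩]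
    have h1 := h.2.trans Finset.inter_subset_left
    obtain ⟨t, ht, h3⟩ := t
    obtain ⟨c, hac, hbc, rfl⟩ := exists_eq_triple h3 (h1 (by simp)) (h1 (by simp)) h.1
    exact side_swap (area_ne_zero ht h.1 hac hbc)
  · rw [if_neg h, if_neg, neg_zero]
    rintro ⟨h1, h2⟩
    exact h ⟨h1.symm, by rw [Finset.pair_comm]; exact h2⟩

theorem crossing_of_not_subset {t t' : Triangle P} {a b : Plane} (h : ¬ {a, b} ⊆ t.1 ∩ t'.1) :
    crossing t t' a b = 0 :=
  if_neg fun h' => h h'.2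

theorem not_subset_of_pair_eq {x y z : Plane} (hxz : x ≠ z) (hyz : y ≠ z) {s : Finset Plane}
    (hs : s = {x, y}) {u : Plane} : ¬ ({z, u} : Finset Plane) ⊆ s := by
  intro h
  have : z ∈ s := h (by simp)
  simp [hs, hxz.symm, hyz.symm] at this

theorem side_eq_side_cyclic {a b c : Plane} (h : area a b c ≠ 0) :
    side {a, b, c} b c = side {a, b, c} a b := by
  have e : ({a, b, c} : Finset Plane) = {b, c, a} := by
    ext x; simp; tauto
  have h' : area b c a ≠ 0 := by rwa [area_rotate]
  rw [side_eq h]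
  conv_lhs => rw [e]
  rw [side_eq h', area_rotate]

/-- The crossing numbers of a step with the three edges of a triangle add up to zero unless the
step starts or ends there. -/
theorem IsPolygon.crossing_sum (hP : IsPolygon P) {t t' : Triangle P} (hne : t ≠ t')
    (hadj : (t.1 ∩ t'.1).card = 2) {x y z : Plane} (hxy : x ≠ y) (hxz : x ≠ z) (hyz : y ≠ z)
    (s : Triangle P) (hs : s.1 = {x, y, z}) :
    crossing t t' x y + crossing t t' y z + crossing t t' z x =
      side s.1 x y * ((if s = t then 1 else 0) - (if s = t' then 1 else 0)) := by
  have hA : area x y z ≠ 0 := area_ne_zero (hs ▸ s.2.1) hxy hxz hyz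
  have hside1 : side s.1 y z = side s.1 x y := by rw [hs]; exact side_eq_side_cyclic hA
  have hside2 : side s.1 z x = side s.1 x y := by
    rw [← hside1, hs]
    have e : ({x, y, z} : Finset Plane) = {y, z, x} := by
      ext w; simp; tauto
    rw [e]
    exact side_eq_side_cyclic (by rwa [area_rotate])
  -- The triangles lie on opposite sides of the common edge, so leaving `t` and entering `t'` count
  -- with opposite signs.
  have hopp : ∀ a b : Plane, a ≠ b → {a, b} ⊆ t.1 ∩ t'.1 → side t'.1 a b = -side t.1 a b := by
    intro a b hab hsub
    have h1 := hsub.trans Finset.inter_subset_left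
    have h2 := hsub.trans Finset.inter_subset_right
    obtain ⟨t, ht, h3⟩ := t
    obtain ⟨t', ht', h3'⟩ := t'
    obtain ⟨c, hac, hbc, rfl⟩ := exists_eq_triple h3 (h1 (by simp)) (h1 (by simp)) hab
    obtain ⟨d, had, hbd, rfl⟩ := exists_eq_triple h3' (h2 (by simp)) (h2 (by simp)) hab
    have hcd : c ≠ d := by rintro rfl; exact hne rfl
    have hn := area_mul_area_neg hab hac hbc had hbd hcd ht ht'
    rcases mul_neg_iff.1 hn with ⟨q1, q2⟩ | ⟨q1, q2⟩
    · simp only [side_of_pos q1, side_of_neg q2]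
    · simp only [side_of_pos q2, side_of_neg q1, neg_neg]
  by_cases hcase : s = t ∨ s = t'
  · have hsub : t.1 ∩ t'.1 ⊆ s.1 := by
      rcases hcase with rfl | rfl
      · exact Finset.inter_subset_left
      · exact Finset.inter_subset_right
    have hval : ∀ a b : Plane, a ≠ b → {a, b} = t.1 ∩ t'.1 → side s.1 a b = side s.1 x y →
        crossing t t' a b = side s.1 x y * ((if s = t then 1 else 0) - (if s = t' then 1 else 0)) := by
      intro a b hab he hsd
      rw [crossing, if_pos ⟨hab, he.subset⟩, ← hsd]
      rcases hcase with rfl | rfl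
      · simp [hne]
      · rw [hopp a b hab he.subset]
        simp [hne.symm]
    have hcases : t.1 ∩ t'.1 = {x, y} ∨ t.1 ∩ t'.1 = {y, z} ∨ t.1 ∩ t'.1 = {z, x} := by
      by_cases hx : x ∈ t.1 ∩ t'.1
      · by_cases hy : y ∈ t.1 ∩ t'.1
        · left
          exact (Finset.eq_of_subset_of_card_le (by
            intro w; simp only [Finset.mem_insert, Finset.mem_singleton]
            rintro (rfl | rfl) <;> assumption) (by rw [hadj, Finset.card_pair hxy])).symm
        · right; right
          refine Finset.eq_of_subset_of_card_le ?_ (by rw [hadj, Finset.card_pair hxz.symm])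
          intro w hw
          have := hsub hw
          simp only [hs, Finset.mem_insert, Finset.mem_singleton] at this ⊢
          rcases this with rfl | rfl | rfl
          · simp
          · exact absurd hw hy
          · simp
      · right; left
        refine Finset.eq_of_subset_of_card_le ?_ (by rw [hadj, Finset.card_pair hyz])
        intro w hw
        have := hsub hw
        simp only [hs, Finset.mem_insert, Finset.mem_singleton] at this ⊢
        rcases this with rfl | rfl | rfl
        · exact absurd hw hx
        · simp
        · simp
    rcases hcases with h | h | h
    · rw [hval x y hxy h.symm rfl, crossing_of_not_subset (a := z) (not_subset_of_pair_eq hxz hyz h),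
        crossing_of_not_subset (a := y) (b := z), add_zero, add_zero]
      rw [Finset.pair_comm]
      exact not_subset_of_pair_eq hxz hyz h
    · rw [hval y z hyz h.symm hside1,
        crossing_of_not_subset (a := x) (not_subset_of_pair_eq hxy.symm hxz.symm h),
        crossing_of_not_subset (a := z) (b := x), zero_add, add_zero]
      rw [Finset.pair_comm]
      exact not_subset_of_pair_eq hxy.symm hxz.symm h
    · rw [hval z x hxz.symm h.symm hside2,
        crossing_of_not_subset (a := y) (not_subset_of_pair_eq hyz.symm hxy h),
        crossing_of_not_subset (a := x) (b := y), zero_add, zero_add]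
      rw [Finset.pair_comm]
      exact not_subset_of_pair_eq hyz.symm hxy h
  -- The shared edge is not an edge of `s`, since only two triangles contain it.
  · rw [not_or] at hcase
    have hz : ∀ a b : Plane, a ≠ b → {a, b} ⊆ s.1 → crossing t t' a b = 0 := by
      intro a b hab hsub
      refine crossing_of_not_subset fun h => ?_
      have h1 := h.trans Finset.inter_subset_left
      have h2 := h.trans Finset.inter_subset_right
      have he : IsEdge P {a, b} := isEdge_of_subset (Finset.card_pair hab) s hsub
      obtain ⟨r, r', hrr, -, -, hall⟩ := hP.exists_pair_triangles he
        (not_onBoundary_of_two_triangles he.2 hne h1 h2)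
      have a1 := hall s hsub
      have a2 := hall t h1
      have a3 := hall t' h2
      rcases eq_pair_of_mem_pair a1 a2 a1 a3 hcase.1 hcase.2 with h | h
      · exact hne h.2
      · exact hcase.2 h.1
    rw [hz x y hxy (by rw [hs]; intro w; simp; tauto),
      hz y z hyz (by rw [hs]; intro w; simp; tauto),
      hz z x hxz.symm (by rw [hs]; intro w; simp; tauto)]
    simp [hcase.1, hcase.2]

/-- The signed crossing number of a walk in the dual graph with the edge from `a` to `b`. -/
noncomputable def walkCrossing {G : SimpleGraph (Triangle P)} (a b : Plane) :
    ∀ {t t' : Triangle P}, G.Walk t t' → ℤ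
  | _, _, .nil => 0
  | t, _, .cons (v := t') _ p => crossing t t' a b + walkCrossing a b p

theorem dualGraph_adj {S : Set (Finset Plane)} {t t' : Triangle P} :
    (dualGraph P S).Adj t t' ↔ t ≠ t' ∧ ∃ e ∈ S, IsEdge P e ∧ e ⊆ t.1 ∧ e ⊆ t'.1 := by
  unfold dualGraph
  rw [SimpleGraph.fromRel_adj]
  constructor
  · rintro ⟨hne, h | ⟨e, h1, h2, h3, h4⟩⟩
    · exact ⟨hne, h⟩
    · exact ⟨hne, e, h1, h2, h4, h3⟩
  · rintro ⟨hne, h⟩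
    exact ⟨hne, Or.inl h⟩

theorem walkCrossing_antisymm {G : SimpleGraph (Triangle P)} (a b : Plane) {t t' : Triangle P}
    (p : G.Walk t t') : walkCrossing b a p = -walkCrossing a b p := by
  induction p with
  | nil => simp [walkCrossing]
  | cons h p ih => rw [walkCrossing, walkCrossing, ih, crossing_antisymm]; ring

theorem dualGraph_inter_mem {S : Set (Finset Plane)} {t t' : Triangle P}
    (h : (dualGraph P S).Adj t t') : t.1 ∩ t'.1 ∈ S ∧ (t.1 ∩ t'.1).card = 2 := by
  obtain ⟨hne, e, heS, he, h1, h2⟩ := dualGraph_adj.1 h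
  rw [← eq_inter_of_subset he.2 hne h1 h2]
  exact ⟨heS, he.2⟩

/-- The contributions of the steps telescope. For a closed walk the right side vanishes, so its
crossing numbers form a cocycle. -/
theorem IsPolygon.walkCrossing_sum (hP : IsPolygon P) {S : Set (Finset Plane)} {x y z : Plane}
    (hxy : x ≠ y) (hxz : x ≠ z) (hyz : y ≠ z) (s : Triangle P) (hs : s.1 = {x, y, z})
    {t t' : Triangle P} (p : (dualGraph P S).Walk t t') :
    walkCrossing x y p + walkCrossing y z p + walkCrossing z x p =
      side s.1 x y * ((if s = t then 1 else 0) - (if s = t' then 1 else 0)) := by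
  induction p with
  | nil => simp [walkCrossing]
  | cons h p ih =>
    have := hP.crossing_sum h.ne (dualGraph_inter_mem h).2 hxy hxz hyz s hs
    simp only [walkCrossing]
    linear_combination this + ih

theorem walkCrossing_eq_zero {G : SimpleGraph (Triangle P)} {a b : Plane} {t t' : Triangle P}
    (p : G.Walk t t') (h : ∀ d ∈ p.darts, ¬ {a, b} ⊆ d.fst.1 ∩ d.snd.1) :
    walkCrossing a b p = 0 := by
  induction p with
  | nil => rfl
  | cons hadj p ih =>
    rw [walkCrossing, ih fun d hd => h d (by simp [hd]), add_zero]
    exact crossing_of_not_subset (h ⟨(_, _), hadj⟩ (by simp))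

/-- A set of edges of a polygon such that all vertices are connected by the other edges has an
acyclic dual graph. -/
theorem IsPolygon.isAcyclic_dualGraph (hP : IsPolygon P) {S : Set (Finset Plane)}
    (hS : ∀ n : Plane → ℝ, (∀ a b, a ≠ b → ({a, b} : Finset Plane) ∈ P.faces →
      ({a, b} : Finset Plane) ∉ S → n a = n b) → ∀ a ∈ P.vertices, ∀ b ∈ P.vertices, n a = n b) :
    (dualGraph P S).IsAcyclic := by
  rw [SimpleGraph.isAcyclic_iff_forall_adj_isBridge]
  intro t t' hadj
  rw [SimpleGraph.isBridge_iff_forall_walk_mem_edges]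
  intro p
  by_contra hp
  -- If the dual edge is not a bridge in the sense of graph theory, `q` is a closed walk that
  -- crosses the common edge of `t` and `t'` exactly once.
  set q : (dualGraph P S).Walk t' t' := .cons hadj.symm p
  obtain ⟨n, hn⟩ := hP.exists_potential (c := fun a b => walkCrossing a b q)
    (fun a b => walkCrossing_antisymm a b q) (by
      intro x y z hxy hxz hyz hf
      rw [hP.walkCrossing_sum hxy hxz hyz
        ⟨_, hf, Finset.card_eq_three.2 ⟨x, y, z, hxy, hxz, hyz, rfl⟩⟩ rfl]
      simp)
  have hdart : ∀ a b, a ≠ b → ∀ d ∈ q.darts, {a, b} ⊆ d.fst.1 ∩ d.snd.1 →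
      ({a, b} : Finset Plane) = d.fst.1 ∩ d.snd.1 := by
    intro a b hab d _ hsub
    exact Finset.eq_of_subset_of_card_le hsub
      (by rw [Finset.card_pair hab, (dualGraph_inter_mem d.adj).2])
  -- The walk crosses only edges in `S`, so `n` does not change along any other edge.
  have hconst := hS n (by
    intro a b hab hf hnS
    have h1 := hn a b hf
    rw [walkCrossing_eq_zero q] at h1
    · simp at h1; linarith
    · intro d hd hsub
      exact hnS (hdart a b hab d hd hsub ▸ (dualGraph_inter_mem d.adj).1))
  obtain ⟨a, b, hab, he⟩ := exists_eq_pair (dualGraph_inter_mem hadj).2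
  have hat : {a, b} ⊆ t.1 := he ▸ Finset.inter_subset_left
  have hat' : {a, b} ⊆ t'.1 := he ▸ Finset.inter_subset_right
  have hE : IsEdge P {a, b} := isEdge_of_subset (Finset.card_pair hab) t hat
  have h1 := hn a b hE.1
  rw [hconst a (singleton_mem_faces hE.1 (by simp)) b (singleton_mem_faces hE.1 (by simp)),
    sub_self] at h1
  have h2 : walkCrossing a b p = 0 := by
    refine walkCrossing_eq_zero p fun d hd hsub => hp ?_
    obtain ⟨r, r', hrr, -, -, hall⟩ := hP.exists_pair_triangles hE
      (not_onBoundary_of_two_triangles hE.2 hadj.ne hat hat')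
    have a1 := hall t hat
    have a2 := hall t' hat'
    have a3 := hall d.fst (hsub.trans Finset.inter_subset_left)
    have a4 := hall d.snd (hsub.trans Finset.inter_subset_right)
    have hcases := eq_pair_of_mem_pair a1 a2 a3 a4 hadj.ne d.adj.ne
    have hde : d.edge ∈ p.edges := List.mem_map_of_mem hd
    rcases hcases with ⟨rfl, rfl⟩ | ⟨rfl, rfl⟩
    · exact hde
    · rw [Sym2.eq_swap]; exact hde
  simp only [q, walkCrossing, h2, add_zero] at h1
  rw [crossing, if_pos ⟨hab, Finset.subset_inter hat' hat⟩] at h1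
  exact side_ne_zero _ _ _ (by exact_mod_cast h1.symm)

end Cocycle

/-! ### Rooted trees -/

section Tree

variable {V : Type*} {T : SimpleGraph V}

/-- Both neighbours are the penultimate vertex of the path from `r` to `a`: a shortest path to a
nearer neighbour is too short to pass through `a`. This is the uniqueness of parents. -/
theorem eq_of_adj_of_dist_lt (hT : T.IsTree) {r a b b' : V} (hb : T.Adj a b) (hb' : T.Adj a b')
    (h : T.dist r b < T.dist r a) (h' : T.dist r b' < T.dist r a) : b = b' := by
  obtain ⟨p, hp, hpl⟩ := hT.connected.exists_path_of_dist r a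
  have key : ∀ c, T.Adj a c → T.dist r c < T.dist r a → c = p.penultimate := by
    intro c hc hlt
    obtain ⟨q, hq, hql⟩ := hT.connected.exists_path_of_dist r c
    refine hT.isAcyclic.eq_penultimate_of_adj_end hp hc
      (hT.isAcyclic.mem_support_of_ne_mem_support_of_adj_of_isPath hp hq hc fun ha => ?_)
    have h1 := SimpleGraph.dist_le (q.takeUntil a ha)
    have h2 := q.length_takeUntil_le_length ha
    omega
  exact (key b hb h).trans (key b' hb' h').symm

theorem exists_adj_dist_lt (hT : T.Connected) {r a : V} (ha : a ≠ r) :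
    ∃ b, T.Adj a b ∧ T.dist r b < T.dist r a := by
  obtain ⟨p, hp⟩ := hT.exists_walk_length_eq_dist a r
  cases p with
  | nil => exact absurd rfl ha
  | cons h p =>
    refine ⟨_, h, ?_⟩
    have h1 := SimpleGraph.dist_le p
    rw [SimpleGraph.Walk.length_cons] at hp
    rw [T.dist_comm (u := r), T.dist_comm (u := r)]
    omega

end Tree

section RootedPairs

variable {α : Type*} {S : Set α} {T : SimpleGraph S} {r : S}

theorem rootedPairs_eq_of_fst_eq (hT : T.IsTree) {p p' : Finset α × Finset α}
    (hp : p ∈ rootedPairs T r) (hp' : p' ∈ rootedPairs T r) (h : p.1 = p'.1) : p = p' := by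
  obtain ⟨a, b, hab, hd, h1, h2⟩ := hp
  obtain ⟨a', b', hab', hd', h1', h2'⟩ := hp'
  have haa : a = a' := by
    rw [h, h1'] at h1
    exact (Subtype.ext (singleton_injective h1)).symm
  subst haa
  obtain rfl := eq_of_adj_of_dist_lt hT hab hab' hd hd'
  exact Prod.ext h (Finset.coe_injective (h2.trans h2'.symm))

/-- The distances from the root differ at the two endpoints, so the edge determines which of them is
paired. -/
theorem rootedPairs_eq_of_snd_eq {p p' : Finset α × Finset α}
    (hp : p ∈ rootedPairs T r) (hp' : p' ∈ rootedPairs T r) (h : p.2 = p'.2) : p = p' := by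
  obtain ⟨a, b, hab, hd, h1, h2⟩ := hp
  obtain ⟨a', b', hab', hd', h1', h2'⟩ := hp'
  rw [h, h2', pair_eq_pair_iff] at h2
  rcases h2 with ⟨q1, q2⟩ | ⟨q1, q2⟩
  · refine Prod.ext (Finset.coe_injective ?_) h
    rw [h1, h1', q1]
  · rw [Subtype.ext q1, Subtype.ext q2] at hd'
    omega

end RootedPairs

/-! ### The pieces of a polygon -/

section Pieces

variable {P : SimplicialComplex ℝ Plane}

theorem inPiece_mono {j : Piece P} {s s' : Finset Plane} (h : s ⊆ s') (hs : InPiece j s') :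
    InPiece j s := by
  obtain ⟨t, ht, hst⟩ := hs
  exact ⟨t, ht, h.trans hst⟩

/-- An edge with an internal vertex is neither a boundary edge nor a crossing edge, so it does not
separate pieces. -/
theorem mem_supp_of_common_edge {j : Piece P} {t t' : Triangle P} (ht : t ∈ j.supp)
    {e : Finset Plane} (he : IsEdge P e) {v : Plane} (hv : v ∈ e) (hvi : IsInternalVertex P v)
    (h : e ⊆ t.1) (h' : e ⊆ t'.1) : t' ∈ j.supp := by
  by_cases hne : t = t'
  · exact hne ▸ ht
  rw [SimpleGraph.ConnectedComponent.mem_supp_iff] at ht ⊢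
  rw [← ht]
  refine (SimpleGraph.ConnectedComponent.connectedComponentMk_eq_of_adj ?_).symm
  refine dualGraph_adj.2 ⟨hne, e, ⟨hvi.not_onBoundary hv, fun hc => ?_⟩, he, h, h'⟩
  exact hvi.not_isBoundaryVertex (hc.2.2 v hv)

/-- An internal vertex belongs to a single piece. -/
theorem IsPolygon.piece_unique (hP : IsPolygon P) {v : Plane} (hv : IsInternalVertex P v)
    {j j' : Piece P} (h : InPiece j {v}) (h' : InPiece j' {v}) : j = j' := by
  obtain ⟨t, ht, hvt⟩ := h
  obtain ⟨t', ht', hvt'⟩ := h'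
  have h1 : t' ∈ j.supp := hP.forall_triangle_at hv (p := fun t => t ∈ j.supp)
    (fun r r' e _ he hve h1 h2 hr => mem_supp_of_common_edge hr he hve hv h1 h2)
    (Finset.singleton_subset_iff.1 hvt) (Finset.singleton_subset_iff.1 hvt') ht
  rw [SimpleGraph.ConnectedComponent.mem_supp_iff] at h1 ht'
  exact h1.symm.trans ht'

theorem pair_subset {a b : Plane} {t : Finset Plane} (ha : a ∈ t) (hb : b ∈ t) :
    ({a, b} : Finset Plane) ⊆ t := by
  intro x
  simp only [Finset.mem_insert, Finset.mem_singleton]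
  rintro (rfl | rfl) <;> assumption

/-- A piece with an internal vertex has a bridge edge. -/
theorem IsPolygon.exists_bridge (hP : IsPolygon P) {j : Piece P}
    (hj : (internalVertices j).Nonempty) : ∃ b w, IsBridgeEdge P {b, w} ∧ InPiece j {b, w} ∧
      IsBoundaryVertex P b ∧ w ∈ internalVertices j := by
  by_contra hcon
  -- Without a bridge edge, a triangle of the piece with one internal vertex has only internal
  -- vertices. This spreads across edges to the whole polygon, which does have boundary vertices.
  have hall : ∀ t ∈ j.supp, ∀ v ∈ t.1, IsInternalVertex P v → ∀ u ∈ t.1, IsInternalVertex P u := by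
    intro t ht v hv hvi u hu
    rcases isInternalVertex_or_isBoundaryVertex t.2.1 hu with h | h
    · exact h
    · have huv : u ≠ v := by
        rintro rfl
        exact hvi.not_isBoundaryVertex h
      have hin : InPiece j {u, v} := ⟨t, ht, pair_subset hu hv⟩
      exact absurd ⟨u, v, ⟨isEdge_of_subset (Finset.card_pair huv) t (pair_subset hu hv),
        ⟨v, by simp, hvi⟩, ⟨u, by simp, h⟩⟩, hin, h, hvi, inPiece_mono (by simp) hin⟩ hcon
  obtain ⟨v, hvi, t, ht, hvt⟩ := hj
  have hvt' := Finset.singleton_subset_iff.1 hvt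
  have hev := hP.forall_triangle
    (p := fun t => t ∈ j.supp ∧ ∀ u ∈ t.1, IsInternalVertex P u)
    (t := t) (fun r r' e _ he _ h1 h2 hr => by
      obtain ⟨u, hu⟩ := Finset.card_pos.1 (by rw [he.2]; exact two_pos)
      have hui := hr.2 u (h1 hu)
      have hr' := mem_supp_of_common_edge hr.1 he hu hui h1 h2
      exact ⟨hr', hall r' hr' u (h2 hu) hui⟩) ⟨ht, hall t ht v hvt' hvi⟩
  obtain ⟨w, hw⟩ := hP.exists_isBoundaryVertex
  obtain ⟨s, hs, hws, h3⟩ := hP.exists_triangle hw.1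
  exact ((hev ⟨s, hs, h3⟩).2 w (hws (by simp))).not_isBoundaryVertex hw

theorem pieceGraph_adj {j : Piece P} {b w : Plane}
    {x y : (insert b (internalVertices j) : Set Plane)} (hne : x ≠ y)
    (hin : InPiece j {x.1, y.1})
    (h : IsInternalEdge P {x.1, y.1} ∨ ({x.1, y.1} : Set Plane) = {b, w}) :
    (pieceGraph j b w).Adj x y := by
  refine (SimpleGraph.fromRel_adj _ _ _).2 ⟨hne, Or.inl ⟨{x.1, y.1}, by simp, hin, ?_⟩⟩
  simpa using h

/-- The internal vertices of a triangle are adjacent to each other. Consecutive triangles of a piece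
share an edge that is neither boundary nor crossing, hence an internal vertex. -/
theorem connected_pieceGraph {j : Piece P} {b w : Plane} (hin : InPiece j {b, w})
    (hb : IsBoundaryVertex P b) (hw : w ∈ internalVertices j) :
    (pieceGraph j b w).Connected := by
  rw [SimpleGraph.connected_iff_exists_forall_reachable]
  set w' : (insert b (internalVertices j) : Set Plane) := ⟨w, Or.inr hw⟩
  have hadj : ∀ t ∈ j.supp, ∀ u v : (insert b (internalVertices j) : Set Plane),
      IsInternalVertex P u.1 → IsInternalVertex P v.1 → u.1 ∈ t.1 → v.1 ∈ t.1 →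
      (pieceGraph j b w).Reachable u v := by
    intro t ht u v hui hvi hu hv
    by_cases huv : u = v
    · exact huv ▸ SimpleGraph.Reachable.refl _
    have hne : u.1 ≠ v.1 := fun h => huv (Subtype.ext h)
    refine (pieceGraph_adj huv ⟨t, ht, pair_subset hu hv⟩ (Or.inl
      ⟨isEdge_of_subset (Finset.card_pair hne) t (pair_subset hu hv), ?_⟩)).reachable
    simp only [Finset.mem_insert, Finset.mem_singleton]
    rintro x (rfl | rfl) <;> assumption
  refine ⟨w', ?_⟩
  rintro ⟨x, rfl | hx⟩
  · have hne : w ≠ x := by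
      rintro rfl
      exact hw.1.not_isBoundaryVertex hb
    refine (pieceGraph_adj (fun h => hne (congrArg Subtype.val h)) ?_ (Or.inr ?_)).reachable
    · rwa [Finset.pair_comm]
    · exact pair_comm _ _
  · obtain ⟨hwi, t₀, ht₀, hwt₀⟩ := id hw
    obtain ⟨hxi, t, ht, hxt⟩ := id hx
    have hreach : Relation.ReflTransGen
        (dualGraph P {e | ¬ OnBoundary P e ∧ ¬ IsCrossingEdge P e}).Adj t₀ t := by
      rw [← SimpleGraph.reachable_iff_reflTransGen]
      exact SimpleGraph.ConnectedComponent.exact (ht₀.trans ht.symm)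
    have key : t ∈ j.supp ∧ ∀ v : (insert b (internalVertices j) : Set Plane),
        IsInternalVertex P v.1 → v.1 ∈ t.1 → (pieceGraph j b w).Reachable w' v := by
      clear hxt ht
      induction hreach with
      | refl => exact ⟨ht₀, fun v hv hvt =>
          hadj t₀ ht₀ w' v hwi hv (Finset.singleton_subset_iff.1 hwt₀) hvt⟩
      | @tail t t' _ hstep ih =>
        obtain ⟨-, e, ⟨hnb, hnc⟩, he, h1, h2⟩ := dualGraph_adj.1 hstep
        obtain ⟨u, hue, hub⟩ : ∃ u ∈ e, IsInternalVertex P u := by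
          by_contra hcon
          refine hnc ⟨he, hnb, fun u hu => ?_⟩
          exact (isInternalVertex_or_isBoundaryVertex he.1 hu).resolve_left
            fun h => hcon ⟨u, hu, h⟩
        have ht' := mem_supp_of_common_edge ih.1 he hue hub h1 h2
        have hu' : u ∈ internalVertices j :=
          ⟨hub, t', ht', Finset.singleton_subset_iff.2 (h2 hue)⟩
        refine ⟨ht', fun v hv hvt => (ih.2 ⟨u, Or.inr hu'⟩ hub (h1 hue)).trans ?_⟩
        exact hadj t' ht' ⟨u, Or.inr hu'⟩ v hub hv (h2 hue) hvt
    exact key.2 ⟨x, Or.inr hx⟩ hxi (Finset.singleton_subset_iff.1 hxt)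

theorem IsPolygon.nonempty_pieceChoice (hP : IsPolygon P) {j : Piece P}
    (hj : (internalVertices j).Nonempty) : Nonempty (PieceChoice j) := by
  obtain ⟨b, w, hbr, hin, hb, hw⟩ := hP.exists_bridge hj
  obtain ⟨T, hT, htree⟩ := (connected_pieceGraph hin hb hw).exists_isTree_le
  exact ⟨⟨b, w, {b, w}, by simp, hbr, hin, hb, hw, T, hT, htree⟩⟩

theorem PieceChoice.usedEdges_spec {j : Piece P} (C : PieceChoice j) {e : Finset Plane}
    (he : e ∈ C.usedEdges) : IsEdge P e ∧ InPiece j e ∧ ∃ v ∈ e, v ∈ internalVertices j := by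
  obtain ⟨x, y, hxy, hexy⟩ := he
  have key : ∀ x y : (insert C.b (internalVertices j) : Set Plane), x ≠ y →
      (e : Set Plane) = {x.1, y.1} → (∃ e' : Finset Plane, (e' : Set Plane) = {x.1, y.1} ∧
        InPiece j e' ∧ (IsInternalEdge P e' ∨ (e' : Set Plane) = {C.b, C.w})) →
      IsEdge P e ∧ InPiece j e ∧ ∃ v ∈ e, v ∈ internalVertices j := by
    rintro x y hne he ⟨e', he', hin, hor⟩
    obtain rfl : e = e' := Finset.coe_injective (he.trans he'.symm)
    refine ⟨?_, hin, ?_⟩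
    · rcases hor with h | h
      · exact h.1
      · rw [← C.coe_bridge] at h
        rw [Finset.coe_injective h]
        exact C.isBridge.1
    · have hx : x.1 ∈ e := by rw [← Finset.mem_coe, he]; simp
      have hy : y.1 ∈ e := by rw [← Finset.mem_coe, he]; simp
      rcases x.2 with h | h
      · rcases y.2 with h' | h'
        · exact absurd (Subtype.ext (h.trans h'.symm)) hne
        · exact ⟨_, hy, h'⟩
      · exact ⟨_, hx, h⟩
  obtain ⟨hne, h | h⟩ := (SimpleGraph.fromRel_adj _ _ _).1 (C.T_le hxy)
  · exact key x y hne hexy h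
  · exact key y x hne.symm (hexy.trans (pair_comm _ _)) h

/-- The root `b` is never the farther endpoint, so the paired vertex is internal. -/
theorem PieceChoice.pairs_spec {j : Piece P} (C : PieceChoice j) {p : Finset Plane × Finset Plane}
    (hp : p ∈ C.pairs) : p.2 ∈ C.usedEdges ∧ ∃ a ∈ internalVertices j, p.1 = {a} ∧ a ∈ p.2 := by
  obtain ⟨a, b, hab, hd, h1, h2⟩ := hp
  refine ⟨⟨a, b, hab, h2⟩, a, ?_, by exact_mod_cast h1, ?_⟩
  · refine a.2.resolve_left fun h => ?_
    have : a = ⟨C.b, Set.mem_insert _ _⟩ := Subtype.ext h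
    rw [this, SimpleGraph.dist_self] at hd
    omega
  · rw [← Finset.mem_coe, h2]
    simp

/-- The edges used by a family of spanning trees. -/
def polygonUsedEdges (pc : ∀ j : Piece P, (internalVertices j).Nonempty → PieceChoice j) :
    Set (Finset Plane) :=
  {e | ∃ j hj, e ∈ (pc j hj).usedEdges}

/-- The edges dual to those of the graph determined by a family of spanning trees. -/
def polygonDualEdges (pc : ∀ j : Piece P, (internalVertices j).Nonempty → PieceChoice j) :
    Set (Finset Plane) :=
  {e | IsEdge P e ∧ ¬ OnBoundary P e ∧ (e ∉ polygonUsedEdges pc ∨ IsCrossingEdge P e)}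

variable (pc : ∀ j : Piece P, (internalVertices j).Nonempty → PieceChoice j)

/-- A used edge has an internal endpoint. Thus the alternative `IsCrossingEdge` in the definition of
the dual edges never readmits a used edge. -/
theorem polygonUsedEdges_spec {pc : ∀ j : Piece P, (internalVertices j).Nonempty → PieceChoice j}
    {e : Finset Plane} (he : e ∈ polygonUsedEdges pc) :
    IsEdge P e ∧ ¬ OnBoundary P e ∧ ¬ IsCrossingEdge P e ∧ e ∉ polygonDualEdges pc := by
  obtain ⟨j, hj, h⟩ := id he
  obtain ⟨h1, -, v, hv, hvi⟩ := PieceChoice.usedEdges_spec _ h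
  have h3 : ¬ IsCrossingEdge P e := fun hc => hvi.1.not_isBoundaryVertex (hc.2.2 v hv)
  refine ⟨h1, hvi.1.not_onBoundary hv, h3, ?_⟩
  rintro ⟨-, -, h4 | h4⟩
  · exact h4 he
  · exact h3 h4

/-- The edges outside the dual set join all vertices: the boundary is connected, and an internal
vertex is joined to the boundary vertex `b` by the tree of its piece. -/
theorem IsPolygon.isAcyclic_polygonDual (hP : IsPolygon P) :
    (dualGraph P (polygonDualEdges pc)).IsAcyclic := by
  refine hP.isAcyclic_dualGraph fun n hn => ?_
  obtain ⟨u₀, hu₀⟩ := hP.exists_isBoundaryVertex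
  have hbd : ∀ w, IsBoundaryVertex P w → n w = n u₀ := fun w hw =>
    hP.forall_isBoundaryVertex (p := fun w => n w = n u₀)
      (fun u w huw he hu => (hn u w huw he.1.1 fun h => h.2.1 he.2).symm.trans hu) hu₀ rfl hw
  have hall : ∀ v ∈ P.vertices, n v = n u₀ := by
    intro v hv
    rcases isInternalVertex_or_isBoundaryVertex hv (Finset.mem_singleton_self v) with h | h
    · obtain ⟨t, ht, hvt, h3⟩ := hP.exists_triangle hv
      set j : Piece P := SimpleGraph.connectedComponentMk _ ⟨t, ht, h3⟩
      have hvj : v ∈ internalVertices j := ⟨h, ⟨t, ht, h3⟩, rfl, hvt⟩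
      set C := pc j ⟨v, hvj⟩
      have hreach := (SimpleGraph.reachable_iff_reflTransGen _ _).1
        (C.isTree.connected ⟨C.b, Set.mem_insert _ _⟩ ⟨v, Or.inr hvj⟩)
      have key : ∀ y : (insert C.b (internalVertices j) : Set Plane),
          Relation.ReflTransGen C.T.Adj ⟨C.b, Set.mem_insert _ _⟩ y → n y = n u₀ := by
        intro y hy
        induction hy with
        | refl => exact hbd _ C.b_boundary
        | @tail y z _ hyz ih =>
          have hu : ({y.1, z.1} : Finset Plane) ∈ polygonUsedEdges pc :=
            ⟨j, ⟨v, hvj⟩, y, z, hyz, by simp⟩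
          obtain ⟨h1, -, -, h4⟩ := polygonUsedEdges_spec hu
          rw [← ih]
          exact (hn y z (fun h => hyz.ne (Subtype.ext h)) h1.1 h4).symm
      exact key _ hreach
    · exact hbd v h
  exact fun a ha b hb => (hall a ha).trans (hall b hb).symm

/-- At an internal vertex, the number of edges that separate a set of triangles from its complement
is not one. -/
theorem IsPolygon.exists_other_separating_edge (hP : IsPolygon P) {v : Plane}
    (hv : IsInternalVertex P v) (A : Triangle P → Prop) {y : Plane} {t t' : Triangle P}
    (hvy : v ≠ y) (ht : {v, y} ⊆ t.1) (ht' : {v, y} ⊆ t'.1) (hA : A t) (hA' : ¬ A t') :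
    ∃ z, z ≠ v ∧ z ≠ y ∧ ∃ r r' : Triangle P, {v, z} ⊆ r.1 ∧ {v, z} ⊆ r'.1 ∧ A r ∧ ¬ A r' := by
  by_contra hcon
  have := hP.finite_triangle
  have := Fintype.ofFinite (Triangle P)
  -- Incidences between the triangles of `A` at `v` and their other vertices are counted in two
  -- ways. Each triangle contributes two, and each nonseparating edge at `v` none or two. If only
  -- the edge to `y` separated, the total would be odd.
  set N : Finset Plane := (finite_vertices hP.1).toFinset.erase v with hN
  set star : Finset (Triangle P) := Finset.univ.filter fun t => v ∈ t.1 ∧ A t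
  have hdc := Finset.sum_card_bipartiteAbove_eq_sum_card_bipartiteBelow (s := star) (t := N)
    (fun (t : Triangle P) (z : Plane) => z ∈ t.1)
  have hleft : ∀ s ∈ star, (N.bipartiteAbove (fun (t : Triangle P) (z : Plane) => z ∈ t.1) s).card
      = 2 := by
    intro s hs
    have hs' : v ∈ s.1 ∧ A s := by simpa [star] using hs
    have e : N.bipartiteAbove (fun (t : Triangle P) (z : Plane) => z ∈ t.1) s = s.1.erase v := by
      ext z
      simp only [Finset.mem_bipartiteAbove, hN, Finset.mem_erase, Finite.mem_toFinset]
      constructor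
      · rintro ⟨⟨h1, -⟩, h2⟩
        exact ⟨h1, h2⟩
      · rintro ⟨h1, h2⟩
        exact ⟨⟨h1, singleton_mem_faces s.2.1 h2⟩, h2⟩
    rw [e, Finset.card_erase_of_mem hs'.1, s.2.2]
  have hyN : y ∈ N := by
    simp only [hN, Finset.mem_erase, Finite.mem_toFinset]
    exact ⟨hvy.symm, singleton_mem_faces t.2.1 (ht (by simp))⟩
  have hval : ∀ z, star.bipartiteBelow (fun (t : Triangle P) (z : Plane) => z ∈ t.1) z =
      Finset.univ.filter fun t => {v, z} ⊆ t.1 ∧ A t := by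
    intro z
    ext s
    simp only [Finset.mem_bipartiteBelow, star, Finset.mem_filter, Finset.mem_univ, true_and,
      Finset.insert_subset_iff, Finset.singleton_subset_iff]
    tauto
  have heven : ∀ z ∈ N, z ≠ y →
      Even (star.bipartiteBelow (fun (t : Triangle P) (z : Plane) => z ∈ t.1) z).card := by
    intro z hz hzy
    have hzv : z ≠ v := (Finset.mem_erase.1 hz).1
    rw [hval]
    rcases Finset.eq_empty_or_nonempty
      (Finset.univ.filter fun t : Triangle P => {v, z} ⊆ t.1 ∧ A t) with h0 | ⟨s, hs⟩
    · simp [h0]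
    · have hs' : {v, z} ⊆ s.1 ∧ A s := by simpa using hs
      have he : IsEdge P {v, z} := isEdge_of_subset (Finset.card_pair hzv.symm) s hs'.1
      obtain ⟨r, r', hne, hr, hr', hall⟩ :=
        hP.exists_pair_triangles he (hv.not_onBoundary (by simp))
      have hAll : ∀ q : Triangle P, {v, z} ⊆ q.1 → A q := by
        intro q hq
        by_contra hAq
        exact hcon ⟨z, hzv, hzy, s, q, hs'.1, hq, hs'.2, hAq⟩
      have e : (Finset.univ.filter fun t : Triangle P => {v, z} ⊆ t.1 ∧ A t) = {r, r'} := by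
        ext q
        simp only [Finset.mem_filter, Finset.mem_univ, true_and, Finset.mem_insert,
          Finset.mem_singleton]
        constructor
        · exact fun h => hall q h.1
        · rintro (rfl | rfl)
          · exact ⟨hr, hAll _ hr⟩
          · exact ⟨hr', hAll _ hr'⟩
      rw [e, Finset.card_pair hne]
      exact even_two
  have hodd : (star.bipartiteBelow (fun (t : Triangle P) (z : Plane) => z ∈ t.1) y).card = 1 := by
    rw [hval, Finset.card_eq_one]
    have he : IsEdge P {v, y} := isEdge_of_subset (Finset.card_pair hvy) t ht
    obtain ⟨r, r', hne, hr, hr', hall⟩ :=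
      hP.exists_pair_triangles he (hv.not_onBoundary (by simp))
    refine ⟨t, ?_⟩
    ext q
    simp only [Finset.mem_filter, Finset.mem_univ, true_and, Finset.mem_singleton]
    constructor
    · rintro ⟨hq, hAq⟩
      by_contra hqt
      rcases eq_pair_of_mem_pair (hall q hq) (hall t ht) (hall t' ht') (hall t ht) hqt
        (fun h => hA' (h ▸ hA)) with h | h
      · exact hA' (h.1 ▸ hAq)
      · exact hqt h.1
    · rintro rfl
      exact ⟨ht, hA⟩
  have htot : Even (∑ z ∈ N,
      (star.bipartiteBelow (fun (t : Triangle P) (z : Plane) => z ∈ t.1) z).card) := by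
    rw [← hdc]
    exact Finset.even_sum _ fun s hs => by rw [hleft s hs]; exact even_two
  rw [← Finset.add_sum_erase _ _ hyN, hodd] at htot
  have hrest : Even (∑ z ∈ N.erase y,
      (star.bipartiteBelow (fun (t : Triangle P) (z : Plane) => z ∈ t.1) z).card) :=
    Finset.even_sum _ fun z hz => heven z (Finset.mem_of_mem_erase hz) (Finset.ne_of_mem_erase hz)
  rw [add_comm] at htot
  exact (Nat.not_even_iff_odd.2 hrest.add_one) htot

/-- The edges that separate a component from the rest belong to the spanning trees, but by parity
they cannot stop at an internal vertex, so followed away from the root they would never end. -/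
theorem IsPolygon.connected_polygonDual (hP : IsPolygon P) :
    (dualGraph P (polygonDualEdges pc)).Connected := by
  rw [SimpleGraph.connected_iff_exists_forall_reachable]
  obtain ⟨t₀⟩ := hP.nonempty_triangle
  refine ⟨t₀, ?_⟩
  by_contra hcon
  set A : Triangle P → Prop := fun t => (dualGraph P (polygonDualEdges pc)).Reachable t₀ t
  have hused : ∀ (e : Finset Plane) (t t' : Triangle P), IsEdge P e → ¬ OnBoundary P e →
      e ⊆ t.1 → e ⊆ t'.1 → A t → ¬ A t' → e ∈ polygonUsedEdges pc := by
    intro e t t' he hb h1 h2 hA hA'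
    by_contra hu
    have hne : t ≠ t' := fun h => hA' (h ▸ hA)
    exact hA' (SimpleGraph.Reachable.trans hA
      (dualGraph_adj.2 ⟨hne, e, ⟨he, hb, Or.inl hu⟩, he, h1, h2⟩ :
        (dualGraph P (polygonDualEdges pc)).Adj t t').reachable)
  obtain ⟨t, t', e, he, hb, h1, h2, hA, hA'⟩ : ∃ (t t' : Triangle P) (e : Finset Plane),
      IsEdge P e ∧ ¬ OnBoundary P e ∧ e ⊆ t.1 ∧ e ⊆ t'.1 ∧ A t ∧ ¬ A t' := by
    by_contra hno
    refine hcon (hP.forall_triangle (p := A) (t := t₀) ?_ (SimpleGraph.Reachable.refl _))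
    intro t t' e _ he hb h1 h2 hA
    by_contra hA'
    exact hno ⟨t, t', e, he, hb, h1, h2, hA, hA'⟩
  obtain ⟨j, hj, hej⟩ := hused e t t' he hb h1 h2 hA hA'
  set C := pc j hj
  set root : (insert C.b (internalVertices j) : Set Plane) := ⟨C.b, Set.mem_insert _ _⟩
  have hfin : Finite (insert C.b (internalVertices j) : Set Plane) :=
    (((finite_vertices hP.1).subset fun v hv => hv.1.1).insert C.b).to_subtype
  set F := {x : (insert C.b (internalVertices j) : Set Plane) // ∃ y, C.T.Adj x y ∧
    C.T.dist root y < C.T.dist root x ∧ ∃ r r' : Triangle P, {x.1, y.1} ⊆ r.1 ∧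
      {x.1, y.1} ⊆ r'.1 ∧ A r ∧ ¬ A r'}
  have hFne : Nonempty F := by
    obtain ⟨x, y, hxy, hexy⟩ := hej
    have hexy' : e = {x.1, y.1} := Finset.coe_injective (by simpa using hexy)
    subst hexy'
    rcases lt_or_gt_of_ne (C.isTree.dist_ne_of_adj root hxy) with h | h
    · exact ⟨⟨y, x, hxy.symm, h, t, t', by rwa [Finset.pair_comm], by rwa [Finset.pair_comm], hA, hA'⟩⟩
    · exact ⟨⟨x, y, hxy, h, t, t', h1, h2, hA, hA'⟩⟩
  -- A separating tree edge whose far endpoint `x` has the largest distance from the root.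
  obtain ⟨⟨x, y, hxy, hd, r, r', hr, hr', hAr, hAr'⟩, hmax⟩ :=
    Finite.exists_max fun x : F => C.T.dist root x.1
  have hx : x.1 ∈ internalVertices j := by
    refine x.2.resolve_left fun h => ?_
    have : x = root := Subtype.ext h
    rw [this, SimpleGraph.dist_self] at hd
    omega
  have hxy' : x.1 ≠ y.1 := fun h => hxy.ne (Subtype.ext h)
  obtain ⟨z, hzx, hzy, s, s', hs, hs', hAs, hAs'⟩ :=
    hP.exists_other_separating_edge hx.1 A hxy' hr hr' hAr hAr'
  have he2 : IsEdge P {x.1, z} := isEdge_of_subset (Finset.card_pair hzx.symm) s hs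
  obtain ⟨j', hj', hej'⟩ := hused _ s s' he2 (hx.1.not_onBoundary (by simp)) hs hs' hAs hAs'
  have hjj : j' = j := hP.piece_unique hx.1
    (inPiece_mono (by simp) (PieceChoice.usedEdges_spec _ hej').2.1) hx.2
  subst hjj
  obtain ⟨x', z', hxz, hexz⟩ := hej'
  have hcases : ∃ zz : (insert C.b (internalVertices j') : Set Plane), zz.1 = z ∧ C.T.Adj x zz := by
    simp only [Finset.coe_insert, Finset.coe_singleton] at hexz
    rcases pair_eq_pair_iff.1 hexz with ⟨q1, q2⟩ | ⟨q1, q2⟩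
    · exact ⟨z', q2.symm, (Subtype.ext q1 : x = x') ▸ hxz⟩
    · exact ⟨x', q2.symm, (Subtype.ext q1 : x = z') ▸ hxz.symm⟩
  obtain ⟨zz, rfl, hxzz⟩ := hcases
  -- A farther `zz` contradicts the maximality of `x`; a nearer one is the parent of `x`, which is
  -- `y`.
  rcases lt_or_gt_of_ne (C.isTree.dist_ne_of_adj root hxzz) with h | h
  · have hle := hmax ⟨zz, x, hxzz.symm, h, s, s', by rwa [Finset.pair_comm],
      by rwa [Finset.pair_comm], hAs, hAs'⟩
    simp only at hle
    omega
  · exact hzy (congrArg Subtype.val (eq_of_adj_of_dist_lt C.isTree hxzz hxy h hd))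

theorem IsPolygon.isTree_polygonDual (hP : IsPolygon P) :
    (dualGraph P (polygonDualEdges pc)).IsTree :=
  ⟨hP.connected_polygonDual pc, hP.isAcyclic_polygonDual pc⟩

end Pieces

/-! ### Discrete Morse functions from potentials -/

section Morse

variable {E : Type*} [AddCommGroup E] [Module ℝ E] {K : SimplicialComplex ℝ E}

theorem isDiscreteMorse_of_negGradient {f : Cell K → ℝ} {V : Set (Cell K × Cell K)}
    (hV : IsDiscreteVectorField V) (hf : negGradient f = V) : IsDiscreteMorse f := by
  subst hf
  refine fun σ => ⟨encard_le_one_iff.2 fun τ τ' h h' => ?_, encard_le_one_iff.2 fun τ τ' h h' => ?_⟩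
  · exact congrArg Prod.snd (hV.2 σ (σ, τ) h (σ, τ') h' (Or.inl rfl) (Or.inl rfl))
  · exact congrArg Prod.fst (hV.2 σ (τ, σ) h (τ', σ) h' (Or.inr rfl) (Or.inr rfl))

theorem isCritical_iff {f : Cell K → ℝ} {V : Set (Cell K × Cell K)} (hf : negGradient f = V)
    (hV : ∀ p ∈ V, IsFacet p.1 p.2) (σ : Cell K) :
    IsCritical f σ ↔ ∀ p ∈ V, p.1 ≠ σ ∧ p.2 ≠ σ := by
  subst hf
  unfold IsCritical
  rw [encard_eq_zero, encard_eq_zero, eq_empty_iff_forall_notMem, eq_empty_iff_forall_notMem]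
  constructor
  · rintro ⟨h1, h2⟩ ⟨τ, ρ⟩ hp
    refine ⟨?_, ?_⟩
    · rintro rfl
      exact h1 ρ hp
    · rintro rfl
      exact h2 τ hp
  · intro h
    exact ⟨fun τ hτ => (h (σ, τ) hτ).1 rfl, fun τ hτ => (h (τ, σ) hτ).2 rfl⟩

/-- Passing from `τ j` to its partner `σ j` does not increase `f`, and the next facet, not being the
partner of `σ j`, has a strictly smaller value. -/
theorem not_hasClosedVPath {f : Cell K → ℝ} {V : Set (Cell K × Cell K)}
    (hV : IsDiscreteVectorField V) (hf : negGradient f = V) : ¬ HasClosedVPath V := by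
  rintro ⟨r, τ, σ, hr, hpath, hcl⟩
  have hstep : ∀ j < r, f (τ (j + 1)) < f (τ j) := by
    intro j hj
    obtain ⟨h1, -, h3, h4⟩ := hpath j hj
    have h5 : f (σ j) ≤ f (τ j) := (hf.symm ▸ h1 : (τ j, σ j) ∈ negGradient f).2
    refine lt_of_lt_of_le (lt_of_not_ge fun h6 => h4 ?_) h5
    have h7 : (τ (j + 1), σ j) ∈ V := hf ▸ ⟨h3, h6⟩
    exact congrArg Prod.fst (hV.2 (σ j) _ h1 _ h7 (Or.inr rfl) (Or.inr rfl))
  have hle : ∀ j, 1 ≤ j → j ≤ r → f (τ j) < f (τ 0) := by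
    intro j h1
    induction j, h1 using Nat.le_induction with
    | base => exact fun h => hstep 0 h
    | succ k hk ih => exact fun h => (hstep k h).trans (ih (by omega))
  have := hle r (by omega) le_rfl
  rw [← hcl] at this
  exact lt_irrefl _ this

/-- On a two-dimensional complex, a vector field with a suitable potential on the vertices and
triangles is the gradient of a function. -/
theorem exists_negGradient_eq {V : Set (Cell K × Cell K)} (hV : IsDiscreteVectorField V)
    (hdim : ∀ σ : Cell K, σ.1.card = 1 ∨ σ.1.card = 2 ∨ σ.1.card = 3) {φ : Cell K → ℝ}
    (h1 : ∀ σ : Cell K, σ.1.card = 1 → φ σ < 0) (h3 : ∀ σ : Cell K, σ.1.card = 3 → 0 < φ σ)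
    (hv : ∀ p ∈ V, p.1.1.card = 1 → ∀ w : Cell K, IsFacet w p.2 → w ≠ p.1 → φ w < φ p.1)
    (ht : ∀ p ∈ V, p.1.1.card = 2 → ∀ F : Cell K, IsFacet p.1 F → F ≠ p.2 → φ p.2 < φ F) :
    ∃ f : Cell K → ℝ, negGradient f = V := by
  have huniq2 : ∀ {p p' : Cell K × Cell K}, p ∈ V → p' ∈ V → p.2 = p'.2 → p = p' :=
    fun {p p'} hp hp' h => hV.2 p.2 p hp p' hp' (Or.inr rfl) (Or.inr h.symm)
  have huniq1 : ∀ {p p' : Cell K × Cell K}, p ∈ V → p' ∈ V → p.1 = p'.1 → p = p' :=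
    fun {p p'} hp hp' h => hV.2 p.1 p hp p' hp' (Or.inl rfl) (Or.inl h.symm)
  have hcross : ∀ {p p' : Cell K × Cell K}, p ∈ V → p' ∈ V → p.1 ≠ p'.2 := by
    intro p p' hp hp' h
    have heq := hV.2 p.1 p hp p' hp' (Or.inl rfl) (Or.inr h.symm)
    have hc := (hV.1 p hp).2
    rw [← heq] at h
    rw [← h] at hc
    omega
  -- A paired edge copies the value of its partner, an unpaired one gets `0`. Since vertices are
  -- negative and triangles positive, an edge paired with a vertex is below all triangles, and one
  -- paired with a triangle is above all vertices.
  set f : Cell K → ℝ := fun σ =>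
    if σ.1.card = 2 then
      if h : ∃ p ∈ V, p.2 = σ then φ h.choose.1
      else if h' : ∃ p ∈ V, p.1 = σ then φ h'.choose.2 else 0
    else φ σ with hf
  have fne : ∀ σ : Cell K, σ.1.card ≠ 2 → f σ = φ σ := fun σ h => if_neg h
  have fsnd : ∀ p ∈ V, p.2.1.card = 2 → f p.2 = φ p.1 := by
    intro p hp hc
    have hex : ∃ p' ∈ V, p'.2 = p.2 := ⟨p, hp, rfl⟩
    simp only [hf, if_pos hc, dif_pos hex]
    rw [huniq2 hex.choose_spec.1 hp hex.choose_spec.2]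
  have ffst : ∀ p ∈ V, p.1.1.card = 2 → f p.1 = φ p.2 := by
    intro p hp hc
    have hno : ¬ ∃ p' ∈ V, p'.2 = p.1 := fun ⟨p', hp', h⟩ => hcross hp hp' h.symm
    have hex : ∃ p' ∈ V, p'.1 = p.1 := ⟨p, hp, rfl⟩
    simp only [hf, if_pos hc, dif_neg hno, dif_pos hex]
    rw [huniq1 hex.choose_spec.1 hp hex.choose_spec.2]
  have fnone : ∀ σ : Cell K, σ.1.card = 2 → (¬ ∃ p ∈ V, p.2 = σ) → (¬ ∃ p ∈ V, p.1 = σ) →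
      f σ = 0 := by
    intro σ hc hno hno'
    simp only [hf, if_pos hc, dif_neg hno, dif_neg hno']
  refine ⟨f, ?_⟩
  ext ⟨τ, σ⟩
  constructor
  · rintro ⟨hfac, hle⟩
    simp only at hfac hle
    have hcard := hfac.2
    rcases hdim τ with hτ | hτ | hτ
    · have hσ : σ.1.card = 2 := by omega
      rw [fne τ (by omega)] at hle
      have hneg := h1 τ hτ
      by_cases hex : ∃ p ∈ V, p.2 = σ
      · obtain ⟨p, hp, rfl⟩ := hex
        rw [fsnd p hp hσ] at hle
        have hp1 : p.1.1.card = 1 := by have := (hV.1 p hp).2; omega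
        have : τ = p.1 := by
          by_contra hne
          exact absurd (hv p hp hp1 τ hfac hne) (not_lt.2 hle)
        rw [this]
        exact hp
      · by_cases hex' : ∃ p ∈ V, p.1 = σ
        · obtain ⟨p, hp, rfl⟩ := hex'
          rw [ffst p hp hσ] at hle
          have := h3 p.2 (by have := (hV.1 p hp).2; omega)
          linarith
        · rw [fnone σ hσ hex hex'] at hle
          linarith
    · have hσ : σ.1.card = 3 := by omega
      rw [fne σ (by omega)] at hle
      have hpos := h3 σ hσ
      by_cases hex : ∃ p ∈ V, p.2 = τ
      · obtain ⟨p, hp, rfl⟩ := hex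
        rw [fsnd p hp hτ] at hle
        have := h1 p.1 (by have := (hV.1 p hp).2; omega)
        linarith
      · by_cases hex' : ∃ p ∈ V, p.1 = τ
        · obtain ⟨p, hp, rfl⟩ := hex'
          rw [ffst p hp hτ] at hle
          have : σ = p.2 := by
            by_contra hne
            exact absurd (ht p hp hτ σ hfac hne) (not_lt.2 hle)
          rw [this]
          exact hp
        · rw [fnone τ hτ hex hex'] at hle
          linarith
    · rcases hdim σ with h | h | h <;> omega
  · intro hp
    have hfac := hV.1 _ hp
    refine ⟨hfac, ?_⟩
    have hcard := hfac.2
    simp only at hcard ⊢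
    rcases hdim τ with hτ | hτ | hτ
    · rw [fne τ (by omega), fsnd (τ, σ) hp (by simp only; omega)]
    · rw [fne σ (by omega), ffst (τ, σ) hp hτ]
    · rcases hdim σ with h | h | h <;> omega

end Morse

/-! ### The presentation of the complex by polygons -/

section Push

variable {E : Type*}

theorem mem_push {q : Plane → E} {s : Finset Plane} {x : E} :
    x ∈ push q s ↔ ∃ v ∈ s, q v = x := Finset.mem_image

theorem push_singleton (q : Plane → E) (v : Plane) : push q {v} = {q v} := Finset.image_singleton q v

theorem push_mono (q : Plane → E) {s t : Finset Plane} (hst : s ⊆ t) : push q s ⊆ push q t :=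
  Finset.image_subset_image hst

theorem coe_push_pair (q : Plane → E) {s : Finset Plane} {a b : Plane}
    (hs : (s : Set Plane) = {a, b}) : (push q s : Set E) = {q a, q b} := by
  rw [push, Finset.coe_image, hs, image_pair]

end Push

section Presentation

variable {E : Type*} [NormedAddCommGroup E] [NormedSpace ℝ E]
  {X : Type*} [TopologicalSpace X] {X₁ : Set X} {K : SimplicialComplex ℝ E} {h : K.space ≃ₜ X}

namespace PolygonPresentation

variable (D : PolygonPresentation X₁ K h)

theorem card_push {i : Surface X₁} {s : Finset Plane} (hs : s ∈ (D.P i).faces) :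
    (push (D.q i) s).card = s.card :=
  Finset.card_image_of_injOn (D.map_injOn i s hs)

theorem push_mem_singleton {i : Surface X₁} {v : Plane} (hv : {v} ∈ (D.P i).faces) :
    ({D.q i v} : Finset E) ∈ K.faces := by
  rw [← push_singleton]
  exact D.map_mem i _ hv

theorem exists_rep (σ : Cell K) : ∃ i s, s ∈ (D.P i).faces ∧ σ.1 = push (D.q i) s := by
  obtain ⟨i, s, hs, h⟩ := D.map_surj σ.1 σ.2
  exact ⟨i, s, hs, h.symm⟩

theorem card_cell (D : PolygonPresentation X₁ K h) (σ : Cell K) : σ.1.card = 1 ∨ σ.1.card = 2 ∨ σ.1.card = 3 := by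
  obtain ⟨i, s, hs, hσ⟩ := D.exists_rep σ
  rw [hσ, D.card_push hs]
  have h1 := card_le_three hs
  have h2 := Finset.card_pos.2 (SimplicialComplex.nonempty_of_mem_faces hs)
  omega

/-- No triangle is identified with another, so one triangle from each polygon embeds the set of
surfaces into the cells of `K`. -/
theorem finite_surface (D : PolygonPresentation X₁ K h) (hK : K.faces.Finite) : Finite (Surface X₁) := by
  have hne := fun i => (D.isPolygon i).nonempty_triangle
  have hKf : Finite K.faces := hK
  refine Finite.of_injective
    (fun i => (⟨push (D.q i) (hne i).some.1, D.map_mem i _ (hne i).some.2.1⟩ : K.faces)) ?_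
  intro i j hij
  exact (D.map_glue i j _ (hne i).some.2.1 _ (hne j).some.2.1 (Subtype.ext_iff.1 hij)
    (not_onBoundary_of_card_eq_three (hne i).some.2.1 (hne i).some.2.2)).1

theorem boundaryGraph_adj {x y : D.boundaryVertices} : D.boundaryGraph.Adj x y ↔ x ≠ y ∧
    ∃ i e, IsBoundaryEdge (D.P i) e ∧ (push (D.q i) e : Set E) = {x.1, y.1} := by
  unfold boundaryGraph
  rw [SimpleGraph.fromRel_adj]
  constructor
  · rintro ⟨hne, h | ⟨i, e, h1, h2⟩⟩
    · exact ⟨hne, h⟩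
    · exact ⟨hne, i, e, h1, h2.trans (pair_comm _ _)⟩
  · rintro ⟨hne, h⟩
    exact ⟨hne, Or.inl h⟩

theorem reachable_of_same_polygon (r : D.boundaryVertices) {i : Surface X₁} {u w : Plane}
    (hu : IsBoundaryVertex (D.P i) u) (hw : IsBoundaryVertex (D.P i) w)
    (hr : D.boundaryGraph.Reachable r ⟨D.q i u, i, u, hu, rfl⟩) :
    D.boundaryGraph.Reachable r ⟨D.q i w, i, w, hw, rfl⟩ := by
  obtain ⟨h1, h2⟩ := (D.isPolygon i).forall_isBoundaryVertex
    (p := fun v => ∃ h : D.q i v ∈ D.boundaryVertices, D.boundaryGraph.Reachable r ⟨D.q i v, h⟩)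
    (by
      rintro u w huw he ⟨hu', hr'⟩
      have hwb : IsBoundaryVertex (D.P i) w := he.2.isBoundaryVertex he.1.1 (by simp)
      refine ⟨⟨i, w, hwb, rfl⟩, hr'.trans ?_⟩
      have hq : D.q i u ≠ D.q i w := fun hq =>
        huw (D.map_injOn i _ he.1.1 (by simp) (by simp) hq)
      refine (D.boundaryGraph_adj.2 ⟨fun h => hq (congrArg Subtype.val h), i, {u, w}, he, ?_⟩ :
        D.boundaryGraph.Adj _ _).reachable
      exact coe_push_pair _ (by simp)) hu ⟨_, hr⟩ hw
  exact h2

/-- The images of the polygons form a finite closed cover of the connected space of `K`. Two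
different ones that meet share a vertex, and since it is identified it is a boundary vertex of both.
-/
theorem connected_boundaryGraph (hX : IsTwoStratifold X X₁) (hK : K.faces.Finite) :
    D.boundaryGraph.Connected := by
  have := D.finite_surface hK
  have hconn := hX.connected
  have hKconn : ConnectedSpace K.space := h.symm.surjective.connectedSpace h.symm.continuous
  have hKpre : IsPreconnected K.space := isPreconnected_iff_preconnectedSpace.2 inferInstance
  obtain ⟨x₀⟩ := hKconn.toNonempty
  obtain ⟨σ, hσ, -⟩ := SimplicialComplex.mem_space_iff.1 x₀.2
  obtain ⟨i₀, -⟩ := D.map_surj σ hσ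
  obtain ⟨u₀, hu₀⟩ := (D.isPolygon i₀).exists_isBoundaryVertex
  rw [SimpleGraph.connected_iff_exists_forall_reachable]
  refine ⟨⟨D.q i₀ u₀, i₀, u₀, hu₀, rfl⟩, ?_⟩
  set r : D.boundaryVertices := ⟨D.q i₀ u₀, i₀, u₀, hu₀, rfl⟩
  have hall := fun j => hKpre.forall_of_closed_cover
    (C := fun i => ⋃ s ∈ (D.P i).faces, convexHull ℝ (push (D.q i) s : Set E))
    (p := fun i => ∀ w (hw : IsBoundaryVertex (D.P i) w),
      D.boundaryGraph.Reachable r ⟨D.q i w, i, w, hw, rfl⟩)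
    (fun i => (D.isPolygon i).1.isClosed_biUnion fun s _ =>
      (push (D.q i) s).finite_toSet.isClosed_convexHull ℝ)
    (by
      intro x hx
      obtain ⟨σ, hσ, hxσ⟩ := SimplicialComplex.mem_space_iff.1 hx
      obtain ⟨i, s, hs, rfl⟩ := D.map_surj σ hσ
      exact mem_iUnion.2 ⟨i, mem_biUnion hs hxσ⟩)
    (by
      intro i
      obtain ⟨v, hv⟩ := (D.isPolygon i).exists_isBoundaryVertex
      refine ⟨D.q i v, SimplicialComplex.vertices_subset_space (D.push_mem_singleton hv.1),
        mem_biUnion hv.1 ?_⟩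
      rw [push_singleton]
      simp)
    (by
      rintro i j ⟨x, -, hxi, hxj⟩ hi w hw
      by_cases hij : i = j
      · subst hij
        exact hi w hw
      obtain ⟨s, hs, hxs⟩ := mem_iUnion₂.1 hxi
      obtain ⟨t, ht, hxt⟩ := mem_iUnion₂.1 hxj
      have hx' := K.inter_subset_convexHull (D.map_mem i s hs) (D.map_mem j t ht) ⟨hxs, hxt⟩
      obtain ⟨y, hy1, hy2⟩ := convexHull_nonempty_iff.1 ⟨x, hx'⟩
      obtain ⟨a, ha, hay⟩ := mem_push.1 hy1
      obtain ⟨b, hb, hby⟩ := mem_push.1 hy2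
      have ha' := singleton_mem_faces hs ha
      have hb' := singleton_mem_faces ht hb
      have hpush : push (D.q i) {a} = push (D.q j) {b} := by
        rw [push_singleton, push_singleton, hay, hby]
      have haB : IsBoundaryVertex (D.P i) a := ⟨ha', by
        by_contra hn
        exact hij (D.map_glue i j _ ha' _ hb' hpush hn).1⟩
      have hbB : IsBoundaryVertex (D.P j) b := ⟨hb', by
        by_contra hn
        exact hij (D.map_glue j i _ hb' _ ha' hpush.symm hn).1.symm⟩
      refine D.reachable_of_same_polygon r hbB hw ?_
      have h1 := hi a haB
      have h2 : (⟨D.q i a, i, a, haB, rfl⟩ : D.boundaryVertices) = ⟨D.q j b, j, b, hbB, rfl⟩ :=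
        Subtype.ext (hay.trans hby.symm)
      rwa [h2] at h1)
    (i := i₀) (fun w hw => D.reachable_of_same_polygon r hu₀ hw (SimpleGraph.Reachable.refl _)) j
  rintro ⟨x, i, v, hv, rfl⟩
  exact hall i v hv

theorem nonempty_run (hX : IsTwoStratifold X X₁) (hK : K.faces.Finite) : Nonempty (Run D) := by
  have hconn := D.connected_boundaryGraph hX hK
  obtain ⟨T, hT, htree⟩ := hconn.exists_isTree_le
  exact ⟨⟨fun i j hj => ((D.isPolygon i).nonempty_pieceChoice hj).some,
    fun i => (D.isPolygon i).nonempty_triangle.some, T, hT, htree, hconn.nonempty.some⟩⟩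

end PolygonPresentation

end Presentation

/-! ### The vector field -/

section VectorField

variable {E : Type*} [NormedAddCommGroup E] [NormedSpace ℝ E]
  {X : Type*} [TopologicalSpace X] {X₁ : Set X} {K : SimplicialComplex ℝ E} {h : K.space ≃ₜ X}

/-- A simplex of `K` is a boundary simplex if it is the image of a boundary simplex of a polygon. -/
def PolygonPresentation.IsBoundaryCell (D : PolygonPresentation X₁ K h) (σ : Finset E) : Prop :=
  ∃ i, ∃ s ∈ (D.P i).faces, OnBoundary (D.P i) s ∧ push (D.q i) s = σ

/-- Gluing never involves a simplex off the boundary. This keeps the cells in `boundaryPairs` apart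
from those in all other pairs. -/
theorem PolygonPresentation.not_isBoundaryCell (D : PolygonPresentation X₁ K h) {i : Surface X₁}
    {s : Finset Plane} (hs : s ∈ (D.P i).faces) (hb : ¬ OnBoundary (D.P i) s) :
    ¬ D.IsBoundaryCell (push (D.q i) s) := by
  rintro ⟨j, t, ht, htb, hst⟩
  obtain ⟨rfl, rfl⟩ := D.map_glue i j s hs t ht hst.symm hb
  exact hb htb

theorem PolygonPresentation.isBoundaryCell_singleton (D : PolygonPresentation X₁ K h)
    (x : D.boundaryVertices) : D.IsBoundaryCell {x.1} := by
  obtain ⟨x, i, v, hv, rfl⟩ := x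
  exact ⟨i, {v}, hv.1, hv.2, push_singleton _ _⟩

theorem isDiscreteVectorField_of {V : Set (Cell K × Cell K)} (h0 : ∀ p ∈ V, IsFacet p.1 p.2)
    (h1 : ∀ p ∈ V, ∀ p' ∈ V, p.1 = p'.1 → p = p') (h2 : ∀ p ∈ V, ∀ p' ∈ V, p.2 = p'.2 → p = p')
    (h3 : ∀ p ∈ V, ∀ p' ∈ V, p.1 ≠ p'.2) : IsDiscreteVectorField V := by
  refine ⟨h0, ?_⟩
  rintro σ p hp p' hp' (rfl | rfl) (h | h)
  · exact h1 p hp p' hp' h.symm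
  · exact absurd h.symm (h3 p hp p' hp')
  · exact absurd h (h3 p' hp' p hp)
  · exact h2 p hp p' hp' h.symm

namespace Run

variable {D : PolygonPresentation X₁ K h} {R : Run D} {p p' : Cell K × Cell K}

theorem mem_V : p ∈ R.V ↔
    p ∈ R.boundaryPairs ∨ (∃ i, p ∈ R.facePairs i) ∨ ∃ i j, p ∈ R.vertexPairs i j := by
  simp only [V, mem_union, mem_iUnion, or_assoc]

/-- `R.dualEdges i` is by definition `polygonDualEdges (R.piece i)`. -/
theorem isTree_dualTree (R : Run D) (i : Surface X₁) : (R.dualTree i).IsTree :=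
  (D.isPolygon i).isTree_polygonDual (R.piece i)

theorem bdTree_edge {a b : D.boundaryVertices} (hab : R.bdTree.Adj a b) :
    ∃ e ∈ K.faces, (e : Set E) = {a.1, b.1} ∧ D.IsBoundaryCell e := by
  obtain ⟨-, i, e, he, hpe⟩ := D.boundaryGraph_adj.1 (R.bdTree_le hab)
  exact ⟨_, D.map_mem i e he.1.1, hpe, i, e, he.1.1, he.2, rfl⟩

theorem pair_card {α : Type*} {s : Finset α} {a b : α} (hab : a ≠ b) (hs : (s : Set α) = {a, b}) :
    s.card = 2 := by
  rw [← Set.ncard_coe_finset, hs, Set.ncard_pair hab]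

theorem boundaryPairs_spec (hp : p ∈ R.boundaryPairs) :
    IsFacet p.1 p.2 ∧ p.1.1.card = 1 ∧ D.IsBoundaryCell p.1.1 ∧ D.IsBoundaryCell p.2.1 := by
  obtain ⟨a, b, hab, -, h1, h2⟩ := hp
  simp only at h1 h2
  obtain ⟨e, -, he, heb⟩ := bdTree_edge hab
  have h1' : p.1.1 = {a.1} := by exact_mod_cast h1
  have hc : p.1.1.card = 1 := by rw [h1', Finset.card_singleton]
  refine ⟨⟨?_, ?_⟩, hc, h1' ▸ D.isBoundaryCell_singleton a, ?_⟩
  · rw [← Finset.coe_subset, h1, h2]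
    simp
  · rw [hc, pair_card (fun h => hab.ne (Subtype.ext h)) h2]
  · rwa [Finset.coe_injective (h2.trans he.symm)]

theorem facePairs_spec {i : Surface X₁} (hp : p ∈ R.facePairs i) :
    IsFacet p.1 p.2 ∧ p.1.1.card = 2 ∧ ¬ D.IsBoundaryCell p.1.1 ∧ ¬ D.IsBoundaryCell p.2.1 := by
  obtain ⟨F, F', e, he, -, heF, -, -, h1, h2⟩ := hp
  have hc : p.1.1.card = 2 := by rw [h1, D.card_push he.1.1, he.1.2]
  refine ⟨⟨?_, ?_⟩, hc, ?_, ?_⟩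
  · rw [h1, h2]
    exact push_mono _ heF
  · rw [hc, h2, D.card_push F.2.1, F.2.2]
  · rw [h1]
    exact D.not_isBoundaryCell he.1.1 he.2.1
  · rw [h2]
    exact D.not_isBoundaryCell F.2.1 (not_onBoundary_of_card_eq_three F.2.1 F.2.2)

theorem vertexPairs_spec {i : Surface X₁} {j : Piece (D.P i)} (hp : p ∈ R.vertexPairs i j) :
    IsFacet p.1 p.2 ∧ p.1.1.card = 1 ∧ ¬ D.IsBoundaryCell p.1.1 ∧ ¬ D.IsBoundaryCell p.2.1 := by
  obtain ⟨hj, p', hp', h1, h2⟩ := hp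
  obtain ⟨he, a, ha, ha', hae⟩ := PieceChoice.pairs_spec _ hp'
  have hu := PieceChoice.usedEdges_spec _ he
  have hc : p.1.1.card = 1 := by rw [h1, ha', push_singleton, Finset.card_singleton]
  refine ⟨⟨?_, ?_⟩, hc, ?_, ?_⟩
  · rw [h1, h2]
    exact push_mono _ (by rw [ha']; exact Finset.singleton_subset_iff.2 hae)
  · rw [hc, h2, D.card_push hu.1.1, hu.1.2]
  · rw [h1, ha']
    exact D.not_isBoundaryCell ha.1.1 ha.1.2
  · rw [h2]
    exact D.not_isBoundaryCell hu.1.1 (ha.1.not_onBoundary hae)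

theorem isFacet_of_mem_V (hp : p ∈ R.V) : IsFacet p.1 p.2 := by
  rcases mem_V.1 hp with h | ⟨i, h⟩ | ⟨i, j, h⟩
  exacts [(boundaryPairs_spec h).1, (facePairs_spec h).1, (vertexPairs_spec h).1]

theorem eq_of_fst_eq_boundary (hp : p ∈ R.boundaryPairs) (hp' : p' ∈ R.boundaryPairs)
    (h : p.1 = p'.1) : p = p' := by
  have := rootedPairs_eq_of_fst_eq R.bdTree_isTree hp hp' (congrArg Subtype.val h)
  exact Prod.ext h (Subtype.ext (congrArg Prod.snd this))

theorem eq_of_snd_eq_boundary (hp : p ∈ R.boundaryPairs) (hp' : p' ∈ R.boundaryPairs)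
    (h : p.2 = p'.2) : p = p' := by
  have := rootedPairs_eq_of_snd_eq hp hp' (congrArg Subtype.val h)
  exact Prod.ext (Subtype.ext (congrArg Prod.fst this)) h

/-- An edge off the boundary lies in exactly two triangles, and the distances decide which of them
is paired. -/
theorem eq_of_fst_eq_face {i i' : Surface X₁} (hp : p ∈ R.facePairs i) (hp' : p' ∈ R.facePairs i')
    (h : p.1 = p'.1) : p = p' := by
  obtain ⟨F, F', e, he, hne, heF, heF', hd, h1, h2⟩ := hp
  obtain ⟨G, G', e', he', hne', heG, heG', hd', h1', h2'⟩ := hp'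
  obtain ⟨rfl, rfl⟩ := D.map_glue i i' e he.1.1 e' he'.1.1 (by rw [← h1, ← h1', h]) he.2.1
  have hFG : F = G := by
    obtain ⟨t, t', -, -, -, ht⟩ := (D.isPolygon i).exists_pair_triangles he.1 he.2.1
    rcases ht F heF with rfl | rfl <;> rcases ht F' heF' with rfl | rfl <;>
      rcases ht G heG with rfl | rfl <;> rcases ht G' heG' with rfl | rfl <;>
      first | rfl | exact absurd rfl hne | exact absurd rfl hne' | exact absurd hd hd'.not_gt
  exact Prod.ext h (Subtype.ext (by rw [h2, h2', hFG]))

/-- The paired edge is the intersection of the triangle with its parent in the dual tree, and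
parents are unique. -/
theorem eq_of_snd_eq_face {i i' : Surface X₁} (hp : p ∈ R.facePairs i) (hp' : p' ∈ R.facePairs i')
    (h : p.2 = p'.2) : p = p' := by
  obtain ⟨F, F', e, he, hne, heF, heF', hd, h1, h2⟩ := hp
  obtain ⟨G, G', e', he', hne', heG, heG', hd', h1', h2'⟩ := hp'
  obtain ⟨rfl, hFG⟩ := D.map_glue i i' F.1 F.2.1 G.1 G.2.1 (by rw [← h2, ← h2', h])
    (not_onBoundary_of_card_eq_three F.2.1 F.2.2)
  obtain rfl := Subtype.ext hFG
  obtain rfl : F' = G' := eq_of_adj_of_dist_lt (R.isTree_dualTree i)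
    (dualGraph_adj.2 ⟨hne, e, he, he.1, heF, heF'⟩)
    (dualGraph_adj.2 ⟨hne', e', he', he'.1, heG, heG'⟩) hd hd'
  refine Prod.ext (Subtype.ext ?_) h
  rw [h1, h1', eq_inter_of_subset he.1.2 hne heF heF', eq_inter_of_subset he'.1.2 hne heG heG']

theorem eq_of_fst_eq_vertex {i i' : Surface X₁} {j : Piece (D.P i)} {j' : Piece (D.P i')}
    (hp : p ∈ R.vertexPairs i j) (hp' : p' ∈ R.vertexPairs i' j') (h : p.1 = p'.1) : p = p' := by
  obtain ⟨hj, r, hr, h1, h2⟩ := hp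
  obtain ⟨hj', r', hr', h1', h2'⟩ := hp'
  obtain ⟨-, a, ha, ha', -⟩ := PieceChoice.pairs_spec _ hr
  obtain ⟨-, b, hb, hb', -⟩ := PieceChoice.pairs_spec _ hr'
  obtain ⟨rfl, hab⟩ := D.map_glue i i' {a} ha.1.1 {b} hb.1.1
    (by rw [← ha', ← hb', ← h1, ← h1', h]) ha.1.2
  obtain rfl := Finset.singleton_injective hab
  obtain rfl := (D.isPolygon i).piece_unique ha.1 ha.2 hb.2
  have := rootedPairs_eq_of_fst_eq (R.piece i j hj).isTree hr hr' (ha'.trans hb'.symm)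
  exact Prod.ext h (Subtype.ext (by rw [h2, h2', this]))

theorem eq_of_snd_eq_vertex {i i' : Surface X₁} {j : Piece (D.P i)} {j' : Piece (D.P i')}
    (hp : p ∈ R.vertexPairs i j) (hp' : p' ∈ R.vertexPairs i' j') (h : p.2 = p'.2) : p = p' := by
  obtain ⟨hj, r, hr, h1, h2⟩ := hp
  obtain ⟨hj', r', hr', h1', h2'⟩ := hp'
  obtain ⟨hu, a, ha, ha', hae⟩ := PieceChoice.pairs_spec _ hr
  obtain ⟨hu', -⟩ := PieceChoice.pairs_spec _ hr'
  have hs := PieceChoice.usedEdges_spec _ hu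
  have hs' := PieceChoice.usedEdges_spec _ hu'
  obtain ⟨rfl, hee⟩ := D.map_glue i i' r.2 hs.1.1 r'.2 hs'.1.1
    (by rw [← h2, ← h2', h]) (ha.1.not_onBoundary hae)
  obtain rfl := (D.isPolygon i).piece_unique ha.1 ha.2
    (inPiece_mono (Finset.singleton_subset_iff.2 (hee ▸ hae)) hs'.2.1)
  have := rootedPairs_eq_of_snd_eq hr hr' hee
  exact Prod.ext (Subtype.ext (by rw [h1, h1', this])) h

/-- Pairs of different kinds differ in dimension or in lying on the boundary. The one remaining
conflict, an edge paired with both a triangle and an internal vertex, is impossible because dual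
edges are not used in the trees. -/
theorem isDiscreteVectorField_V (R : Run D) : IsDiscreteVectorField R.V := by
  refine isDiscreteVectorField_of (fun p => isFacet_of_mem_V) ?_ ?_ ?_
  · intro p hp p' hp' heq
    rcases mem_V.1 hp with h | ⟨i, h⟩ | ⟨i, j, h⟩ <;>
      rcases mem_V.1 hp' with h' | ⟨i', h'⟩ | ⟨i', j', h'⟩
    · exact eq_of_fst_eq_boundary h h' heq
    · exact absurd (heq ▸ (boundaryPairs_spec h).2.2.1) (facePairs_spec h').2.2.1
    · exact absurd (heq ▸ (boundaryPairs_spec h).2.2.1) (vertexPairs_spec h').2.2.1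
    · exact absurd (heq ▸ (boundaryPairs_spec h').2.2.1) (facePairs_spec h).2.2.1
    · exact eq_of_fst_eq_face h h' heq
    · have := (facePairs_spec h).2.1
      rw [heq, (vertexPairs_spec h').2.1] at this
      omega
    · exact absurd (heq ▸ (boundaryPairs_spec h').2.2.1) (vertexPairs_spec h).2.2.1
    · have := (vertexPairs_spec h).2.1
      rw [heq, (facePairs_spec h').2.1] at this
      omega
    · exact eq_of_fst_eq_vertex h h' heq
  · intro p hp p' hp' heq
    have hc := (isFacet_of_mem_V hp).2
    rw [heq, (isFacet_of_mem_V hp').2] at hc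
    rcases mem_V.1 hp with h | ⟨i, h⟩ | ⟨i, j, h⟩ <;>
      rcases mem_V.1 hp' with h' | ⟨i', h'⟩ | ⟨i', j', h'⟩
    · exact eq_of_snd_eq_boundary h h' heq
    · exact absurd (heq ▸ (boundaryPairs_spec h).2.2.2) (facePairs_spec h').2.2.2
    · exact absurd (heq ▸ (boundaryPairs_spec h).2.2.2) (vertexPairs_spec h').2.2.2
    · exact absurd (heq ▸ (boundaryPairs_spec h').2.2.2) (facePairs_spec h).2.2.2
    · exact eq_of_snd_eq_face h h' heq
    · rw [(facePairs_spec h).2.1, (vertexPairs_spec h').2.1] at hc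
      omega
    · exact absurd (heq ▸ (boundaryPairs_spec h').2.2.2) (vertexPairs_spec h).2.2.2
    · rw [(vertexPairs_spec h).2.1, (facePairs_spec h').2.1] at hc
      omega
    · exact eq_of_snd_eq_vertex h h' heq
  · intro p hp p' hp' heq
    have hc := (isFacet_of_mem_V hp').2
    rw [← heq] at hc
    rcases mem_V.1 hp with h | ⟨i, h⟩ | ⟨i, j, h⟩
    · have h1 := (boundaryPairs_spec h).2.1
      have h2 := Finset.card_pos.2 (K.nonempty_of_mem_faces p'.1.2)
      omega
    · rcases mem_V.1 hp' with h' | ⟨i', h'⟩ | ⟨i', j', h'⟩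
      · exact absurd (heq ▸ (boundaryPairs_spec h').2.2.2) (facePairs_spec h).2.2.1
      · have h1 := (facePairs_spec h).2.1
        have h2 := (facePairs_spec h').2.1
        omega
      · obtain ⟨F, F', e, he, -, -, -, -, h1, -⟩ := h
        obtain ⟨hj, r, hr, -, h2⟩ := h'
        obtain ⟨hu, -⟩ := PieceChoice.pairs_spec _ hr
        have hs := PieceChoice.usedEdges_spec _ hu
        obtain ⟨rfl, rfl⟩ := D.map_glue i i' e he.1.1 r.2 hs.1.1 (by rw [← h1, ← h2, heq]) he.2.1
        exact (polygonUsedEdges_spec (pc := R.piece i) ⟨j', hj, hu⟩).2.2.2 he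
    · have h1 := (vertexPairs_spec h).2.1
      have h2 := Finset.card_pos.2 (K.nonempty_of_mem_faces p'.1.2)
      omega

end Run

end VectorField

/-! ### The potential and the critical cells -/

/-- A positive strictly decreasing function of a distance. -/
noncomputable def decay (n : ℕ) : ℝ := 1 / (n + 1 : ℝ)

theorem decay_pos (n : ℕ) : 0 < decay n := Nat.one_div_pos_of_nat

theorem decay_le_one (n : ℕ) : decay n ≤ 1 := by
  unfold decay
  rw [div_le_one (by positivity)]
  have : (0 : ℝ) ≤ n := n.cast_nonneg
  linarith

theorem decay_lt_decay {m n : ℕ} (hmn : m < n) : decay n < decay m :=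
  Nat.one_div_lt_one_div hmn

section Potential

variable {E : Type*} [NormedAddCommGroup E] [NormedSpace ℝ E]
  {X : Type*} [TopologicalSpace X] {X₁ : Set X} {K : SimplicialComplex ℝ E} {h : K.space ≃ₜ X}

namespace Run

variable {D : PolygonPresentation X₁ K h} (R : Run D)

/-- The value of the potential at a cell, for the 2-cells. -/
def FaceHeight (σ : Cell K) (y : ℝ) : Prop :=
  ∃ i, ∃ F : Triangle (D.P i), σ.1 = push (D.q i) F.1 ∧
    y = decay ((R.dualTree i).dist (R.rootFace i) F)

/-- The value of the potential at a cell, for the boundary vertices. -/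
def BoundaryHeight (σ : Cell K) (y : ℝ) : Prop :=
  ∃ x : D.boundaryVertices, σ.1 = {x.1} ∧ y = -1 - decay (R.bdTree.dist R.bdRoot x)

/-- The value of the potential at a cell, for the internal vertices. -/
def InternalHeight (σ : Cell K) (y : ℝ) : Prop :=
  ∃ i j hj, ∃ a, ∃ ha : a ∈ internalVertices j, σ.1 = push (D.q i) {a} ∧
    y = -decay ((R.piece i j hj).T.dist ⟨_, mem_insert _ _⟩ ⟨a, mem_insert_of_mem _ ha⟩)

/-- The value of the potential at a cell. -/
def Height (σ : Cell K) (y : ℝ) : Prop :=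
  R.FaceHeight σ y ∨ R.BoundaryHeight σ y ∨ R.InternalHeight σ y

/-- The potential, which decreases along the paths of the vector field. -/
noncomputable def potential (σ : Cell K) : ℝ :=
  -- Edges have no height; their default value `0` plays no role.
  if h : ∃ y, R.Height σ y then h.choose else 0

variable {R} {σ : Cell K} {y y' : ℝ}

theorem FaceHeight.card (hy : R.FaceHeight σ y) : σ.1.card = 3 := by
  obtain ⟨i, F, hF, -⟩ := hy
  rw [hF, D.card_push F.2.1, F.2.2]

theorem FaceHeight.pos (hy : R.FaceHeight σ y) : 0 < y := by
  obtain ⟨i, F, -, rfl⟩ := hy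
  exact decay_pos _

theorem BoundaryHeight.card (hy : R.BoundaryHeight σ y) : σ.1.card = 1 := by
  obtain ⟨x, hx, -⟩ := hy
  rw [hx, Finset.card_singleton]

theorem BoundaryHeight.isBoundaryCell (hy : R.BoundaryHeight σ y) : D.IsBoundaryCell σ.1 := by
  obtain ⟨x, hx, -⟩ := hy
  exact hx ▸ D.isBoundaryCell_singleton x

/-- Together with `InternalHeight.ge` this puts boundary vertices below internal ones, as needed
where the tree of a piece ends at `b`. Such bands are possible because `decay` is bounded, unlike
the distance. -/
theorem BoundaryHeight.lt (hy : R.BoundaryHeight σ y) : y < -1 := by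
  obtain ⟨x, -, rfl⟩ := hy
  linarith [decay_pos (R.bdTree.dist R.bdRoot x)]

theorem InternalHeight.card (hy : R.InternalHeight σ y) : σ.1.card = 1 := by
  obtain ⟨i, j, hj, a, ha, h1, -⟩ := hy
  rw [h1, push_singleton, Finset.card_singleton]

theorem InternalHeight.not_isBoundaryCell (hy : R.InternalHeight σ y) :
    ¬ D.IsBoundaryCell σ.1 := by
  obtain ⟨i, j, hj, a, ha, h1, -⟩ := hy
  exact h1 ▸ D.not_isBoundaryCell ha.1.1 ha.1.2

theorem InternalHeight.neg (hy : R.InternalHeight σ y) : y < 0 := by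
  obtain ⟨i, j, hj, a, ha, -, rfl⟩ := hy
  exact neg_neg_of_pos (decay_pos _)

theorem InternalHeight.ge (hy : R.InternalHeight σ y) : -1 ≤ y := by
  obtain ⟨i, j, hj, a, ha, -, rfl⟩ := hy
  exact neg_le_neg (decay_le_one _)

/-- A cell off the boundary comes from a single simplex of a single polygon, and an internal vertex
from a single piece, so the value does not depend on the representative. -/
theorem Height.unique (hy : R.Height σ y) (hy' : R.Height σ y') : y = y' := by
  rcases hy with hy | hy | hy <;> rcases hy' with hy' | hy' | hy'
  · obtain ⟨i, F, h1, rfl⟩ := hy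
    obtain ⟨i', F', h1', rfl⟩ := hy'
    obtain ⟨rfl, hF⟩ := D.map_glue i i' F.1 F.2.1 F'.1 F'.2.1 (h1 ▸ h1')
      (not_onBoundary_of_card_eq_three F.2.1 F.2.2)
    rw [Subtype.ext hF]
  · exact absurd (hy.card.symm.trans hy'.card) (by decide)
  · exact absurd (hy.card.symm.trans hy'.card) (by decide)
  · exact absurd (hy.card.symm.trans hy'.card) (by decide)
  · obtain ⟨x, h1, rfl⟩ := hy
    obtain ⟨x', h1', rfl⟩ := hy'
    rw [Subtype.ext (Finset.singleton_injective (h1.symm.trans h1'))]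
  · exact absurd hy.isBoundaryCell hy'.not_isBoundaryCell
  · exact absurd (hy.card.symm.trans hy'.card) (by decide)
  · exact absurd hy'.isBoundaryCell hy.not_isBoundaryCell
  · obtain ⟨i, j, hj, a, ha, h1, rfl⟩ := hy
    obtain ⟨i', j', hj', a', ha', h1', rfl⟩ := hy'
    obtain ⟨rfl, haa⟩ := D.map_glue i i' {a} ha.1.1 {a'} ha'.1.1 (h1 ▸ h1') ha.1.2
    obtain rfl := Finset.singleton_injective haa
    obtain rfl := (D.isPolygon i).piece_unique ha.1 ha.2 ha'.2
    rfl

theorem Height.potential_eq (hy : R.Height σ y) : R.potential σ = y := by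
  have hex : ∃ y, R.Height σ y := ⟨y, hy⟩
  rw [potential, dif_pos hex]
  exact hex.choose_spec.unique hy

theorem exists_piece {P : SimplicialComplex ℝ Plane} (hP : IsPolygon P) {a : Plane}
    (ha : IsInternalVertex P a) : ∃ j : Piece P, a ∈ internalVertices j := by
  obtain ⟨t, ht, hat, h3⟩ := hP.exists_triangle ha.1
  exact ⟨SimpleGraph.connectedComponentMk _ ⟨t, ht, h3⟩, ha, ⟨t, ht, h3⟩, rfl, hat⟩

variable (R) in
theorem exists_vertexHeight (hσ : σ.1.card = 1) :
    ∃ y, R.BoundaryHeight σ y ∨ R.InternalHeight σ y := by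
  obtain ⟨i, s, hs, h1⟩ := D.exists_rep σ
  rw [h1, D.card_push hs] at hσ
  obtain ⟨a, rfl⟩ := Finset.card_eq_one.1 hσ
  rcases isInternalVertex_or_isBoundaryVertex hs (Finset.mem_singleton_self a) with h | h
  · obtain ⟨j, hj⟩ := exists_piece (D.isPolygon i) h
    exact ⟨_, Or.inr ⟨i, j, ⟨a, hj⟩, a, hj, h1, rfl⟩⟩
  · exact ⟨_, Or.inl ⟨⟨_, i, a, h, rfl⟩, h1.trans (push_singleton _ _), rfl⟩⟩

variable (R) in
theorem exists_faceHeight (hσ : σ.1.card = 3) : ∃ y, R.FaceHeight σ y := by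
  obtain ⟨i, s, hs, h1⟩ := D.exists_rep σ
  rw [h1, D.card_push hs] at hσ
  exact ⟨_, i, ⟨s, hs, hσ⟩, h1, rfl⟩

theorem potential_neg (hσ : σ.1.card = 1) : R.potential σ < 0 := by
  obtain ⟨y, hy⟩ := R.exists_vertexHeight hσ
  rw [Height.potential_eq (Or.inr hy)]
  rcases hy with hy | hy
  · linarith [hy.lt]
  · exact hy.neg

theorem potential_pos (hσ : σ.1.card = 3) : 0 < R.potential σ := by
  obtain ⟨y, hy⟩ := R.exists_faceHeight hσ
  rw [Height.potential_eq (Or.inl hy)]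
  exact hy.pos

theorem eq_singleton_of_subset_pair {α : Type*} {s t u : Finset α} {a b : α} (ht : t.card = 1)
    (hts : t ⊆ s) (hs : (s : Set α) = {a, b}) (hu : (u : Set α) = {a}) (htu : t ≠ u) :
    t = {b} := by
  obtain ⟨c, rfl⟩ := Finset.card_eq_one.1 ht
  have hc : c ∈ (s : Set α) := hts (Finset.mem_singleton_self c)
  rw [hs] at hc
  rcases hc with rfl | rfl
  · exact absurd (Finset.coe_injective (by rw [hu, Finset.coe_singleton])) htu
  · rfl

/-- The other endpoint of the paired edge is the parent, which is nearer to the root; if it is the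
boundary vertex of a piece, it lies in the lower band. -/
theorem potential_lt_of_vertex {p : Cell K × Cell K} (hp : p ∈ R.V) (hc : p.1.1.card = 1)
    {w : Cell K} (hw : IsFacet w p.2) (hne : w ≠ p.1) : R.potential w < R.potential p.1 := by
  have hwc : w.1.card = 1 := by
    have h1 := hw.2
    have h2 := (isFacet_of_mem_V hp).2
    omega
  have hne' : w.1 ≠ p.1.1 := fun h => hne (Subtype.ext h)
  rcases mem_V.1 hp with hb | ⟨i, hf⟩ | ⟨i, j, hv⟩
  · obtain ⟨a, b, hab, hd, h1, h2⟩ := hb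
    simp only at h1 h2
    have hwb := eq_singleton_of_subset_pair hwc hw.1 h2 h1 hne'
    rw [Height.potential_eq (Or.inr (Or.inl ⟨b, hwb, rfl⟩)),
      Height.potential_eq (Or.inr (Or.inl ⟨a, by exact_mod_cast h1, rfl⟩))]
    linarith [decay_lt_decay hd]
  · have := (facePairs_spec hf).2.1
    omega
  · obtain ⟨hj, r, ⟨a, b, hab, hd, h1, h2⟩, hr1, hr2⟩ := hv
    have ha : a.1 ∈ internalVertices j := by
      refine a.2.resolve_left fun h => ?_
      have : a = ⟨_, Set.mem_insert _ _⟩ := Subtype.ext h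
      rw [this, SimpleGraph.dist_self] at hd
      omega
    have hr1' : r.1 = {a.1} := by exact_mod_cast h1
    have hwb : w.1 = {D.q i b.1} := by
      refine eq_singleton_of_subset_pair hwc hw.1 (hr2 ▸ coe_push_pair _ h2) (u := p.1.1) ?_ hne'
      rw [hr1, hr1', push_singleton, Finset.coe_singleton]
    have hpa : R.InternalHeight p.1 _ := ⟨i, j, hj, a.1, ha, by rw [hr1, hr1'], rfl⟩
    rw [Height.potential_eq (Or.inr (Or.inr hpa))]
    rcases b.2 with hb | hb
    · have hwB : R.BoundaryHeight w _ :=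
        ⟨⟨D.q i b.1, i, b.1, by rw [hb]; exact (R.piece i j hj).b_boundary, rfl⟩, hwb, rfl⟩
      rw [Height.potential_eq (Or.inr (Or.inl hwB))]
      exact hwB.lt.trans_le hpa.ge
    · rw [Height.potential_eq (Or.inr (Or.inr
        ⟨i, j, hj, b.1, hb, hwb.trans (push_singleton _ _).symm, rfl⟩))]
      exact neg_lt_neg (decay_lt_decay hd)

/-- All triangles of `K` at an edge off the boundary come from the same polygon, so there is just
one besides the partner. It is nearer to the root and has the larger potential. -/
theorem potential_lt_of_face {p : Cell K × Cell K} (hp : p ∈ R.V) (hc : p.1.1.card = 2)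
    {G : Cell K} (hG : IsFacet p.1 G) (hne : G ≠ p.2) : R.potential p.2 < R.potential G := by
  rcases mem_V.1 hp with hb | ⟨i, hf⟩ | ⟨i, j, hv⟩
  · have := (boundaryPairs_spec hb).2.1
    omega
  · obtain ⟨F, F', e, he, hFF, heF, heF', hd, h1, h2⟩ := hf
    obtain ⟨k, s, hs, hGs⟩ := D.exists_rep G
    have hsub := hG.1
    rw [hGs, push, Finset.subset_image_iff] at hsub
    obtain ⟨e', he's, he'⟩ := hsub
    have hpe : push (D.q k) e' = push (D.q i) e := by
      rw [← h1]
      exact he'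
    have hne' : e'.Nonempty := by
      rw [← Finset.image_nonempty (f := D.q k), he']
      exact K.nonempty_of_mem_faces p.1.2
    obtain ⟨rfl, rfl⟩ := D.map_glue i k e he.1.1 e' ((D.P k).down_closed hs he's hne')
      hpe.symm he.2.1
    have hs3 : s.card = 3 := by
      rw [← D.card_push hs, ← hGs, hG.2, hc]
    have hGF : (⟨s, hs, hs3⟩ : Triangle (D.P i)) = F' := by
      have hsF : (⟨s, hs, hs3⟩ : Triangle (D.P i)) ≠ F := by
        rintro rfl
        exact hne (Subtype.ext (hGs.trans h2.symm))
      obtain ⟨t, t', -, -, -, ht⟩ := (D.isPolygon i).exists_pair_triangles he.1 he.2.1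
      rcases ht ⟨s, hs, hs3⟩ he's with h | h <;> rcases ht F heF with h' | h' <;>
        rcases ht F' heF' with h'' | h'' <;> simp_all
    rw [Height.potential_eq (Or.inl ⟨i, F, h2, rfl⟩),
      Height.potential_eq (Or.inl ⟨i, F', by rw [hGs, ← hGF], rfl⟩)]
    exact decay_lt_decay hd
  · have := (vertexPairs_spec hv).2.1
    omega

/-! ### The gradient function and its critical cells. -/

variable (R) in
theorem exists_negGradient_eq_V : ∃ f : Cell K → ℝ, negGradient f = R.V :=
  exists_negGradient_eq R.isDiscreteVectorField_V D.card_cell (φ := R.potential)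
    (fun _ => potential_neg) (fun _ => potential_pos)
    (fun _ hp hc _ => potential_lt_of_vertex hp hc) fun _ hp hc _ => potential_lt_of_face hp hc

theorem isCritical_iff_V {f : Cell K → ℝ} (hf : negGradient f = R.V) (σ : Cell K) :
    IsCritical f σ ↔ ∀ p ∈ R.V, p.1 ≠ σ ∧ p.2 ≠ σ :=
  isCritical_iff hf (fun _ => isFacet_of_mem_V) σ

/-- Any other vertex is paired with the edge to its parent. An internal vertex always has a parent,
because the root of its tree is a boundary vertex. -/
theorem eq_bdRoot_of_isCritical (hσ : σ.1.card = 1) (hc : ∀ p ∈ R.V, p.1 ≠ σ ∧ p.2 ≠ σ) :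
    σ.1 = {R.bdRoot.1} := by
  obtain ⟨y, ⟨x, hx, -⟩ | ⟨i, j, hj, a, ha, h1, -⟩⟩ := R.exists_vertexHeight hσ
  · by_contra hne
    have hxr : x ≠ R.bdRoot := by
      rintro rfl
      exact hne hx
    obtain ⟨b, hxb, hd⟩ := exists_adj_dist_lt R.bdTree_isTree.connected hxr
    obtain ⟨e, he, hexb, -⟩ := bdTree_edge hxb
    refine (hc (σ, ⟨e, he⟩) (mem_V.2 (Or.inl ⟨x, b, hxb, hd, ?_, hexb⟩))).1 rfl
    simp only
    rw [hx, Finset.coe_singleton]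
  · exfalso
    set C := R.piece i j hj
    have hab : (⟨a, mem_insert_of_mem _ ha⟩ : (insert C.b (internalVertices j) : Set Plane)) ≠
        ⟨C.b, mem_insert _ _⟩ := by
      intro h
      have hb := C.b_boundary
      have hab : a = C.b := Subtype.ext_iff.1 h
      rw [← hab] at hb
      exact ha.1.not_isBoundaryVertex hb
    obtain ⟨b, hadj, hd⟩ := exists_adj_dist_lt C.isTree.connected hab
    have hu : ({a, b.1} : Finset Plane) ∈ C.usedEdges := ⟨_, b, hadj, by simp⟩
    have hs := C.usedEdges_spec hu
    refine (hc (σ, ⟨push (D.q i) {a, b.1}, D.map_mem i _ hs.1.1⟩) (mem_V.2 (Or.inr (Or.inr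
      ⟨i, j, hj, ({a}, {a, b.1}), ⟨_, b, hadj, hd, by simp, by simp⟩, h1, rfl⟩)))).1 rfl

theorem ne_of_eq_bdRoot (hσ : σ.1 = {R.bdRoot.1}) {p : Cell K × Cell K} (hp : p ∈ R.V) :
    p.1 ≠ σ ∧ p.2 ≠ σ := by
  have hB : D.IsBoundaryCell σ.1 := hσ ▸ D.isBoundaryCell_singleton R.bdRoot
  refine ⟨?_, ?_⟩
  · rintro rfl
    rcases mem_V.1 hp with ⟨a, b, hab, hd, h1, h2⟩ | ⟨i, hf⟩ | ⟨i, j, hv⟩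
    · rw [hσ, Finset.coe_singleton] at h1
      rw [← Subtype.ext (singleton_injective h1), SimpleGraph.dist_self] at hd
      omega
    · exact (facePairs_spec hf).2.2.1 hB
    · exact (vertexPairs_spec hv).2.2.1 hB
  · rintro rfl
    have h1 := (isFacet_of_mem_V hp).2
    have h2 := Finset.card_pos.2 (K.nonempty_of_mem_faces p.1.2)
    rw [hσ, Finset.card_singleton] at h1
    omega

theorem encard_criticalCells_zero {f : Cell K → ℝ} (hf : negGradient f = R.V) :
    (criticalCells f 0).encard = 1 := by
  obtain ⟨i, v, hv, hvr⟩ := R.bdRoot.2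
  have hmem : ({R.bdRoot.1} : Finset E) ∈ K.faces := hvr ▸ D.push_mem_singleton hv.1
  rw [encard_eq_one]
  refine ⟨⟨_, hmem⟩, Set.ext fun σ => ⟨?_, ?_⟩⟩
  · rintro ⟨h1, h2⟩
    exact Subtype.ext (eq_bdRoot_of_isCritical h1 ((isCritical_iff_V hf σ).1 h2))
  · rintro rfl
    exact ⟨Finset.card_singleton _, (isCritical_iff_V hf _).2 fun p hp => ne_of_eq_bdRoot rfl hp⟩

/-- A 2-cell other than the root is paired with the edge towards its parent in the dual tree, and
the root is never the farther end of an edge. -/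
theorem isCritical_triangle_iff {i : Surface X₁} {F : Triangle (D.P i)}
    (hσ : σ.1 = push (D.q i) F.1) : (∀ p ∈ R.V, p.1 ≠ σ ∧ p.2 ≠ σ) ↔ F = R.rootFace i := by
  have hF := not_onBoundary_of_card_eq_three F.2.1 F.2.2
  have hσc : σ.1.card = 3 := by rw [hσ, D.card_push F.2.1, F.2.2]
  constructor
  · intro hc
    by_contra hne
    obtain ⟨F', hadj, hd⟩ := exists_adj_dist_lt (R.isTree_dualTree i).connected hne
    obtain ⟨hFF, e, he, he1, heF, heF'⟩ := dualGraph_adj.1 hadj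
    exact (hc (⟨push (D.q i) e, D.map_mem i e he1.1⟩, σ) (mem_V.2 (Or.inr (Or.inl
      ⟨i, F, F', e, he, hFF, heF, heF', hd, rfl, hσ⟩)))).2 rfl
  · rintro rfl p hp
    refine ⟨?_, ?_⟩
    · rintro rfl
      rcases mem_V.1 hp with h | ⟨i', h⟩ | ⟨i', j, h⟩
      · exact absurd (hσc.symm.trans (boundaryPairs_spec h).2.1) (by decide)
      · exact absurd (hσc.symm.trans (facePairs_spec h).2.1) (by decide)
      · exact absurd (hσc.symm.trans (vertexPairs_spec h).2.1) (by decide)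
    · rintro rfl
      have hcard := (isFacet_of_mem_V hp).2
      rcases mem_V.1 hp with h | ⟨i', h⟩ | ⟨i', j, h⟩
      · have := (boundaryPairs_spec h).2.1
        omega
      · obtain ⟨G, G', e, he, -, -, -, hd, -, h2⟩ := h
        obtain ⟨rfl, hG⟩ := D.map_glue i i' _ (R.rootFace i).2.1 G.1 G.2.1 (hσ ▸ h2) hF
        rw [← Subtype.ext hG, SimpleGraph.dist_self] at hd
        omega
      · have := (vertexPairs_spec h).2.1
        omega

/-- The root 2-cells of different polygons stay different in `K`, so they correspond bijectively to
the surfaces. -/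
theorem encard_criticalCells_two {f : Cell K → ℝ} (hf : negGradient f = R.V) :
    (criticalCells f 2).encard = ENat.card (Surface X₁) := by
  let c : Surface X₁ → Cell K := fun i =>
    ⟨push (D.q i) (R.rootFace i).1, D.map_mem i _ (R.rootFace i).2.1⟩
  have hc : Function.Injective c := fun i j hij =>
    (D.map_glue i j _ (R.rootFace i).2.1 _ (R.rootFace j).2.1 (congrArg Subtype.val hij)
      (not_onBoundary_of_card_eq_three (R.rootFace i).2.1 (R.rootFace i).2.2)).1
  have hrange : criticalCells f 2 = range c := by
    ext σ
    constructor
    · rintro ⟨h1, h2⟩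
      obtain ⟨i, s, hs, hσ⟩ := D.exists_rep σ
      have h3 : s.card = 3 := by rw [← D.card_push hs, ← hσ, h1]
      refine ⟨i, Subtype.ext ?_⟩
      rw [hσ]
      exact congrArg (fun F : Triangle (D.P i) => push (D.q i) F.1)
        ((isCritical_triangle_iff (F := ⟨s, hs, h3⟩) hσ).1 ((isCritical_iff_V hf σ).1 h2)).symm
    · rintro ⟨i, rfl⟩
      refine ⟨?_, (isCritical_iff_V hf _).2 ((isCritical_triangle_iff rfl).2 rfl)⟩
      exact (D.card_push (R.rootFace i).2.1).trans (R.rootFace i).2.2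
  rw [hrange, ← image_univ, hc.encard_image, encard_univ]

end Run

end Potential

end StratifoldMorse

theorem mainTheorem6
    {X : Type*} [TopologicalSpace X] {X₁ : Set X} (hX : StratifoldMorse.IsTwoStratifold X X₁)
    {E : Type*} [NormedAddCommGroup E] [NormedSpace ℝ E]
    (K : Geometry.SimplicialComplex ℝ E) (hK : K.faces.Finite) (h : K.space ≃ₜ X)
    (D : StratifoldMorse.PolygonPresentation X₁ K h) :
    -- the algorithm can be carried out
    Nonempty (StratifoldMorse.Run D) ∧
    -- and, whatever choices it makes,
    ∀ R : StratifoldMorse.Run D,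
      (∀ i, (R.dualTree i).IsTree) ∧
      StratifoldMorse.IsDiscreteVectorField R.V ∧
      ¬ StratifoldMorse.HasClosedVPath R.V ∧
      (∃ f : StratifoldMorse.Cell K → ℝ,
        StratifoldMorse.IsDiscreteMorse f ∧ StratifoldMorse.negGradient f = R.V) ∧
      ∀ f : StratifoldMorse.Cell K → ℝ,
        StratifoldMorse.IsDiscreteMorse f → StratifoldMorse.negGradient f = R.V →
          (StratifoldMorse.criticalCells f 0).encard = 1 ∧
          (StratifoldMorse.criticalCells f 2).encard = ENat.card (StratifoldMorse.Surface X₁) := by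
  refine ⟨D.nonempty_run hX hK, fun R => ?_⟩
  have hV := R.isDiscreteVectorField_V
  obtain ⟨f, hf⟩ := R.exists_negGradient_eq_V
  exact ⟨R.isTree_dualTree, hV, StratifoldMorse.not_hasClosedVPath hV hf,
    ⟨f, StratifoldMorse.isDiscreteMorse_of_negGradient hV hf, hf⟩,
    fun _ _ hf' => ⟨StratifoldMorse.Run.encard_criticalCells_zero hf',
      StratifoldMorse.Run.encard_criticalCells_two hf'⟩⟩
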